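/- \textbf{Setting.} Let $n\in\mathbb N$, $T>0$, let $\Omega\subset\mathbb R^n$ and $\Lambda\subset\mathbb R$ be open, $f:\Lambda\times\Omega\times[0,T]\to\mathbb R^n$, $g:\Omega\times[0,T]\to\mathbb R^n$, and let $h:(-\infty,T]\to\mathbb R$ be left-continuous, of bounded variation on $[0,T]$, with $h(t)=h(0)$ for $t<0$. Write $\|x\|=\sum_i|x_i|$ on $\mathbb R^n$ and $\|A\|=\max_i\sum_j|a_{ij}|$ for $n\times n$ matrices. Integrals with respect to $h$ or $\mathrm{var}_0^{\cdot}h$ are Kurzweil--Stieltjes integrals, and $f'_x,g'_x$ denote total differentials with respect to $x$. $G[0,T]$ is the Banach space of regulated functions $[0,T]\to\mathbb R^n$ (all one-sided limits exist) with the norm $\|\cdot\|_\infty$, and $B(x_0,\rho)$ is the closed ball in $G[0,T]$. \textbf{Assumptions.} \begin{enumerate} \item $f(\lambda,\cdot,t)$ is continuous on $\Omega$ for all $\lambda\in\Lambda$, $t\in[0,T]$; $f(\lambda,x,\cdot)$ is Lebesgue measurable for all $\lambda\in\Lambda$, $x\in\Omega$; there is a Lebesgue integrable $m:[0,T]\to[0,\infty)$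 with $\|f(\lambda,x,t)\|\le m(t)$ on $\Lambda\times\Omega\times[0,T]$. \item $g(\cdot,t)$ is continuous on $\Omega$ for all $t\in[0,T]$; $\int_0^Tg(x,s)\,dh(s)$ exists for all $x\in\Omega$; there is $m_h:[0,T]\to[0,\infty)$ such that $\int_0^Tm_h(t)\,d[\mathrm{var}_0^th]$ exists (and is finite) and $\|g(x,t)\|\le m_h(t)$ on $\Omega\times[0,T]$. \item $f'_x$ exists on $\Lambda\times\Omega\times[0,T]$ and is continuous in $x\in\Omega$ for all $\lambda\in\Lambda$, $t\in[0,T]$; there is a Lebesgue integrable $\Theta$ on $[0,T]$ with $\|f'_x(\lambda,x,t)\|\le\Theta(t)$ on $\Lambda\times\Omega\times[0,T]$. \item $g'_x$ exists and is bounded on $\Omega\times[0,T]$ and is continuous in $x\in\Omega$ for all $t\in[0,T]$; there is $\Theta_h:[0,T]\to\mathbb R$ such that $\int_0^T\Theta_h(s)\,d[\mathrm{var}_0^sh]$ exists (and is finite) and $\|g'_x(x,t)\|\le\Theta_h(t)$ on $\Omega\times[0,T]$. \item $x_0\in G[0,T]$ is such that, for every $\lambda\in\Lambda$, $(x_0,\lambda)$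 is a solution of $$Dx=f(\lambda,x,t)+g(x,t)\,.\,Dh,\qquad x(0)=x(T),$$ that is: $x_0$ has bounded variation, is left-continuous on $(0,T]$, takes values in $\Omega$, $x_0(0)=x_0(T)$, the integral $\int_0^Tg(x_0(s),s)\,dh(s)$ exists, and $Dx_0=f(\lambda,x_0(\cdot),\cdot)+DH$, where $H(t)=\int_0^tg(x_0(s),s)\,dh(s)$ and $D$ is the distributional derivative, tested with the $C^\infty$ functions $\varphi:\mathbb R\to\mathbb R^n$ that vanish outside $(0,T)$. Moreover, $\rho>0$ is such that $x(t)\in\Omega$ for all $x\in B(x_0,\rho)$ and $t\in[0,T]$. \item There is a nondecreasing $\gamma:[0,T]\to\mathbb R$ such that for every $\varepsilon>0$ there is $\delta>0$ with $$\Big\|\int_s^t[f(\lambda_2,x,r)-f(\lambda_1,x,r)]\,dr\Big\|\le\varepsilon\,|\gamma(t)-\gamma(s)|$$ for all $x\in\Omega$, $s,t\in[0,T]$ and $\lambda_1,\lambda_2\in\Lambda$ with $|\lambda_1-\lambda_2|<\delta$. \item There is a nondecreasing $\widetilde\gamma:[0,T]\to\mathbb R$ such that for every $\varepsilon>0$ there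 is $\delta>0$ with $$\Big\|\int_s^t[f'_x(\lambda_1,x,r)-f'_x(\lambda_2,y,r)]\,dr+\int_s^t[g'_x(x,r)-g'_x(y,r)]\,dh(r)\Big\|\le\varepsilon\,|\widetilde\gamma(t)-\widetilde\gamma(s)|$$ for all $s,t\in[0,T]$, $x,y\in\Omega$, $\lambda_1,\lambda_2\in\Lambda$ with $|\lambda_1-\lambda_2|+\|x-y\|<\delta$. \end{enumerate} For $\lambda\in\Lambda$ and $x\in B(x_0,\rho)$ let $$\widetilde\Phi(\lambda,x)(t)=x(T)+\int_0^tf(\lambda,x(s),s)\,ds+\int_0^tg(x(s),s)\,dh(s),\qquad t\in[0,T].$$ A couple $(y,\mu)\in B(x_0,\rho)\times\Lambda$ is a bifurcation point of the equation $\widetilde\Phi(\lambda,x)=x$ if $\widetilde\Phi(\mu,y)=y$ and every neighbourhood of $(y,\mu)$ in $B(x_0,\rho)\times\Lambda$ contains some $(x,\lambda)$ with $\widetilde\Phi(\lambda,x)=x$ and $x\ne y$. \textbf{Theorem.} Let $\lambda_0\in\Lambda$ be such that $\mathrm{Id}-\widetilde\Phi'_x(\lambda_0,x_0)$ is an isomorphism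 of $G[0,T]$ onto $G[0,T]$, where $\widetilde\Phi'_x(\lambda_0,x_0)$ is the Fr\'echet derivative of $\widetilde\Phi(\lambda_0,\cdot)$ at $x_0$ (which exists under the assumptions above). Then there is $\delta>0$ such that $(x,\lambda)$ is not a bifurcation point of the equation $\widetilde\Phi(\lambda,x)=x$ whenever $\|x-x_0\|_\infty+|\lambda-\lambda_0|<\delta$. -/

import Mathlib

open MeasureTheory Set Filter Topology
open scoped ENNReal ContDiff

namespace MDEBif

noncomputable section

/-- The space of column vectors with the norm `‖x‖ = ∑ i, |x i|`. -/
abbrev Vec (n : ℕ) : Type := PiLp 1 (fun _ : Fin n => ℝ)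

/-- The scalar product of two vectors. -/
def dot {n : ℕ} (x y : Vec n) : ℝ := ∑ i, x i * y i

/-- The maximal absolute row sum of the matrix that represents `A` in the standard basis. -/
def matNorm {n : ℕ} (A : Vec n →L[ℝ] Vec n) : ℝ :=
  ⨆ i : Fin n, ∑ j : Fin n, |(A (PiLp.single 1 j (1 : ℝ))) i|

/-! ## The Kurzweil-Stieltjes integral -/

/-- Tagged partitions `a = t₀ ≤ t₁ ≤ ⋯ ≤ t_ν = b` with tags `τ_j ∈ [t_j, t_{j+1}]`, `j < ν`. -/
structure TaggedPart (a b : ℝ) where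
  size : ℕ
  pt : ℕ → ℝ
  tag : ℕ → ℝ
  pt_zero : pt 0 = a
  pt_size : pt size = b
  tag_mem : ∀ j < size, pt j ≤ tag j ∧ tag j ≤ pt (j + 1)

/-- `P` is fine with respect to the gauge `δ`. -/
def TaggedPart.IsFine {a b : ℝ} (P : TaggedPart a b) (δ : ℝ → ℝ) : Prop :=
  ∀ j < P.size, Icc (P.pt j) (P.pt (j + 1)) ⊆
    Ioo (P.tag j - δ (P.tag j)) (P.tag j + δ (P.tag j))

/-- The integral sum `∑ j, (h(t_{j+1}) - h(t_j)) g(τ_j)`. -/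
def TaggedPart.sum {a b : ℝ} {X : Type*} [NormedAddCommGroup X] [NormedSpace ℝ X]
    (P : TaggedPart a b) (g : ℝ → X) (h : ℝ → ℝ) : X :=
  ∑ j ∈ Finset.range P.size, (h (P.pt (j + 1)) - h (P.pt j)) • g (P.tag j)

/-- `I` is the Kurzweil-Stieltjes integral of `g` with respect to `h` over `[a, b]`, `a ≤ b`. -/
def HasKSIntegral {X : Type*} [NormedAddCommGroup X] [NormedSpace ℝ X]
    (g : ℝ → X) (h : ℝ → ℝ) (a b : ℝ) (I : X) : Prop :=
  ∀ ε > 0, ∃ δ : ℝ → ℝ, (∀ s, 0 < δ s) ∧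
    ∀ P : TaggedPart a b, P.IsFine δ → ‖P.sum g h - I‖ < ε

/-- Existence of the Kurzweil-Stieltjes integral over `[a, b]`, `a ≤ b`. -/
def KSIntegrable {X : Type*} [NormedAddCommGroup X] [NormedSpace ℝ X]
    (g : ℝ → X) (h : ℝ → ℝ) (a b : ℝ) : Prop :=
  ∃ I : X, HasKSIntegral g h a b I

open Classical in
/-- The value of the Kurzweil-Stieltjes integral; for `b < a` it is minus the integral over
`[b, a]`. If the integral does not exist, the value is `0` by convention. -/
def ksIntegral {X : Type*} [NormedAddCommGroup X] [NormedSpace ℝ X]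
    (g : ℝ → X) (h : ℝ → ℝ) (a b : ℝ) : X :=
  if a ≤ b then (if H : KSIntegrable g h a b then H.choose else 0)
  else -(if H : KSIntegrable g h b a then H.choose else 0)

/-- The variation function `t ↦ var_0^t h` of `h` on `[0, T]`. -/
def varFun (T : ℝ) (h : ℝ → ℝ) (t : ℝ) : ℝ := variationOnFromTo h (Icc 0 T) 0 t

/-! ## The Banach space of regulated functions -/

/-- One-sided limits exist at every point of `[0, T]` from each side that is available: the
filter `𝓝[<] t` of the subtype is trivial at the left end and `𝓝[>] t` at the right end. -/
def IsRegulated {n : ℕ} {T : ℝ} (x : Icc (0 : ℝ) T → Vec n) : Prop :=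
  ∀ t, (∃ l, Tendsto x (𝓝[<] t) (𝓝 l)) ∧ (∃ l, Tendsto x (𝓝[>] t) (𝓝 l))

theorem IsRegulated.bounded {n : ℕ} {T : ℝ} {x : Icc (0 : ℝ) T → Vec n} (hx : IsRegulated x) :
    ∃ C, ∀ t, ‖x t‖ ≤ C := by
  have key : ∃ C, ∀ t ∈ (univ : Set (Icc (0 : ℝ) T)), ‖x t‖ ≤ C := by
    refine isCompact_univ.induction_on (p := fun s => ∃ C, ∀ t ∈ s, ‖x t‖ ≤ C) ?_ ?_ ?_ ?_
    · exact ⟨0, by simp⟩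
    · rintro s t hst ⟨C, hC⟩
      exact ⟨C, fun u hu => hC u (hst hu)⟩
    · rintro s t ⟨C, hC⟩ ⟨D, hD⟩
      refine ⟨max C D, ?_⟩
      rintro u (hu | hu)
      · exact (hC u hu).trans (le_max_left _ _)
      · exact (hD u hu).trans (le_max_right _ _)
    · intro t _
      obtain ⟨⟨l, hl⟩, ⟨r, hr⟩⟩ := hx t
      have h1 : ∀ᶠ u in 𝓝[<] t, ‖x u‖ < ‖l‖ + 1 :=
        hl.norm.eventually (gt_mem_nhds (lt_add_one _))
      have h2 : ∀ᶠ u in 𝓝[>] t, ‖x u‖ < ‖r‖ + 1 :=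
        hr.norm.eventually (gt_mem_nhds (lt_add_one _))
      rw [eventually_nhdsWithin_iff] at h1 h2
      refine ⟨{u | ‖x u‖ ≤ max (max (‖l‖ + 1) (‖r‖ + 1)) ‖x t‖}, ?_, _, fun u hu => hu⟩
      rw [nhdsWithin_univ]
      filter_upwards [h1, h2] with u hu1 hu2
      rcases lt_trichotomy u t with h | h | h
      · exact (hu1 h).le.trans ((le_max_left _ _).trans (le_max_left _ _))
      · subst h
        exact le_max_right _ _
      · exact (hu2 h).le.trans ((le_max_right _ _).trans (le_max_left _ _))
  obtain ⟨C, hC⟩ := key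
  exact ⟨C, fun t => hC t (mem_univ t)⟩

theorem IsRegulated.memLp {n : ℕ} {T : ℝ} {x : Icc (0 : ℝ) T → Vec n} (hx : IsRegulated x) :
    Memℓp x ∞ := by
  obtain ⟨C, hC⟩ := hx.bounded
  refine memℓp_infty ⟨C, ?_⟩
  rintro _ ⟨t, rfl⟩
  exact hC t

/-- Regulated functions form a linear subspace of the bounded functions with the sup norm. -/
def regSubmodule (n : ℕ) (T : ℝ) :
    Submodule ℝ (lp (fun _ : Icc (0 : ℝ) T => Vec n) ∞) where
  carrier := {x | IsRegulated (x : Icc (0 : ℝ) T → Vec n)}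
  add_mem' := by
    intro x y hx hy t
    obtain ⟨⟨l, hl⟩, ⟨r, hr⟩⟩ := hx t
    obtain ⟨⟨l', hl'⟩, ⟨r', hr'⟩⟩ := hy t
    exact ⟨⟨_, hl.add hl'⟩, ⟨_, hr.add hr'⟩⟩
  zero_mem' := fun _ => ⟨⟨0, tendsto_const_nhds⟩, ⟨0, tendsto_const_nhds⟩⟩
  smul_mem' := by
    intro c x hx t
    obtain ⟨⟨l, hl⟩, ⟨r, hr⟩⟩ := hx t
    exact ⟨⟨_, hl.const_smul c⟩, ⟨_, hr.const_smul c⟩⟩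

/-- The space `G[0, T]` of regulated functions `[0, T] → ℝⁿ` with the sup norm. -/
abbrev Reg (n : ℕ) (T : ℝ) : Type := ↥(regSubmodule n T)

/-- A regulated function as an element of `G[0, T]`. -/
def Reg.mk {n : ℕ} {T : ℝ} (x : Icc (0 : ℝ) T → Vec n) (hx : IsRegulated x) : Reg n T :=
  ⟨⟨x, hx.memLp⟩, hx⟩

open Classical in
/-- The value `x(s)` for `s ∈ [0, T]` (and `0` elsewhere, a value that is never used). -/
def Reg.val {n : ℕ} {T : ℝ} (x : Reg n T) (s : ℝ) : Vec n :=
  if hs : s ∈ Icc (0 : ℝ) T then (x : lp (fun _ : Icc (0 : ℝ) T => Vec n) ∞) ⟨s, hs⟩ else 0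

/-! ## The measure differential equation -/

/-- Test functions: smooth vector functions on the line that vanish outside `(0, T)`. -/
def IsTest {n : ℕ} (T : ℝ) (φ : ℝ → Vec n) : Prop :=
  ContDiff ℝ ∞ φ ∧ ∀ t, t ∉ Ioo 0 T → φ t = 0

/-- The regular distribution `⟨u, φ⟩ = ∫_0^T u(t) φ(t) dt`. -/
def pairing {n : ℕ} (T : ℝ) (u φ : ℝ → Vec n) : ℝ := ∫ t in (0 : ℝ)..T, dot (u t) (φ t)

/-- The distributional derivative `⟨Du, φ⟩ = -⟨u, φ'⟩`. -/
def pairingD {n : ℕ} (T : ℝ) (u φ : ℝ → Vec n) : ℝ := -pairing T u (deriv φ)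

/-- `x` is a solution of `Dx = f(lam, x, t) + g(x, t) . Dh`, `x(0) = x(T)`, in the sense of
distributions. The product `g(x, t) . Dh` has a sense if the Kurzweil-Stieltjes integral over
`[0, T]` exists, and it is then the distributional derivative of the indefinite integral. -/
structure IsPeriodicSolution {n : ℕ} (T : ℝ) (Ω : Set (Vec n)) (f : ℝ → Vec n → ℝ → Vec n)
    (g : Vec n → ℝ → Vec n) (h : ℝ → ℝ) (x : Reg n T) (lam : ℝ) : Prop where
  bv : BoundedVariationOn x.val (Icc 0 T)
  left_cont : ∀ t ∈ Ioc 0 T, ContinuousWithinAt x.val (Iic t) t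
  mem : ∀ t ∈ Icc 0 T, x.val t ∈ Ω
  product : KSIntegrable (fun s => g (x.val s) s) h 0 T
  eqn : ∀ φ : ℝ → Vec n, IsTest T φ →
    pairingD T x.val φ = pairing T (fun t => f lam (x.val t) t) φ
      + pairingD T (fun t => ksIntegral (fun s => g (x.val s) s) h 0 t) φ
  periodic : x.val 0 = x.val T

/-- The function
`t ↦ x(T) + ∫_0^t f(lam, x(s), s) ds + ∫_0^t g(x(s), s) dh(s)` on `[0, T]`. -/
def phiFun {n : ℕ} {T : ℝ} (f : ℝ → Vec n → ℝ → Vec n) (g : Vec n → ℝ → Vec n) (h : ℝ → ℝ)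
    (lam : ℝ) (x : Reg n T) (t : Icc (0 : ℝ) T) : Vec n :=
  x.val T + (∫ s in (0 : ℝ)..t, f lam (x.val s) s) + ksIntegral (fun s => g (x.val s) s) h 0 t

open Classical in
/-- The operator `Φ̃(lam, ·)`, as a map from `G[0, T]` to `G[0, T]`. The convention `0` concerns
only functions `x` outside the domain of the operator. -/
def phi {n : ℕ} {T : ℝ} (f : ℝ → Vec n → ℝ → Vec n) (g : Vec n → ℝ → Vec n) (h : ℝ → ℝ)
    (lam : ℝ) (x : Reg n T) : Reg n T :=
  if H : IsRegulated (phiFun f g h lam x) then Reg.mk _ H else 0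

/-- `(y, mu)` is a solution in `K × Λ` of `Φ̃(lam, x) = x`, each neighbourhood of which in `K × Λ`
contains a solution `(x, lam)` with `x ≠ y`. -/
def IsBifurcationPoint {n : ℕ} {T : ℝ} (f : ℝ → Vec n → ℝ → Vec n) (g : Vec n → ℝ → Vec n)
    (h : ℝ → ℝ) (K : Set (Reg n T)) (Λ : Set ℝ) (y : Reg n T) (mu : ℝ) : Prop :=
  (y ∈ K ∧ mu ∈ Λ ∧ phi f g h mu y = y) ∧
    ∀ U ∈ 𝓝[K ×ˢ Λ] (y, mu), ∃ x lam, (x, lam) ∈ U ∧ x ∈ K ∧ lam ∈ Λ ∧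
      phi f g h lam x = x ∧ x ≠ y

/-! ## The hypotheses -/

/-- `h : (-∞, T] → ℝ` is left-continuous, has bounded variation on `[0, T]` and is constant on
the negative half-line. -/
structure IntegratorCond (T : ℝ) (h : ℝ → ℝ) : Prop where
  left_cont : ∀ t ≤ T, ContinuousWithinAt h (Iic t) t
  bv : BoundedVariationOn h (Icc 0 T)
  const : ∀ t < 0, h t = h 0

/-- Carathéodory conditions on `f`. -/
structure CaraCond {n : ℕ} (T : ℝ) (Ω : Set (Vec n)) (Λ : Set ℝ)
    (f : ℝ → Vec n → ℝ → Vec n) : Prop where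
  cont : ∀ lam ∈ Λ, ∀ t ∈ Icc 0 T, ContinuousOn (fun x => f lam x t) Ω
  meas : ∀ lam ∈ Λ, ∀ x ∈ Ω, AEStronglyMeasurable (f lam x) (volume.restrict (Icc 0 T))
  bound : ∃ m : ℝ → ℝ, (∀ t ∈ Icc 0 T, 0 ≤ m t) ∧ IntegrableOn m (Icc 0 T) ∧
    ∀ lam ∈ Λ, ∀ x ∈ Ω, ∀ t ∈ Icc 0 T, ‖f lam x t‖ ≤ m t

/-- Conditions on `g`, including that `∫_0^T g(x, s) dh(s)` has a sense for `x ∈ Ω`. -/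
structure StieltjesCond {n : ℕ} (T : ℝ) (Ω : Set (Vec n)) (g : Vec n → ℝ → Vec n)
    (h : ℝ → ℝ) : Prop where
  cont : ∀ t ∈ Icc 0 T, ContinuousOn (fun x => g x t) Ω
  integrable : ∀ x ∈ Ω, KSIntegrable (g x) h 0 T
  bound : ∃ m : ℝ → ℝ, (∀ t ∈ Icc 0 T, 0 ≤ m t) ∧ KSIntegrable m (varFun T h) 0 T ∧
    ∀ x ∈ Ω, ∀ t ∈ Icc 0 T, ‖g x t‖ ≤ m t

/-- The total differential `f'_x(lam, x, t)`. -/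
def dfx {n : ℕ} (f : ℝ → Vec n → ℝ → Vec n) (lam : ℝ) (x : Vec n) (t : ℝ) :
    Vec n →L[ℝ] Vec n := fderiv ℝ (fun y => f lam y t) x

/-- The total differential `g'_x(x, t)`. -/
def dgx {n : ℕ} (g : Vec n → ℝ → Vec n) (x : Vec n) (t : ℝ) :
    Vec n →L[ℝ] Vec n := fderiv ℝ (fun y => g y t) x

/-- `f` has a total differential in `x`, continuous in `x`, with an integrable bound. -/
structure DiffCondF {n : ℕ} (T : ℝ) (Ω : Set (Vec n)) (Λ : Set ℝ)
    (f : ℝ → Vec n → ℝ → Vec n) : Prop where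
  diff : ∀ lam ∈ Λ, ∀ x ∈ Ω, ∀ t ∈ Icc 0 T, DifferentiableAt ℝ (fun y => f lam y t) x
  cont : ∀ lam ∈ Λ, ∀ t ∈ Icc 0 T, ContinuousOn (fun x => dfx f lam x t) Ω
  bound : ∃ θ : ℝ → ℝ, IntegrableOn θ (Icc 0 T) ∧
    ∀ lam ∈ Λ, ∀ x ∈ Ω, ∀ t ∈ Icc 0 T, matNorm (dfx f lam x t) ≤ θ t

/-- `g` has a bounded total differential in `x`, continuous in `x`, with a bound that is
integrable with respect to the variation of `h`. -/
structure DiffCondG {n : ℕ} (T : ℝ) (Ω : Set (Vec n)) (g : Vec n → ℝ → Vec n)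
    (h : ℝ → ℝ) : Prop where
  diff : ∀ x ∈ Ω, ∀ t ∈ Icc 0 T, DifferentiableAt ℝ (fun y => g y t) x
  bdd : ∃ C : ℝ, ∀ x ∈ Ω, ∀ t ∈ Icc 0 T, matNorm (dgx g x t) ≤ C
  cont : ∀ t ∈ Icc 0 T, ContinuousOn (fun x => dgx g x t) Ω
  bound : ∃ θ : ℝ → ℝ, KSIntegrable θ (varFun T h) 0 T ∧
    ∀ x ∈ Ω, ∀ t ∈ Icc 0 T, matNorm (dgx g x t) ≤ θ t

/-- Uniform continuity in the parameter of the integrals of `f`. -/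
def ParamCond {n : ℕ} (T : ℝ) (Ω : Set (Vec n)) (Λ : Set ℝ)
    (f : ℝ → Vec n → ℝ → Vec n) : Prop :=
  ∃ γ : ℝ → ℝ, MonotoneOn γ (Icc 0 T) ∧ ∀ ε > 0, ∃ δ > 0,
    ∀ x ∈ Ω, ∀ t ∈ Icc 0 T, ∀ s ∈ Icc 0 T, ∀ lam₁ ∈ Λ, ∀ lam₂ ∈ Λ, |lam₁ - lam₂| < δ →
      ‖∫ r in s..t, (f lam₂ x r - f lam₁ x r)‖ ≤ ε * |γ t - γ s|

/-- Uniform continuity in the parameter and in `x` of the integrals of the differentials. -/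
def ParamDiffCond {n : ℕ} (T : ℝ) (Ω : Set (Vec n)) (Λ : Set ℝ)
    (f : ℝ → Vec n → ℝ → Vec n) (g : Vec n → ℝ → Vec n) (h : ℝ → ℝ) : Prop :=
  ∃ γ : ℝ → ℝ, MonotoneOn γ (Icc 0 T) ∧ ∀ ε > 0, ∃ δ > 0,
    ∀ t ∈ Icc 0 T, ∀ s ∈ Icc 0 T, ∀ x ∈ Ω, ∀ y ∈ Ω, ∀ lam₁ ∈ Λ, ∀ lam₂ ∈ Λ,
      |lam₁ - lam₂| + ‖x - y‖ < δ →
      matNorm ((∫ r in s..t, (dfx f lam₁ x r - dfx f lam₂ y r))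
        + ksIntegral (fun r => dgx g x r - dgx g y r) h s t) ≤ ε * |γ t - γ s|

end

end MDEBif

/-!
The operators `Φ̃(λ, ·)` are differentiable at `x₀`: the superposition operators of `f(λ, ·, ·)` and
`g` have pointwise small remainders, relative to `‖x - x₀‖`, and the remainders integrate to
something small by dominated convergence, for the Lebesgue and for the Kurzweil-Stieltjes integral.

The difference `Φ̃(λ, ·) - Φ̃(λ₀, ·)` does not involve `g` and has a small Lipschitz constant at
`x₀` when `λ` is close to `λ₀`: on a cell of a fine partition the curves `x` and `x₀` are almost
constant, and for constant arguments the mean value theorem applies to the integral over the cell,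
whose derivative is controlled by the condition on `f'_x`. The value `p = Φ̃(λ, x₀)` does not depend
on `λ`, as the equations for `(x₀, λ)` and `(x₀, λ₀)` have the same distributional derivative on
the left.

With `e = Id - Φ̃'_x(λ₀, x₀)`, every solution of `Φ̃(λ, x) = x` near `(x₀, λ₀)` thus satisfies
`‖e (x - x₀) - (p - x₀)‖ ≤ ε ‖x - x₀‖`. If `p = x₀`, then invertibility of `e` forces `x = x₀`; if
`p ≠ x₀`, there is no such `x` close to `x₀`. In both cases `x₀` is the only possible solution near
`(x₀, λ₀)`.
-/

namespace MDEBif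

/-! ## Fine chains of tagged cells -/

/-- A tagged compact interval `[lo, hi]`. -/
structure Cell where
  tag : ℝ
  lo : ℝ
  hi : ℝ

/-- `Chain a b l`: the cells of `l` are consecutive and lead from `a` to `b`. Cutting a cell at its
tag changes neither an integral sum nor its fineness, so only cells tagged at an end point are
admitted. -/
inductive Chain : ℝ → ℝ → List Cell → Prop
  | nil (a : ℝ) : Chain a a []
  | cons {a c b τ : ℝ} {l : List Cell} (hac : a ≤ c) (hτ : τ = a ∨ τ = c) (hl : Chain c b l) :
      Chain a b (⟨τ, a, c⟩ :: l)

/-- Fineness with respect to the gauge `δ`: each cell of `l` is shorter than `δ` at its tag. -/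
def FineFor (δ : ℝ → ℝ) (l : List Cell) : Prop := ∀ x ∈ l, x.hi - x.lo < δ x.tag

theorem FineFor.mono {δ δ' : ℝ → ℝ} {l : List Cell} (h : FineFor δ l) (hδ : ∀ s, δ s ≤ δ' s) :
    FineFor δ' l := fun x hx => (h x hx).trans_le (hδ _)

@[simp]
theorem fineFor_nil (δ : ℝ → ℝ) : FineFor δ [] := by simp [FineFor]

@[simp]
theorem fineFor_cons {δ : ℝ → ℝ} {x : Cell} {l : List Cell} :
    FineFor δ (x :: l) ↔ x.hi - x.lo < δ x.tag ∧ FineFor δ l := List.forall_mem_cons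

@[simp]
theorem fineFor_append {δ : ℝ → ℝ} {l l' : List Cell} :
    FineFor δ (l ++ l') ↔ FineFor δ l ∧ FineFor δ l' := List.forall_mem_append

theorem Chain.le {a b : ℝ} {l : List Cell} (h : Chain a b l) : a ≤ b := by
  induction h with
  | nil a => exact le_rfl
  | cons hac _ _ ih => exact hac.trans ih

theorem Chain.append {a b c : ℝ} {l l' : List Cell} (h : Chain a b l) (h' : Chain b c l') :
    Chain a c (l ++ l') := by
  induction h with
  | nil a => exact h'
  | cons hac hτ _ ih => exact .cons hac hτ (ih h')

theorem Chain.mem {a b : ℝ} {l : List Cell} (h : Chain a b l) : ∀ x ∈ l,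
    a ≤ x.lo ∧ x.lo ≤ x.hi ∧ x.hi ≤ b ∧ (x.tag = x.lo ∨ x.tag = x.hi) := by
  induction h with
  | nil a => simp
  | cons hac hτ hl ih =>
    refine List.forall_mem_cons.2 ⟨⟨le_rfl, hac, hl.le, hτ⟩, fun x hx => ?_⟩
    exact (ih x hx).imp_left hac.trans

theorem Chain.tag_mem {a b : ℝ} {l : List Cell} (h : Chain a b l) {x : Cell} (hx : x ∈ l) :
    x.tag ∈ Icc a b := by
  obtain ⟨h1, h2, h3, h4 | h4⟩ := h.mem x hx <;> rw [h4] <;> constructor <;> linarith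

/-- Cousin's lemma. -/
theorem exists_fine_chain {a b : ℝ} (hab : a ≤ b) {δ : ℝ → ℝ} (hδ : ∀ s ∈ Icc a b, 0 < δ s) :
    ∃ l, Chain a b l ∧ FineFor δ l := by
  set S : Set ℝ := {x | x ≤ b ∧ ∃ l, Chain a x l ∧ FineFor δ l}
  have haS : a ∈ S := ⟨hab, [], .nil a, fineFor_nil δ⟩
  have hbdd : BddAbove S := ⟨b, fun x hx => hx.1⟩
  have snoc : ∀ x y τ, x ∈ S → x ≤ y → y ≤ b → (τ = x ∨ τ = y) → y - x < δ τ → y ∈ S := by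
    rintro x y τ ⟨-, l, hl, hf⟩ hxy hyb hτ hd
    exact ⟨hyb, l ++ [⟨τ, x, y⟩], hl.append (.cons hxy hτ (.nil y)), by simp [hf, hd]⟩
  set s := sSup S
  have has : a ≤ s := le_csSup hbdd haS
  have hsb : s ≤ b := csSup_le ⟨a, haS⟩ fun x hx => hx.1
  have hδs : 0 < δ s := hδ s ⟨has, hsb⟩
  have hsS : s ∈ S := by
    obtain ⟨x, hxS, hx⟩ := exists_lt_of_lt_csSup ⟨a, haS⟩ (sub_lt_self s hδs)
    exact snoc x s s hxS (le_csSup hbdd hxS) hsb (.inr rfl) (by linarith)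
  have hnext : min b (s + δ s / 2) ∈ S :=
    snoc s _ s hsS (le_min hsb (by linarith)) (min_le_left _ _) (.inl rfl)
      (by linarith [min_le_right b (s + δ s / 2)])
  have hbs : b ≤ s := (min_le_iff.1 (le_csSup hbdd hnext)).resolve_right (by linarith)
  exact hsb.antisymm hbs ▸ hsS.2

theorem Chain.rel_of_forall_mem {P : ℝ → ℝ → Prop} {a b c d : ℝ} {l : List Cell}
    (hl : Chain c d l) (hac : a ≤ c) (hdb : d ≤ b) (refl : ∀ x, P x x)
    (trans : ∀ x y z, a ≤ x → x ≤ y → y ≤ z → z ≤ b → P x y → P y z → P x z)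
    (hP : ∀ x ∈ l, P x.lo x.hi) : P c d := by
  induction hl with
  | nil c => exact refl c
  | cons hcd _ hl ih =>
    rw [List.forall_mem_cons] at hP
    exact trans _ _ _ hac hcd hl.le hdb hP.1 (ih (hac.trans hcd) hdb hP.2)

theorem cousin_induction {P : ℝ → ℝ → Prop} {a b : ℝ} (hab : a ≤ b) (refl : ∀ x, P x x)
    (trans : ∀ x y z, a ≤ x → x ≤ y → y ≤ z → z ≤ b → P x y → P y z → P x z)
    (loc : ∀ t ∈ Icc a b, ∃ η > 0, ∀ c d, a ≤ c → c < d → d ≤ b → (t = c ∨ t = d) →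
      d - c < η → P c d) : P a b := by
  choose! η hη hP using loc
  obtain ⟨l, hl, hf⟩ := exists_fine_chain hab hη
  refine hl.rel_of_forall_mem le_rfl le_rfl refl trans fun x hx => ?_
  obtain ⟨hax, hx', hxb, htag⟩ := hl.mem x hx
  rcases hx'.eq_or_lt with heq | hlt
  · exact heq ▸ refl _
  · exact hP _ (hl.tag_mem hx) _ _ hax hlt hxb htag (hf x hx)

/-- The filter of chains from `a` to `b` that become finer than every gauge; Kurzweil-Stieltjes
integrals are limits of integral sums along it. -/
def gaugeFilter (a b : ℝ) : Filter (List Cell) :=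
  ⨅ δ ∈ {δ : ℝ → ℝ | ∀ s, 0 < δ s}, 𝓟 {l | Chain a b l ∧ FineFor δ l}

theorem gaugeFilter_hasBasis (a b : ℝ) : (gaugeFilter a b).HasBasis
    (fun δ : ℝ → ℝ => ∀ s, 0 < δ s) fun δ => {l | Chain a b l ∧ FineFor δ l} := by
  refine hasBasis_biInf_principal ?_ ⟨fun _ => 1, fun _ => one_pos⟩
  intro δ hδ δ' hδ'
  exact ⟨fun s => min (δ s) (δ' s), fun s => lt_min (hδ s) (hδ' s),
    fun l hl => ⟨hl.1, hl.2.mono fun s => min_le_left _ _⟩,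
    fun l hl => ⟨hl.1, hl.2.mono fun s => min_le_right _ _⟩⟩

theorem eventually_gaugeFilter {a b : ℝ} {p : List Cell → Prop} :
    (∀ᶠ l in gaugeFilter a b, p l) ↔
      ∃ δ : ℝ → ℝ, (∀ s, 0 < δ s) ∧ ∀ l, Chain a b l → FineFor δ l → p l := by
  simp only [(gaugeFilter_hasBasis a b).eventually_iff, mem_ofPred_eq, and_imp]

theorem eventually_chain (a b : ℝ) : ∀ᶠ l in gaugeFilter a b, Chain a b l :=
  eventually_gaugeFilter.2 ⟨fun _ => 1, fun _ => one_pos, fun _ h _ => h⟩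

theorem eventually_fineFor (a b : ℝ) {δ : ℝ → ℝ} (hδ : ∀ s, 0 < δ s) :
    ∀ᶠ l in gaugeFilter a b, FineFor δ l :=
  eventually_gaugeFilter.2 ⟨δ, hδ, fun _ _ h => h⟩

theorem gaugeFilter_neBot {a b : ℝ} (hab : a ≤ b) : (gaugeFilter a b).NeBot :=
  (gaugeFilter_hasBasis a b).neBot_iff.2 fun hδ => exists_fine_chain hab fun s _ => hδ s

theorem Chain.exists_eq_append {a e b : ℝ} {l : List Cell} (hl : Chain a b l) (hae : a ≤ e)
    (heb : e ≤ b) (hf : ∀ x ∈ l, x.tag ≠ e → x.hi - x.lo < |x.tag - e|) :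
    ∃ l₁ l₂, l = l₁ ++ l₂ ∧ Chain a e l₁ ∧ Chain e b l₂ := by
  induction hl with
  | nil a =>
    obtain rfl : a = e := le_antisymm hae heb
    exact ⟨[], [], rfl, .nil a, .nil a⟩
  | @cons a c b τ l hac hτ hl ih =>
    rcases hae.eq_or_lt with rfl | hlt
    · exact ⟨[], _, rfl, .nil a, .cons hac hτ hl⟩
    rw [List.forall_mem_cons] at hf
    have hce : c ≤ e := by
      by_contra! hec
      rcases hτ with rfl | rfl
      · have := hf.1 hlt.ne
        rw [abs_of_neg (by linarith)] at this
        linarith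
      · have := hf.1 hec.ne'
        rw [abs_of_pos (by linarith)] at this
        linarith
    obtain ⟨l₁, l₂, rfl, h1, h2⟩ := ih hce heb hf.2
    exact ⟨_ :: l₁, l₂, rfl, .cons hac hτ h1, h2⟩

/-- The gauge `|s - e|` away from `e` forces `e` to be an end point of a cell. -/
theorem gaugeFilter_le_map_append {a e b : ℝ} (hae : a ≤ e) (heb : e ≤ b) :
    gaugeFilter a b ≤
      map (fun p : List Cell × List Cell => p.1 ++ p.2) (gaugeFilter a e ×ˢ gaugeFilter e b) := by
  rw [(((gaugeFilter_hasBasis a e).prod (gaugeFilter_hasBasis e b)).map _).ge_iff]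
  rintro ⟨δ₁, δ₂⟩ ⟨hδ₁, hδ₂⟩
  have hδe : ∀ s, 0 < if s = e then 1 else |s - e| := fun s => by
    split_ifs with h
    exacts [one_pos, abs_pos.2 (sub_ne_zero.2 h)]
  filter_upwards [eventually_chain a b, eventually_fineFor a b hδ₁, eventually_fineFor a b hδ₂,
    eventually_fineFor a b hδe] with l hl hf₁ hf₂ hfe
  obtain ⟨l₁, l₂, rfl, hl₁, hl₂⟩ := hl.exists_eq_append hae heb fun x hx hxe => by
    simpa only [if_neg hxe] using hfe x hx
  exact ⟨(l₁, l₂), ⟨⟨hl₁, (fineFor_append.1 hf₁).1⟩, hl₂, (fineFor_append.1 hf₂).2⟩, rfl⟩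

/-! ## Integral sums -/

/-- The sum of the values of a cell function over a list of cells. -/
def cellSum {X : Type*} [AddCommMonoid X] (F : Cell → X) (l : List Cell) : X := (l.map F).sum

section cellSum

variable {X : Type*} [AddCommGroup X]

@[simp]
theorem cellSum_nil (F : Cell → X) : cellSum F [] = 0 := rfl

@[simp]
theorem cellSum_cons (F : Cell → X) (x : Cell) (l : List Cell) :
    cellSum F (x :: l) = F x + cellSum F l := rfl

theorem cellSum_append (F : Cell → X) (l l' : List Cell) :
    cellSum F (l ++ l') = cellSum F l + cellSum F l' := by
  simp only [cellSum, List.map_append, List.sum_append]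

theorem cellSum_congr {F G : Cell → X} {l : List Cell} (h : ∀ x ∈ l, F x = G x) :
    cellSum F l = cellSum G l := congrArg List.sum (List.map_congr_left h)

theorem cellSum_eq_zero {F : Cell → X} {l : List Cell} (h : ∀ x ∈ l, F x = 0) :
    cellSum F l = 0 := List.sum_eq_zero <| List.forall_mem_map.2 h

theorem cellSum_add (F G : Cell → X) (l : List Cell) :
    cellSum (fun x => F x + G x) l = cellSum F l + cellSum G l := List.sum_map_add

theorem cellSum_sub (F G : Cell → X) (l : List Cell) :
    cellSum (fun x => F x - G x) l = cellSum F l - cellSum G l := by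
  rw [eq_sub_iff_add_eq, ← cellSum_add]
  simp only [sub_add_cancel]

theorem cellSum_le {F G : Cell → ℝ} {l : List Cell} (h : ∀ x ∈ l, F x ≤ G x) :
    cellSum F l ≤ cellSum G l := List.sum_le_sum h

theorem norm_cellSum_le {Y : Type*} [NormedAddCommGroup Y] (F : Cell → Y) (l : List Cell) :
    ‖cellSum F l‖ ≤ cellSum (fun x => ‖F x‖) l := by
  induction l with
  | nil => simp
  | cons x l ih => exact (norm_add_le _ _).trans (add_le_add_right ih _)

theorem cellSum_mul_left (c : ℝ) (F : Cell → ℝ) (l : List Cell) :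
    cellSum (fun x => c * F x) l = c * cellSum F l := List.sum_map_mul_left _ _ _

theorem cellSum_increment {a b : ℝ} {l : List Cell} (hl : Chain a b l) (U : ℝ → X) :
    cellSum (fun x => U x.hi - U x.lo) l = U b - U a := by
  induction hl with
  | nil a => simp
  | cons hac hτ hl ih => rw [cellSum_cons, ih, add_comm, sub_add_sub_cancel]

end cellSum

/-- The cell function of the Riemann-Stieltjes sums of `u` with respect to `h`. -/
def rsTerm {X : Type*} [AddCommGroup X] [Module ℝ X] (u : ℝ → X) (h : ℝ → ℝ) (x : Cell) : X :=
  (h x.hi - h x.lo) • u x.tag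

theorem rsTerm_sub {X : Type*} [AddCommGroup X] [Module ℝ X] (u v : ℝ → X) (h : ℝ → ℝ)
    (x : Cell) : rsTerm (fun s => u s - v s) h x = rsTerm u h x - rsTerm v h x := smul_sub _ _ _

/-- The tagged partition with one more interval `[a, c]` in front. -/
def TaggedPart.cons {a c b τ : ℝ} (haτ : a ≤ τ) (hτc : τ ≤ c) (P : TaggedPart c b) :
    TaggedPart a b where
  size := P.size + 1
  pt j := Nat.casesOn j a P.pt
  tag j := Nat.casesOn j τ P.tag
  pt_zero := rfl
  pt_size := P.pt_size
  tag_mem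
    | 0, _ => ⟨haτ, hτc.trans_eq P.pt_zero.symm⟩
    | j + 1, hj => P.tag_mem j (Nat.lt_of_succ_lt_succ hj)

theorem TaggedPart.IsFine.cons {a c b τ : ℝ} {δ : ℝ → ℝ} {P : TaggedPart c b} (hP : P.IsFine δ)
    (haτ : a ≤ τ) (hτc : τ ≤ c) (hδ : Icc a c ⊆ Ioo (τ - δ τ) (τ + δ τ)) :
    (P.cons haτ hτc).IsFine δ
  | 0, _ => by
    change Icc a (P.pt 0) ⊆ _
    rwa [P.pt_zero]
  | j + 1, hj => hP j (Nat.lt_of_succ_lt_succ hj)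

section Equivalence

variable {X : Type*} [NormedAddCommGroup X] [NormedSpace ℝ X] {u : ℝ → X} {h : ℝ → ℝ}

theorem TaggedPart.sum_cons {a c b τ : ℝ} (haτ : a ≤ τ) (hτc : τ ≤ c) (P : TaggedPart c b) :
    (P.cons haτ hτc).sum u h = (h c - h a) • u τ + P.sum u h := by
  rw [TaggedPart.sum, TaggedPart.cons, Finset.sum_range_succ', add_comm]
  change (h (P.pt 0) - h a) • u τ + _ = _
  rw [P.pt_zero]
  rfl

theorem Chain.exists_taggedPart {a b : ℝ} {l : List Cell} {δ : ℝ → ℝ} (hl : Chain a b l)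
    (hf : FineFor δ l) :
    ∃ P : TaggedPart a b, P.IsFine δ ∧ P.sum u h = cellSum (rsTerm u h) l := by
  induction hl with
  | nil a =>
    exact ⟨⟨0, fun _ => a, fun _ => a, rfl, rfl, fun j hj => absurd hj (Nat.not_lt_zero j)⟩,
      fun j hj => absurd hj (Nat.not_lt_zero j), Finset.sum_range_zero _⟩
  | @cons a c b τ l hac hτ hl ih =>
    rw [fineFor_cons] at hf
    obtain ⟨P, hP, hs⟩ := ih hf.2
    have haτ : a ≤ τ := by rcases hτ with rfl | rfl <;> simp only [hac, le_refl]
    have hτc : τ ≤ c := by rcases hτ with rfl | rfl <;> simp only [hac, le_refl]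
    have hcδ : c - a < δ τ := hf.1
    refine ⟨P.cons haτ hτc, hP.cons haτ hτc fun s hs => ?_, ?_⟩
    · rcases hτ with rfl | rfl <;> constructor <;> linarith [hs.1, hs.2]
    · rw [TaggedPart.sum_cons, hs, cellSum_cons, rsTerm]

theorem TaggedPart.exists_chain {a b : ℝ} {δ : ℝ → ℝ} (P : TaggedPart a b) (hP : P.IsFine δ) :
    ∃ l, Chain a b l ∧ FineFor δ l ∧ cellSum (rsTerm u h) l = P.sum u h := by
  suffices ∀ k ≤ P.size, ∃ l, Chain a (P.pt k) l ∧ FineFor δ l ∧ cellSum (rsTerm u h) l =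
      ∑ j ∈ Finset.range k, (h (P.pt (j + 1)) - h (P.pt j)) • u (P.tag j) by
    simpa only [P.pt_size, TaggedPart.sum] using this P.size le_rfl
  intro k hk
  induction k with
  | zero => exact ⟨[], P.pt_zero.symm ▸ .nil a, fineFor_nil δ, rfl⟩
  | succ k ih =>
    obtain ⟨l, hl, hf, hs⟩ := ih (Nat.le_of_succ_le hk)
    obtain ⟨hlo, hhi⟩ := P.tag_mem k hk
    have hδlo := (hP k hk ⟨le_rfl, hlo.trans hhi⟩).1
    have hδhi := (hP k hk ⟨hlo.trans hhi, le_rfl⟩).2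
    refine ⟨l ++ [⟨P.tag k, P.pt k, P.tag k⟩, ⟨P.tag k, P.tag k, P.pt (k + 1)⟩],
      hl.append (.cons hlo (.inr rfl) (.cons hhi (.inl rfl) (.nil _))), ?_, ?_⟩
    · simp only [fineFor_append, fineFor_cons, fineFor_nil, and_true]
      exact ⟨hf, by linarith, by linarith⟩
    · simp only [cellSum_append, hs, Finset.sum_range_succ, cellSum_cons, cellSum_nil, add_zero,
        rsTerm, ← add_smul, sub_add_sub_cancel']

theorem hasKSIntegral_iff {a b : ℝ} {I : X} :
    HasKSIntegral u h a b I ↔ Tendsto (cellSum (rsTerm u h)) (gaugeFilter a b) (𝓝 I) := by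
  simp only [Metric.tendsto_nhds, eventually_gaugeFilter, dist_eq_norm]
  constructor
  · intro H ε hε
    obtain ⟨δ, hδ, HP⟩ := H ε hε
    refine ⟨δ, hδ, fun l hl hf => ?_⟩
    obtain ⟨P, hP, hs⟩ := hl.exists_taggedPart (u := u) (h := h) hf
    exact hs ▸ HP P hP
  · intro H ε hε
    obtain ⟨δ, hδ, Hl⟩ := H ε hε
    refine ⟨δ, hδ, fun P hP => ?_⟩
    obtain ⟨l, hl, hf, hs⟩ := P.exists_chain (u := u) (h := h) hP
    exact hs ▸ Hl l hl hf

theorem HasKSIntegral.unique {a b : ℝ} (hab : a ≤ b) {I J : X} (hI : HasKSIntegral u h a b I)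
    (hJ : HasKSIntegral u h a b J) : I = J := by
  have := gaugeFilter_neBot hab
  exact tendsto_nhds_unique (hasKSIntegral_iff.1 hI) (hasKSIntegral_iff.1 hJ)

theorem HasKSIntegral.ksIntegral_eq {a b : ℝ} (hab : a ≤ b) {I : X}
    (hI : HasKSIntegral u h a b I) : ksIntegral u h a b = I := by
  have H : KSIntegrable u h a b := ⟨I, hI⟩
  rw [ksIntegral, if_pos hab, dif_pos H]
  exact H.choose_spec.unique hab hI

theorem KSIntegrable.hasKSIntegral {a b : ℝ} (hab : a ≤ b) (H : KSIntegrable u h a b) :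
    HasKSIntegral u h a b (ksIntegral u h a b) := by
  obtain ⟨I, hI⟩ := H
  rwa [hI.ksIntegral_eq hab]

theorem ksIntegrable_iff_cauchy [CompleteSpace X] {a b : ℝ} (hab : a ≤ b) :
    KSIntegrable u h a b ↔ ∀ ε > 0, ∃ δ : ℝ → ℝ, (∀ s, 0 < δ s) ∧
      ∀ l l', Chain a b l → FineFor δ l → Chain a b l' → FineFor δ l' →
        ‖cellSum (rsTerm u h) l - cellSum (rsTerm u h) l'‖ < ε := by
  have := gaugeFilter_neBot hab
  rw [show KSIntegrable u h a b ↔ _ from exists_congr fun I => hasKSIntegral_iff,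
    ← cauchy_map_iff_exists_tendsto,
    cauchy_map_iff', (gaugeFilter_hasBasis a b).prod_self.tendsto_iff Metric.uniformity_basis_dist]
  simp only [mem_prod, Prod.forall, mem_ofPred_eq, and_imp, dist_eq_norm]

end Equivalence

/-! ## Elementary properties of the Kurzweil-Stieltjes integral -/

section Basic

variable {X : Type*} [NormedAddCommGroup X] [NormedSpace ℝ X] {u v : ℝ → X} {h : ℝ → ℝ}
  {a b e : ℝ} {I J : X}

theorem HasKSIntegral.add (hu : HasKSIntegral u h a b I) (hv : HasKSIntegral v h a b J) :
    HasKSIntegral (fun s => u s + v s) h a b (I + J) := by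
  rw [hasKSIntegral_iff] at *
  refine (hu.add hv).congr fun l => ?_
  rw [← cellSum_add]
  exact cellSum_congr fun x _ => (smul_add _ _ _).symm

theorem HasKSIntegral.map {Y : Type*} [NormedAddCommGroup Y] [NormedSpace ℝ Y]
    (hu : HasKSIntegral u h a b I) (A : X →L[ℝ] Y) :
    HasKSIntegral (fun s => A (u s)) h a b (A I) := by
  rw [hasKSIntegral_iff] at *
  refine ((A.continuous.tendsto I).comp hu).congr fun l => ?_
  simp only [Function.comp_apply, cellSum, map_list_sum, List.map_map]
  congr 1
  exact List.map_congr_left fun x _ => A.map_smul _ _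

theorem HasKSIntegral.smul (hu : HasKSIntegral u h a b I) (c : ℝ) :
    HasKSIntegral (fun s => c • u s) h a b (c • I) :=
  hu.map (c • ContinuousLinearMap.id ℝ X)

theorem HasKSIntegral.sub (hu : HasKSIntegral u h a b I) (hv : HasKSIntegral v h a b J) :
    HasKSIntegral (fun s => u s - v s) h a b (I - J) := by
  simpa only [neg_one_smul, sub_eq_add_neg] using hu.add (hv.smul (-1))

theorem HasKSIntegral.congr (hu : HasKSIntegral u h a b I) (huv : ∀ s ∈ Icc a b, u s = v s) :
    HasKSIntegral v h a b I := by
  rw [hasKSIntegral_iff] at *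
  refine hu.congr' ?_
  filter_upwards [eventually_chain a b] with l hl
  exact cellSum_congr fun x hx => by rw [rsTerm, rsTerm, huv _ (hl.tag_mem hx)]

theorem hasKSIntegral_const (k : X) :
    HasKSIntegral (fun _ => k) h a b ((h b - h a) • k) := by
  rw [hasKSIntegral_iff]
  refine tendsto_const_nhds.congr' ?_
  filter_upwards [eventually_chain a b] with l hl
  rw [sub_smul, ← cellSum_increment hl fun s => h s • k]
  exact cellSum_congr fun x _ => (sub_smul _ _ _).symm

theorem hasKSIntegral_refl : HasKSIntegral u h a a 0 := by
  rw [hasKSIntegral_iff]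
  refine tendsto_const_nhds.congr' ?_
  filter_upwards [eventually_chain a a] with l hl
  refine (cellSum_eq_zero fun x hx => ?_).symm
  obtain ⟨hlo, hlohi, hhi, -⟩ := hl.mem x hx
  rw [rsTerm, le_antisymm hlohi (hhi.trans hlo), sub_self, zero_smul]

theorem HasKSIntegral.append (hae : a ≤ e) (heb : e ≤ b) (hu : HasKSIntegral u h a e I)
    (hv : HasKSIntegral u h e b J) : HasKSIntegral u h a b (I + J) := by
  rw [hasKSIntegral_iff] at *
  refine Tendsto.mono_left (tendsto_map'_iff.2 ?_) (gaugeFilter_le_map_append hae heb)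
  exact ((hu.comp tendsto_fst).add (hv.comp tendsto_snd)).congr fun p =>
    (cellSum_append _ p.1 p.2).symm

theorem KSIntegrable.mono [CompleteSpace X] {c d : ℝ} (H : KSIntegrable u h a b) (hac : a ≤ c)
    (hcd : c ≤ d) (hdb : d ≤ b) : KSIntegrable u h c d := by
  rw [ksIntegrable_iff_cauchy (hac.trans (hcd.trans hdb))] at H
  rw [ksIntegrable_iff_cauchy hcd]
  intro ε hε
  obtain ⟨δ, hδ, Hl⟩ := H ε hε
  refine ⟨δ, hδ, fun l l' hl hf hl' hf' => ?_⟩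
  obtain ⟨l₁, h₁, f₁⟩ := exists_fine_chain hac fun s _ => hδ s
  obtain ⟨l₂, h₂, f₂⟩ := exists_fine_chain hdb fun s _ => hδ s
  have key := Hl (l₁ ++ (l ++ l₂)) (l₁ ++ (l' ++ l₂)) (h₁.append (hl.append h₂))
    (by simp only [fineFor_append, f₁, f₂, hf, and_self]) (h₁.append (hl'.append h₂))
    (by simp only [fineFor_append, f₁, f₂, hf', and_self])
  simpa only [cellSum_append, add_sub_add_left_eq_sub, add_sub_add_right_eq_sub] using key

theorem KSIntegrable.hasKSIntegral_sub [CompleteSpace X] {c d : ℝ} (H : KSIntegrable u h a b)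
    (hac : a ≤ c) (hcd : c ≤ d) (hdb : d ≤ b) :
    HasKSIntegral u h c d (ksIntegral u h a d - ksIntegral u h a c) := by
  have hcInt := (H.mono le_rfl hac (hcd.trans hdb)).hasKSIntegral hac
  have hcdInt := (H.mono hac hcd hdb).hasKSIntegral hcd
  rwa [(hcInt.append hac hcd hcdInt).ksIntegral_eq (hac.trans hcd), add_sub_cancel_left]

theorem ksIntegral_self : ksIntegral u h a a = 0 := hasKSIntegral_refl.ksIntegral_eq le_rfl

end Basic

/-! ## Dominated increments -/

/-- The increments of `F` on `[a, b]` are dominated by those of the real function `V`. -/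
def DominatedBy {E : Type*} [NormedAddCommGroup E] (F : ℝ → E) (V : ℝ → ℝ) (a b : ℝ) : Prop :=
  ∀ c d, a ≤ c → c ≤ d → d ≤ b → ‖F d - F c‖ ≤ V d - V c

section DominatedBy

variable {E : Type*} [NormedAddCommGroup E] {F : ℝ → E} {V : ℝ → ℝ} {a b : ℝ}

theorem DominatedBy.mono {c d : ℝ} (hV : DominatedBy F V a b) (hac : a ≤ c) (hdb : d ≤ b) :
    DominatedBy F V c d := fun s t hs hst ht => hV s t (hac.trans hs) hst (ht.trans hdb)

theorem DominatedBy.dist_le (hV : DominatedBy F V a b) {c d : ℝ} (hc : c ∈ Icc a b)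
    (hd : d ∈ Icc a b) : dist (F c) (F d) ≤ dist (V c) (V d) := by
  wlog hcd : c ≤ d generalizing c d
  · rw [dist_comm, dist_comm (V c)]
    exact this hd hc (le_of_not_ge hcd)
  rw [dist_comm, dist_comm (V c), dist_eq_norm, Real.dist_eq]
  exact (hV c d hc.1 hcd hd.2).trans (le_abs_self _)

theorem exists_tendsto_of_dist_le [CompleteSpace E] {α : Type*} {G : α → E} {M : α → ℝ}
    {f : Filter α} {s : Set α} {L : ℝ} (hs : s ∈ f)
    (hG : ∀ x ∈ s, ∀ y ∈ s, dist (G x) (G y) ≤ dist (M x) (M y)) (hL : Tendsto M f (𝓝 L)) :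
    ∃ l, Tendsto G f (𝓝 l) := by
  rcases f.eq_or_neBot with rfl | hf
  · exact ⟨0, tendsto_bot⟩
  refine cauchy_map_iff_exists_tendsto.1 (cauchy_map_iff'.2 ?_)
  have hM := cauchy_map_iff'.1 (cauchy_map_iff_exists_tendsto.2 ⟨L, hL⟩)
  rw [tendsto_uniformity_iff_dist_tendsto_zero] at hM ⊢
  refine squeeze_zero' (.of_forall fun _ => dist_nonneg) ?_ hM
  filter_upwards [prod_mem_prod hs hs] with p hp
  exact hG _ hp.1 _ hp.2

theorem DominatedBy.increment_nonneg {c d : ℝ} (hV : DominatedBy F V a b) (hac : a ≤ c)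
    (hcd : c ≤ d) (hdb : d ≤ b) : 0 ≤ V d - V c := (norm_nonneg _).trans (hV c d hac hcd hdb)

theorem DominatedBy.monotoneOn (hV : DominatedBy F V a b) : MonotoneOn V (Icc a b) :=
  fun _ hc _ hd hcd => sub_nonneg.1 (hV.increment_nonneg hc.1 hcd hd.2)

theorem dominatedBy_self_of_monotoneOn (hV : MonotoneOn V (Icc a b)) : DominatedBy V V a b :=
  fun _ _ hc hcd hd => (abs_of_nonneg (sub_nonneg.2
    (hV ⟨hc, hcd.trans hd⟩ ⟨hc.trans hcd, hd⟩ hcd))).le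

theorem DominatedBy.self (hV : DominatedBy F V a b) : DominatedBy V V a b :=
  dominatedBy_self_of_monotoneOn hV.monotoneOn

theorem DominatedBy.comp_neg (hV : DominatedBy F V a b) :
    DominatedBy (fun s => F (-s)) (fun s => -V (-s)) (-b) (-a) := fun c d hc hcd hd => by
  rw [norm_sub_rev, neg_sub_neg]
  exact hV (-d) (-c) (le_neg_of_le_neg hd) (neg_le_neg hcd) (neg_le_of_neg_le hc)

end DominatedBy

section Domination

variable {X : Type*} [NormedAddCommGroup X] [NormedSpace ℝ X] {u : ℝ → X} {h V : ℝ → ℝ}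
  {a b : ℝ} {I : X}

theorem norm_cellSum_rsTerm_le (hV : DominatedBy h V a b) {m : ℝ → ℝ}
    (hm : ∀ s ∈ Icc a b, ‖u s‖ ≤ m s) {l : List Cell} (hl : Chain a b l) :
    ‖cellSum (rsTerm u h) l‖ ≤ cellSum (rsTerm m V) l := by
  refine (norm_cellSum_le _ _).trans (cellSum_le fun x hx => ?_)
  obtain ⟨hlo, hlohi, hhi, -⟩ := hl.mem x hx
  rw [rsTerm, rsTerm, norm_smul, smul_eq_mul]
  exact mul_le_mul (hV _ _ hlo hlohi hhi) (hm _ (hl.tag_mem hx)) (norm_nonneg _)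
    (hV.increment_nonneg hlo hlohi hhi)

theorem HasKSIntegral.norm_le (hab : a ≤ b) (hV : DominatedBy h V a b) {m : ℝ → ℝ} {M : ℝ}
    (hm : ∀ s ∈ Icc a b, ‖u s‖ ≤ m s) (hu : HasKSIntegral u h a b I)
    (hM : HasKSIntegral m V a b M) : ‖I‖ ≤ M := by
  have := gaugeFilter_neBot hab
  rw [hasKSIntegral_iff] at *
  refine le_of_tendsto_of_tendsto hu.norm hM ?_
  filter_upwards [eventually_chain a b] with l hl
  exact norm_cellSum_rsTerm_le hV hm hl

theorem HasKSIntegral.norm_le_const (hab : a ≤ b) (hV : DominatedBy h V a b) {C : ℝ}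
    (hC : ∀ s ∈ Icc a b, ‖u s‖ ≤ C) (hu : HasKSIntegral u h a b I) : ‖I‖ ≤ C * (V b - V a) := by
  have := hu.norm_le hab hV hC (hasKSIntegral_const C)
  rwa [smul_eq_mul, mul_comm] at this

theorem HasKSIntegral.mono_of_le {m m' : ℝ → ℝ} {M M' : ℝ} (hab : a ≤ b)
    (hV : DominatedBy V V a b) (hm : ∀ s ∈ Icc a b, m s ≤ m' s) (hM : HasKSIntegral m V a b M)
    (hM' : HasKSIntegral m' V a b M') : M ≤ M' := by
  have hsub := hM'.sub hM
  exact sub_nonneg.1 <| (norm_nonneg _).trans <| hsub.norm_le hab hV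
    (fun s hs => (Real.norm_of_nonneg (sub_nonneg.2 (hm s hs))).le) hsub

theorem ksIntegrable_of_approx [CompleteSpace X] (hab : a ≤ b) (hV : DominatedBy h V a b)
    (H : ∀ ε > 0, ∃ (w : ℝ → X) (m : ℝ → ℝ) (M : ℝ), KSIntegrable w h a b ∧
      HasKSIntegral m V a b M ∧ M < ε ∧ ∀ s ∈ Icc a b, ‖u s - w s‖ ≤ m s) :
    KSIntegrable u h a b := by
  rw [ksIntegrable_iff_cauchy hab]
  intro ε hε
  obtain ⟨w, m, M, hw, hm, hM, huw⟩ := H (ε / 3) (by positivity)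
  obtain ⟨δ₁, hδ₁, H₁⟩ := (ksIntegrable_iff_cauchy hab).1 hw (ε / 3) (by positivity)
  obtain ⟨δ₂, hδ₂, H₂⟩ := eventually_gaugeFilter.1
    ((hasKSIntegral_iff.1 hm).eventually (gt_mem_nhds hM))
  have huw_sum : ∀ l, Chain a b l → FineFor δ₂ l →
      ‖cellSum (rsTerm u h) l - cellSum (rsTerm w h) l‖ < ε / 3 := fun l hl hf => by
    simp only [← cellSum_sub, ← rsTerm_sub]
    exact (norm_cellSum_rsTerm_le hV huw hl).trans_lt (H₂ l hl hf)
  refine ⟨fun s => min (δ₁ s) (δ₂ s), fun s => lt_min (hδ₁ s) (hδ₂ s),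
    fun l l' hl hf hl' hf' => ?_⟩
  have hl_near := huw_sum l hl (hf.mono fun s => min_le_right _ _)
  have hl'_near := huw_sum l' hl' (hf'.mono fun s => min_le_right _ _)
  have hw_near := H₁ l l' hl (hf.mono fun s => min_le_left _ _) hl'
    (hf'.mono fun s => min_le_left _ _)
  rw [← dist_eq_norm] at *
  rw [dist_comm] at hl'_near
  linarith [dist_triangle4 (cellSum (rsTerm u h) l) (cellSum (rsTerm w h) l)
    (cellSum (rsTerm w h) l') (cellSum (rsTerm u h) l')]

theorem ksIntegrable_of_uniform_approx [CompleteSpace X] (hab : a ≤ b)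
    (hV : DominatedBy h V a b)
    (H : ∀ ε > 0, ∃ w : ℝ → X, KSIntegrable w h a b ∧ ∀ s ∈ Icc a b, ‖u s - w s‖ ≤ ε) :
    KSIntegrable u h a b := by
  refine ksIntegrable_of_approx hab hV fun ε hε => ?_
  have hD := hV.increment_nonneg le_rfl hab le_rfl
  obtain ⟨w, hw, huw⟩ := H (ε / (V b - V a + 1)) (by positivity)
  refine ⟨w, _, _, hw, hasKSIntegral_const (ε / (V b - V a + 1)), ?_, huw⟩
  rw [smul_eq_mul, mul_div_assoc', div_lt_iff₀ (by positivity)]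
  linarith

end Domination

/-! ## Integrands changed at a point -/

/-- The mirror image of a cell. -/
def Cell.neg (x : Cell) : Cell := ⟨-x.tag, -x.hi, -x.lo⟩

theorem Chain.reverse_map_neg {a b : ℝ} {l : List Cell} (hl : Chain a b l) :
    Chain (-b) (-a) (l.map Cell.neg).reverse := by
  induction hl with
  | nil a => exact .nil _
  | @cons a c b τ l hac hτ _ ih =>
    simp only [List.map_cons, List.reverse_cons]
    refine ih.append (.cons (neg_le_neg hac) ?_ (.nil _))
    rcases hτ with rfl | rfl
    exacts [.inr rfl, .inl rfl]

section Limits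

variable {E : Type*} [NormedAddCommGroup E] {X : Type*} [NormedAddCommGroup X] [NormedSpace ℝ X]
  {u : ℝ → X} {h V : ℝ → ℝ} {a b : ℝ}

theorem HasKSIntegral.comp_neg {I : X} (hu : HasKSIntegral u h a b I) :
    HasKSIntegral (fun s => u (-s)) (fun s => -h (-s)) (-b) (-a) I := by
  rw [hasKSIntegral_iff, Metric.tendsto_nhds] at *
  intro ε hε
  obtain ⟨δ, hδ, H⟩ := eventually_gaugeFilter.1 (hu ε hε)
  refine eventually_gaugeFilter.2 ⟨fun s => δ (-s), fun s => hδ _, fun l hl hf => ?_⟩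
  have hsum : cellSum (rsTerm u h) (l.map Cell.neg).reverse =
      cellSum (rsTerm (fun s => u (-s)) fun s => -h (-s)) l := by
    rw [cellSum, List.map_reverse, List.sum_reverse, List.map_map]
    refine congrArg List.sum (List.map_congr_left fun x _ => ?_)
    simp only [Function.comp_apply, rsTerm, Cell.neg, neg_sub_neg]
  rw [← hsum]
  have hl' := hl.reverse_map_neg
  rw [neg_neg, neg_neg] at hl'
  refine H _ hl' fun x hx => ?_
  obtain ⟨y, hy, rfl⟩ := List.mem_map.1 (List.mem_reverse.1 hx)
  simpa only [Cell.neg, neg_sub_neg] using hf y hy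

theorem DominatedBy.exists_tendsto_nhdsGT [CompleteSpace E] {F : ℝ → E} (hab : a < b)
    (hV : DominatedBy F V a b) : ∃ L, Tendsto F (𝓝[>] a) (𝓝 L) := by
  have hbdd : BddBelow (V '' Ioo a b) :=
    ⟨V a, forall_mem_image.2 fun s hs =>
      hV.monotoneOn (left_mem_Icc.2 hab.le) (Ioo_subset_Icc_self hs) hs.1.le⟩
  have hVlim := (hV.monotoneOn.mono Ioo_subset_Icc_self).tendsto_nhdsWithin_Ioo_right
    (nonempty_Ioo.2 hab) hbdd
  exact exists_tendsto_of_dist_le (Ioo_mem_nhdsGT hab) (fun c hc d hd =>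
    hV.dist_le (Ioo_subset_Icc_self hc) (Ioo_subset_Icc_self hd)) hVlim

/-- The gauge `|s - a|` away from `a` forces the first nondegenerate cell to be tagged at `a`. -/
theorem Chain.exists_cellSum_indicator_left {k : X} {l : List Cell} {δ : ℝ → ℝ} (hab : a < b)
    (hl : Chain a b l) (hf : FineFor δ l) (hδ : ∀ s > a, δ s ≤ s - a) :
    ∃ d ∈ Ioo a (a + δ a),
      cellSum (rsTerm (fun s => if s = a then k else 0) h) l = (h d - h a) • k := by
  induction hl with
  | nil a => exact absurd hab (lt_irrefl _)
  | @cons a c b τ l hac hτ hl ih =>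
    rw [fineFor_cons] at hf
    rcases hac.eq_or_lt with rfl | hlt
    · obtain ⟨d, hd, hsum⟩ := ih hab hf.2 hδ
      exact ⟨d, hd, by simp [rsTerm, hsum]⟩
    · obtain rfl : τ = a := hτ.resolve_right fun hτc => by
        have := hf.1.trans_le (hδ τ (hτc ▸ hlt))
        simp [hτc] at this
      refine ⟨c, ⟨hlt, sub_lt_iff_lt_add'.1 hf.1⟩, ?_⟩
      rw [cellSum_cons, cellSum_eq_zero, add_zero, rsTerm, if_pos rfl]
      intro x hx
      rw [rsTerm, if_neg (hlt.trans_le (hl.tag_mem hx).1).ne', smul_zero]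

theorem ksIntegrable_indicator_left (hab : a < b) (hV : DominatedBy h V a b) (k : X) :
    KSIntegrable (fun s => if s = a then k else 0) h a b := by
  obtain ⟨L, hL⟩ := hV.exists_tendsto_nhdsGT hab
  refine ⟨(L - h a) • k, hasKSIntegral_iff.2 (Metric.tendsto_nhds.2 fun ε hε => ?_)⟩
  obtain ⟨η, hη, H⟩ := Metric.mem_nhdsWithin_iff.1
    (((hL.sub_const (h a)).smul_const k).eventually (Metric.ball_mem_nhds _ hε))
  refine eventually_gaugeFilter.2 ⟨fun s => if s = a then η else |s - a|, fun s => ?_,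
    fun l hl hf => ?_⟩
  · dsimp only
    split_ifs with h
    exacts [hη, abs_pos.2 (sub_ne_zero.2 h)]
  · obtain ⟨d, hd, hsum⟩ := hl.exists_cellSum_indicator_left (h := h) (k := k) hab hf fun s hs => by
      simp only [hs.ne', if_false, abs_of_pos (sub_pos.2 hs), le_refl]
    rw [if_pos rfl] at hd
    rw [hsum]
    refine H ⟨?_, hd.1⟩
    rw [Metric.mem_ball, Real.dist_eq, abs_of_pos (sub_pos.2 hd.1)]
    exact sub_lt_iff_lt_add'.2 hd.2

theorem ksIntegrable_indicator_right (hab : a < b) (hV : DominatedBy h V a b) (k : X) :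
    KSIntegrable (fun s => if s = b then k else 0) h a b := by
  have hneg : DominatedBy (fun s => -h (-s)) (fun s => -V (-s)) (-b) (-a) := by
    simpa only [DominatedBy, neg_sub_neg, Real.norm_eq_abs, abs_sub_comm] using hV.comp_neg
  obtain ⟨I, hI⟩ := ksIntegrable_indicator_left (neg_lt_neg hab) hneg k
  refine ⟨I, ?_⟩
  simpa only [neg_neg, neg_inj] using hI.comp_neg

theorem KSIntegrable.congr_Ioo {w : ℝ → X} (hab : a ≤ b) (hV : DominatedBy h V a b)
    (hw : KSIntegrable w h a b) (huw : ∀ s ∈ Ioo a b, u s = w s) : KSIntegrable u h a b := by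
  rcases hab.eq_or_lt with rfl | hab
  · exact ⟨0, hasKSIntegral_refl⟩
  obtain ⟨I, hI⟩ := hw
  obtain ⟨I₁, h₁⟩ := ksIntegrable_indicator_left hab hV (u a - w a)
  obtain ⟨I₂, h₂⟩ := ksIntegrable_indicator_right hab hV (u b - w b)
  refine ⟨_, ((hI.add h₁).add h₂).congr fun s hs => ?_⟩
  rcases eq_endpoints_or_mem_Ioo_of_mem_Icc hs with rfl | rfl | hs
  · simp [hab.ne]
  · simp [hab.ne']
  · simp [hs.1.ne', hs.2.ne, huw s hs]

theorem ksIntegrable_of_local_approx [CompleteSpace X] (hab : a ≤ b) (hV : DominatedBy h V a b)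
    (H : ∀ ε > 0, ∀ t ∈ Icc a b, ∃ η > 0, ∀ c d, a ≤ c → c < d → d ≤ b → (t = c ∨ t = d) →
      d - c < η → ∃ w : ℝ → X, KSIntegrable w h c d ∧ ∀ s ∈ Ioo c d, ‖u s - w s‖ ≤ ε) :
    KSIntegrable u h a b := by
  refine ksIntegrable_of_uniform_approx hab hV fun ε hε => ?_
  refine cousin_induction (P := fun c d => ∃ w : ℝ → X, KSIntegrable w h c d ∧
    ∀ s ∈ Icc c d, ‖u s - w s‖ ≤ ε) hab ?_ ?_ ?_
  · exact fun c => ⟨u, ⟨0, hasKSIntegral_refl⟩, fun s _ => by simpa using hε.le⟩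
  · rintro c d e hac hcd hde heb ⟨w, ⟨I, hI⟩, hw⟩ ⟨w', hint', hw'⟩
    obtain ⟨J, hJ⟩ := hint'.congr_Ioo (u := fun s => if s ≤ d then w s else w' s) hde
      (hV.mono (hac.trans hcd) heb) fun s hs => if_neg hs.1.not_ge
    refine ⟨fun s => if s ≤ d then w s else w' s,
      ⟨I + J, (hI.congr fun s hs => (if_pos hs.2).symm).append hcd hde hJ⟩, fun s hs => ?_⟩
    dsimp only
    split_ifs with hsd
    exacts [hw s ⟨hs.1, hsd⟩, hw' s ⟨(not_le.1 hsd).le, hs.2⟩]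
  · intro t ht
    obtain ⟨η, hη, Hη⟩ := H ε hε t ht
    refine ⟨η, hη, fun c d hac hcd hdb htcd hd => ?_⟩
    obtain ⟨w, hw, huw⟩ := Hη c d hac hcd hdb htcd hd
    refine ⟨(Ioo c d).piecewise w u, hw.congr_Ioo hcd.le (hV.mono hac hdb) fun s hs =>
      piecewise_eq_of_mem _ _ _ hs, fun s _ => ?_⟩
    by_cases hs : s ∈ Ioo c d
    · rw [piecewise_eq_of_mem _ _ _ hs]
      exact huw s hs
    · rw [piecewise_eq_of_notMem _ _ _ hs, sub_self, norm_zero]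
      exact hε.le

end Limits

/-! ## The Saks-Henstock lemma -/

theorem cellSum_filter {X : Type*} [AddCommGroup X] (F : Cell → X) (p : Cell → Prop)
    [DecidablePred p] (l : List Cell) :
    cellSum F (l.filter p) = cellSum (fun x => if p x then F x else 0) l := by
  induction l with
  | nil => rfl
  | cons x l ih =>
    rw [cellSum_cons, ← ih, List.filter_cons]
    by_cases hp : p x <;> simp [hp]

theorem cellSum_abs_eq (G : Cell → ℝ) (l : List Cell) :
    cellSum (fun x => |G x|) l =
      cellSum G (l.filter fun x => 0 ≤ G x) - cellSum G (l.filter fun x => ¬0 ≤ G x) := by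
  rw [cellSum_filter, cellSum_filter, ← cellSum_sub]
  refine cellSum_congr fun x _ => ?_
  by_cases hx : 0 ≤ G x
  · rw [if_pos hx, if_neg (not_not.2 hx), sub_zero, abs_of_nonneg hx]
  · rw [if_neg hx, if_pos hx, zero_sub, abs_of_neg (not_le.1 hx)]

section SaksHenstock

variable {a b ε : ℝ} {δ : ℝ → ℝ} {l l' : List Cell}

theorem FineFor.sublist (hf : FineFor δ l) (hsub : l'.Sublist l) : FineFor δ l' :=
  fun x hx => hf x (hsub.subset hx)

section Sublist

variable {X : Type*} [NormedAddCommGroup X] {G : Cell → X}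

-- The cells that are left out are filled with fine chains on which the sum of `G` is negligible.
theorem Chain.exists_fineFor_norm_cellSum_sub_le
    (hG : ∀ c d, a ≤ c → c ≤ d → d ≤ b → ∀ η > 0, ∃ l, Chain c d l ∧ FineFor δ l ∧
      ‖cellSum G l‖ ≤ η)
    (hsub : l'.Sublist l) (hf : FineFor δ l') {c : ℝ} (hl : Chain c b l) (hac : a ≤ c) {η : ℝ}
    (hη : 0 < η) :
    ∃ m, Chain c b m ∧ FineFor δ m ∧ ‖cellSum G m - cellSum G l'‖ ≤ η := by
  induction hsub generalizing c η with
  | slnil => exact ⟨[], hl, hf, by rw [sub_self, norm_zero]; exact hη.le⟩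
  | cons x _ ih =>
    rcases hl with _ | ⟨hcd, hτ, hl⟩
    obtain ⟨m₀, hm₀, hf₀, hG₀⟩ := hG _ _ hac hcd hl.le (η / 2) (half_pos hη)
    obtain ⟨m, hm, hfm, hGm⟩ := ih hf hl (hac.trans hcd) (half_pos hη)
    refine ⟨m₀ ++ m, hm₀.append hm, fineFor_append.2 ⟨hf₀, hfm⟩, ?_⟩
    rw [cellSum_append, add_sub_assoc]
    exact (norm_add_le_of_le hG₀ hGm).trans_eq (add_halves η)
  | cons_cons x _ ih =>
    rcases hl with _ | ⟨hcd, hτ, hl⟩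
    obtain ⟨hfx, hf⟩ := fineFor_cons.1 hf
    obtain ⟨m, hm, hfm, hGm⟩ := ih hf hl (hac.trans hcd) hη
    refine ⟨_ :: m, .cons hcd hτ hm, fineFor_cons.2 ⟨hfx, hfm⟩, ?_⟩
    rwa [cellSum_cons, cellSum_cons, add_sub_add_left_eq_sub]

theorem norm_cellSum_sublist_le
    (hε : ∀ l, Chain a b l → FineFor δ l → ‖cellSum G l‖ ≤ ε)
    (hG : ∀ c d, a ≤ c → c ≤ d → d ≤ b → ∀ η > 0, ∃ l, Chain c d l ∧ FineFor δ l ∧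
      ‖cellSum G l‖ ≤ η)
    (hl : Chain a b l) (hsub : l'.Sublist l) (hf : FineFor δ l') : ‖cellSum G l'‖ ≤ ε := by
  refine le_of_forall_pos_le_add fun η hη => ?_
  obtain ⟨m, hm, hfm, hGm⟩ := hl.exists_fineFor_norm_cellSum_sub_le hG hsub hf le_rfl hη
  linarith [hε m hm hfm, norm_sub_norm_le (cellSum G l') (cellSum G m),
    norm_sub_rev (cellSum G m) (cellSum G l')]

end Sublist

/-- The deviation of a term of the integral sum from the integral over the cell. -/
noncomputable def deviation {X : Type*} [NormedAddCommGroup X] [NormedSpace ℝ X] (u : ℝ → X)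
    (h : ℝ → ℝ) (a : ℝ) (x : Cell) : X :=
  rsTerm u h x - (ksIntegral u h a x.hi - ksIntegral u h a x.lo)

section Deviation

variable {X : Type*} [NormedAddCommGroup X] [NormedSpace ℝ X] {u : ℝ → X} {h : ℝ → ℝ}

theorem cellSum_deviation {c d : ℝ} (hl : Chain c d l) :
    cellSum (deviation u h a) l =
      cellSum (rsTerm u h) l - (ksIntegral u h a d - ksIntegral u h a c) := by
  rw [← cellSum_increment hl, ← cellSum_sub]
  rfl

theorem KSIntegrable.tendsto_cellSum_deviation [CompleteSpace X] {c d : ℝ}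
    (hu : KSIntegrable u h a b) (hac : a ≤ c) (hcd : c ≤ d) (hdb : d ≤ b) :
    Tendsto (cellSum (deviation u h a)) (gaugeFilter c d) (𝓝 0) := by
  rw [← sub_self (ksIntegral u h a d - ksIntegral u h a c)]
  refine ((hasKSIntegral_iff.1 (hu.hasKSIntegral_sub hac hcd hdb)).sub_const _).congr' ?_
  filter_upwards [eventually_chain c d] with l hl
  exact (cellSum_deviation hl).symm

theorem saks_henstock [CompleteSpace X] (hab : a ≤ b) (hu : KSIntegrable u h a b) (hε : 0 < ε) :
    ∃ δ : ℝ → ℝ, (∀ s, 0 < δ s) ∧ ∀ l, Chain a b l → ∀ l', l'.Sublist l → FineFor δ l' →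
      ‖cellSum (deviation u h a) l'‖ ≤ ε := by
  obtain ⟨δ, hδ, hδε⟩ := eventually_gaugeFilter.1
    ((hu.tendsto_cellSum_deviation le_rfl hab le_rfl).norm.eventually_le_const
      (by rwa [norm_zero]))
  refine ⟨δ, hδ, fun l hl l' hsub hf => norm_cellSum_sublist_le hδε ?_ hl hsub hf⟩
  intro c d hac hcd hdb η hη
  have := gaugeFilter_neBot hcd
  obtain ⟨m, hGm, hm, hfm⟩ := (((hu.tendsto_cellSum_deviation hac hcd hdb).norm.eventually_le_const
    (by rwa [norm_zero])).and ((eventually_chain c d).and (eventually_fineFor c d hδ))).exists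
  exact ⟨m, hm, hfm, hGm⟩

end Deviation

variable {u h : ℝ → ℝ}

theorem saks_henstock_abs (hab : a ≤ b) (hu : KSIntegrable u h a b) (hε : 0 < ε) :
    ∃ δ : ℝ → ℝ, (∀ s, 0 < δ s) ∧ ∀ l, Chain a b l → ∀ l', l'.Sublist l → FineFor δ l' →
      cellSum (fun x => |deviation u h a x|) l' ≤ ε := by
  obtain ⟨δ, hδ, H⟩ := saks_henstock hab hu (half_pos hε)
  refine ⟨δ, hδ, fun l hl l' hsub hf => ?_⟩
  have hfilter : ∀ p : Cell → Bool, |cellSum (deviation u h a) (l'.filter p)| ≤ ε / 2 := fun p =>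
    H l hl _ (List.filter_sublist.trans hsub) (hf.sublist List.filter_sublist)
  rw [cellSum_abs_eq]
  linarith [(abs_le.1 (hfilter fun x => 0 ≤ deviation u h a x)).2,
    (abs_le.1 (hfilter fun x => ¬0 ≤ deviation u h a x)).1]

theorem tendsto_cellSum_abs_deviation (hab : a ≤ b) (hu : KSIntegrable u h a b) :
    Tendsto (cellSum fun x => |deviation u h a x|) (gaugeFilter a b) (𝓝 0) := by
  refine (nhds_basis_zero_abs_lt ℝ).tendsto_right_iff.2 fun ε hε => ?_
  obtain ⟨δ, hδ, H⟩ := saks_henstock_abs hab hu (half_pos hε)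
  refine eventually_gaugeFilter.2 ⟨δ, hδ, fun l hl hf => ?_⟩
  have hnonneg : 0 ≤ cellSum (fun x => |deviation u h a x|) l :=
    (norm_nonneg _).trans (norm_cellSum_le (deviation u h a) l)
  rw [mem_ofPred_eq, abs_of_nonneg hnonneg]
  exact (H l hl l (List.Sublist.refl l) hf).trans_lt (half_lt_self hε)

end SaksHenstock

/-! ## Variation and absolute integrability -/

section Increments

variable {E : Type*} [NormedAddCommGroup E] {U : ℝ → E} {a b B : ℝ}

theorem Chain.norm_increment_le_cellSum {l : List Cell} (hl : Chain a b l) :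
    ‖U b - U a‖ ≤ cellSum (fun x => ‖U x.hi - U x.lo‖) l := by
  rw [← cellSum_increment hl]
  exact norm_cellSum_le _ l

theorem Chain.eventually_cellSum_norm_increment_le {l₀ : List Cell} (hl₀ : Chain a b l₀) :
    ∀ᶠ l in gaugeFilter a b, cellSum (fun x => ‖U x.hi - U x.lo‖) l₀ ≤
      cellSum (fun x => ‖U x.hi - U x.lo‖) l := by
  induction hl₀ with
  | nil a =>
    exact .of_forall fun l => (norm_nonneg _).trans (norm_cellSum_le (fun x => U x.hi - U x.lo) l)
  | cons hac _ hl ih =>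
    refine gaugeFilter_le_map_append hac hl.le (eventually_map.2 ?_)
    filter_upwards [(eventually_chain _ _).prod_mk ih] with p hp
    rw [cellSum_cons, cellSum_append]
    exact add_le_add (hp.1.norm_increment_le_cellSum (U := U)) hp.2

theorem tendsto_cellSum_norm_increment
    (hB : IsLUB ((cellSum fun x => ‖U x.hi - U x.lo‖) '' {l | Chain a b l}) B) :
    Tendsto (cellSum fun x => ‖U x.hi - U x.lo‖) (gaugeFilter a b) (𝓝 B) := by
  refine tendsto_order.2 ⟨fun B' hB' => ?_, fun B' hB' => ?_⟩
  · obtain ⟨_, ⟨l₀, hl₀, rfl⟩, hB'l₀⟩ := (lt_isLUB_iff hB).1 hB'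
    filter_upwards [hl₀.eventually_cellSum_norm_increment_le (U := U)] with l hl
    exact hB'l₀.trans_le hl
  · filter_upwards [eventually_chain a b] with l hl
    exact (hB.1 ⟨l, hl, rfl⟩).trans_lt hB'

theorem DominatedBy.exists_tendsto_cellSum_norm_increment {W : ℝ → ℝ} (hab : a ≤ b)
    (hU : DominatedBy U W a b) :
    ∃ L, Tendsto (cellSum fun x => ‖U x.hi - U x.lo‖) (gaugeFilter a b) (𝓝 L) := by
  refine ⟨_, tendsto_cellSum_norm_increment (U := U) (isLUB_csSup ?_ ⟨W b - W a, ?_⟩)⟩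
  · exact ⟨_, [⟨a, a, b⟩], .cons hab (.inl rfl) (.nil b), rfl⟩
  · rintro _ ⟨l, hl, rfl⟩
    rw [← cellSum_increment hl]
    refine cellSum_le fun x hx => ?_
    obtain ⟨hlo, hlohi, hhi, -⟩ := hl.mem x hx
    exact hU _ _ hlo hlohi hhi

end Increments

section Lattice

variable {u v h V : ℝ → ℝ} {a b C : ℝ}

/-- `V` is the variation of `h` on `[a, b]`, up to a constant. -/
structure IsVariation (h V : ℝ → ℝ) (a b : ℝ) : Prop where
  dominated : DominatedBy h V a b
  tendsto : Tendsto (cellSum fun x => ‖h x.hi - h x.lo‖) (gaugeFilter a b) (𝓝 (V b - V a))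

theorem DominatedBy.isVariation_self (hV : DominatedBy V V a b) : IsVariation V V a b := by
  refine ⟨hV, tendsto_const_nhds.congr' ?_⟩
  filter_upwards [eventually_chain a b] with l hl
  rw [← cellSum_increment hl]
  refine cellSum_congr fun x hx => ?_
  obtain ⟨hlo, hlohi, hhi, -⟩ := hl.mem x hx
  exact (Real.norm_of_nonneg (hV.increment_nonneg hlo hlohi hhi)).symm

theorem KSIntegrable.dominatedBy_ksIntegral_of_abs_le (hV : DominatedBy h V a b)
    (hu : KSIntegrable u h a b) (hC : ∀ s ∈ Icc a b, |u s| ≤ C) :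
    DominatedBy (ksIntegral u h a) (fun t => C * V t) a b :=
  fun _ _ hac hcd hdb =>
    ((hu.hasKSIntegral_sub hac hcd hdb).norm_le_const hcd (hV.mono hac hdb) fun _ hs =>
      hC _ ⟨hac.trans hs.1, hs.2.trans hdb⟩).trans_eq (mul_sub _ _ _)

theorem tendsto_cellSum_abs_rsTerm_sub (hab : a ≤ b) (hu : KSIntegrable u h a b) :
    Tendsto (cellSum fun x => |rsTerm u h x| - ‖ksIntegral u h a x.hi - ksIntegral u h a x.lo‖)
      (gaugeFilter a b) (𝓝 0) :=
  squeeze_zero_norm (fun l => (norm_cellSum_le _ l).trans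
    (cellSum_le fun _ _ => abs_abs_sub_abs_le_abs_sub _ _)) (tendsto_cellSum_abs_deviation hab hu)

theorem IsVariation.tendsto_cellSum_mul_sub (hV : IsVariation h V a b)
    (hC : ∀ s ∈ Icc a b, |u s| ≤ C) :
    Tendsto (cellSum fun x => |u x.tag| * ((V x.hi - V x.lo) - ‖h x.hi - h x.lo‖))
      (gaugeFilter a b) (𝓝 0) := by
  have hbound : Tendsto (fun l => C * ((V b - V a) - cellSum (fun x => ‖h x.hi - h x.lo‖) l))
      (gaugeFilter a b) (𝓝 0) := by
    simpa only [sub_self, mul_zero] using (hV.tendsto.const_sub (V b - V a)).const_mul C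
  refine squeeze_zero_norm' ?_ hbound
  filter_upwards [eventually_chain a b] with l hl
  rw [← cellSum_increment hl, ← cellSum_sub, ← cellSum_mul_left]
  refine (norm_cellSum_le _ l).trans (cellSum_le fun x hx => ?_)
  obtain ⟨hlo, hlohi, hhi, -⟩ := hl.mem x hx
  have hnonneg := sub_nonneg.2 (hV.dominated _ _ hlo hlohi hhi)
  rw [Real.norm_eq_abs, abs_mul, abs_abs, abs_of_nonneg hnonneg]
  exact mul_le_mul_of_nonneg_right (hC _ (hl.tag_mem hx)) hnonneg

-- Both `∑ ||u| |Δh| - |ΔU||` (Saks-Henstock, `U` the indefinite integral) and `∑ |u| (ΔV - |Δh|)`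
-- tend to `0`, while `∑ |ΔU|` converges to the variation of `U`.
theorem KSIntegrable.abs (hab : a ≤ b) (hV : IsVariation h V a b) (hu : KSIntegrable u h a b)
    (hC : ∀ s ∈ Icc a b, |u s| ≤ C) : KSIntegrable (fun s => |u s|) V a b := by
  obtain ⟨L, hL⟩ :=
    (hu.dominatedBy_ksIntegral_of_abs_le hV.dominated hC).exists_tendsto_cellSum_norm_increment hab
  refine ⟨0 + 0 + L, hasKSIntegral_iff.2 ?_⟩
  refine (((hV.tendsto_cellSum_mul_sub hC).add
    (tendsto_cellSum_abs_rsTerm_sub hab hu)).add hL).congr fun l => ?_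
  rw [← cellSum_add, ← cellSum_add]
  refine cellSum_congr fun x _ => ?_
  simp only [rsTerm, smul_eq_mul, abs_mul, Real.norm_eq_abs]
  ring

theorem KSIntegrable.norm {n : ℕ} {w : ℝ → Vec n} (hab : a ≤ b) (hV : IsVariation h V a b)
    (hw : KSIntegrable w h a b) (hC : ∀ s ∈ Icc a b, ‖w s‖ ≤ C) :
    KSIntegrable (fun s => ‖w s‖) V a b := by
  obtain ⟨I, hI⟩ := hw
  have hcoord : ∀ i, KSIntegrable (fun s => ‖w s i‖) V a b := fun i =>
    KSIntegrable.abs hab hV ⟨_, hI.map (PiLp.proj 1 (fun _ : Fin n => ℝ) i)⟩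
      fun s hs => (PiLp.norm_apply_le (w s) i).trans (hC s hs)
  have hsum : ∀ t : Finset (Fin n), KSIntegrable (fun s => ∑ i ∈ t, ‖w s i‖) V a b := by
    intro t
    induction t using Finset.induction_on with
    | empty => exact ⟨_, hasKSIntegral_const 0⟩
    | insert i t hi ih =>
      obtain ⟨J, hJ⟩ := ih
      obtain ⟨K, hK⟩ := hcoord i
      exact ⟨_, (hK.add hJ).congr fun s _ =>
        (Finset.sum_insert (f := fun i => ‖w s i‖) hi).symm⟩
  simpa only [PiLp.norm_eq_of_L1] using hsum Finset.univ

theorem KSIntegrable.max (hab : a ≤ b) (hV : DominatedBy V V a b) (hu : KSIntegrable u V a b)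
    (hv : KSIntegrable v V a b) (hC : ∀ s ∈ Icc a b, |u s| ≤ C) (hC' : ∀ s ∈ Icc a b, |v s| ≤ C) :
    KSIntegrable (fun s => max (u s) (v s)) V a b := by
  obtain ⟨I, hI⟩ := hu
  obtain ⟨J, hJ⟩ := hv
  obtain ⟨K, hK⟩ := KSIntegrable.abs (C := C + C) hab hV.isVariation_self ⟨_, hI.sub hJ⟩
    fun s hs => (abs_sub _ _).trans (add_le_add (hC s hs) (hC' s hs))
  refine ⟨_, (((hI.add hJ).add hK).smul 2⁻¹).congr fun s _ => ?_⟩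
  rw [abs_sub_comm]
  exact (sup_eq_half_smul_add_add_abs_sub' ℝ (u s) (v s)).symm

theorem KSIntegrable.partialSups {d : ℕ → ℝ → ℝ} (hab : a ≤ b) (hV : DominatedBy V V a b)
    (hd : ∀ j, KSIntegrable (d j) V a b) (hC : ∀ j, ∀ s ∈ Icc a b, |d j s| ≤ C) (K : ℕ) :
    KSIntegrable (fun s => partialSups (fun j => d j s) K) V a b ∧
      ∀ s ∈ Icc a b, |partialSups (fun j => d j s) K| ≤ C := by
  induction K with
  | zero => simpa only [partialSups_zero] using ⟨hd 0, hC 0⟩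
  | succ K ih =>
    simp only [partialSups_add_one]
    exact ⟨ih.1.max hab hV (hd _) ih.2 (hC _), fun s hs =>
      (abs_max_le_max_abs_abs).trans (max_le (ih.2 s hs) (hC _ s hs))⟩

end Lattice

/-! ## Convergence theorems -/

section VaryingIntegrand

theorem cellSum_eq_sum_filter {X : Type*} [AddCommGroup X] (F : Cell → X) (k : Cell → ℕ)
    (l : List Cell) :
    cellSum F l = ∑ j ∈ (l.map k).toFinset, cellSum F (l.filter fun x => k x = j) := by
  have hsum_ite : ∀ (s : Finset ℕ) (l : List Cell),
      cellSum (fun x => ∑ j ∈ s, if k x = j then F x else 0) l =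
        ∑ j ∈ s, cellSum (fun x => if k x = j then F x else 0) l := fun s l => by
    induction l with
    | nil => simp
    | cons x l ih => simp only [cellSum_cons, ih, Finset.sum_add_distrib]
  simp only [cellSum_filter, ← hsum_ite]
  refine cellSum_congr fun x hx => ?_
  rw [Finset.sum_ite_eq, if_pos (List.mem_toFinset.2 (List.mem_map_of_mem hx))]

variable {X : Type*} [NormedAddCommGroup X] [NormedSpace ℝ X] {h V : ℝ → ℝ} {a b ε : ℝ}
  {l : List Cell}

theorem exists_gauges_norm_cellSum_deviation_le [CompleteSpace X] {u : ℕ → ℝ → X} (hab : a ≤ b)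
    (hu : ∀ j, KSIntegrable (u j) h a b) (hε : 0 < ε) :
    ∃ δ : ℕ → ℝ → ℝ, (∀ j s, 0 < δ j s) ∧ ∀ (k : ℝ → ℕ) (l : List Cell), Chain a b l →
      FineFor (fun s => δ (k s) s) l →
        ‖cellSum (fun x => deviation (u (k x.tag)) h a x) l‖ ≤ ε := by
  choose δ hδ H using fun j : ℕ => saks_henstock hab (hu j) (ε := ε / 2 / 2 ^ j) (by positivity)
  refine ⟨δ, hδ, fun k l hl hf => ?_⟩
  rw [cellSum_eq_sum_filter _ (fun x => k x.tag)]
  refine (norm_sum_le_of_le _ fun j _ => ?_).trans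
    (sum_le_hasSum _ (fun j _ => by positivity) (hasSum_geometric_two' ε))
  have hfilter : ∀ x ∈ l.filter fun x => k x.tag = j, x ∈ l ∧ k x.tag = j := by simp
  rw [cellSum_congr (G := deviation (u j) h a) fun x hx => by rw [(hfilter x hx).2]]
  refine H j l hl _ List.filter_sublist fun x hx => ?_
  obtain ⟨hxl, rfl⟩ := hfilter x hx
  exact hf x hxl

theorem norm_cellSum_rsTerm_sub_le {u v : ℝ → X} (hV : DominatedBy h V a b)
    (huv : ∀ s ∈ Icc a b, ‖u s - v s‖ ≤ ε) (hl : Chain a b l) :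
    ‖cellSum (rsTerm u h) l - cellSum (rsTerm v h) l‖ ≤ ε * (V b - V a) := by
  simp only [← cellSum_sub, ← rsTerm_sub]
  refine (norm_cellSum_rsTerm_le hV huv hl).trans_eq ?_
  rw [← cellSum_increment hl, ← cellSum_mul_left]
  exact cellSum_congr fun x _ => mul_comm _ _

end VaryingIntegrand

section Comparison

variable {X : Type*} [NormedAddCommGroup X] [NormedSpace ℝ X] [CompleteSpace X] {u v : ℝ → X}
  {m m' h V : ℝ → ℝ} {a b c d t : ℝ}

theorem KSIntegrable.increment_le (hV : DominatedBy V V a b) (hm : KSIntegrable m V a b)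
    (hm' : KSIntegrable m' V a b) (hle : ∀ s ∈ Icc c d, m s ≤ m' s) (hac : a ≤ c) (hcd : c ≤ d)
    (hdb : d ≤ b) :
    ksIntegral m V a d - ksIntegral m V a c ≤ ksIntegral m' V a d - ksIntegral m' V a c :=
  (hm.hasKSIntegral_sub hac hcd hdb).mono_of_le hcd (hV.mono hac hdb) hle
    (hm'.hasKSIntegral_sub hac hcd hdb)

theorem ksIntegral_mono_of_le (hab : a ≤ b) (hV : DominatedBy V V a b)
    (hm : KSIntegrable m V a b) (hm' : KSIntegrable m' V a b)
    (hle : ∀ s ∈ Icc a b, m s ≤ m' s) : ksIntegral m V a b ≤ ksIntegral m' V a b :=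
  (hm.hasKSIntegral hab).mono_of_le hab hV hle (hm'.hasKSIntegral hab)

theorem norm_ksIntegral_sub_le (hV : DominatedBy h V a b) (hu : KSIntegrable u h a b)
    (hv : KSIntegrable v h a b) (hm : KSIntegrable m V a b)
    (huv : ∀ s ∈ Icc a b, ‖u s - v s‖ ≤ m s) (ht : t ∈ Icc a b) :
    ‖ksIntegral u h a t - ksIntegral v h a t‖ ≤ ksIntegral m V a b := by
  have huvt := ((hu.mono le_rfl ht.1 ht.2).hasKSIntegral ht.1).sub
    ((hv.mono le_rfl ht.1 ht.2).hasKSIntegral ht.1)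
  have hmt := (hm.mono le_rfl ht.1 ht.2).hasKSIntegral ht.1
  have htail : 0 ≤ ksIntegral m V a b - ksIntegral m V a t := by
    have := (hasKSIntegral_const (h := V) (0 : ℝ)).mono_of_le ht.2 (hV.self.mono ht.1 le_rfl)
      (fun s hs => (norm_nonneg _).trans (huv s ⟨ht.1.trans hs.1, hs.2⟩))
      (hm.hasKSIntegral_sub ht.1 ht.2 le_rfl)
    rwa [smul_zero] at this
  exact (huvt.norm_le ht.1 (hV.mono le_rfl ht.2) (fun s hs => huv s ⟨hs.1, hs.2.trans ht.2⟩)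
    hmt).trans (sub_nonneg.1 htail)

end Comparison

section MonotoneConvergence

variable {V : ℝ → ℝ} {a b C : ℝ} {u : ℕ → ℝ → ℝ} {u' : ℝ → ℝ}

theorem exists_mem_Icc_cellSum_integral (hV : DominatedBy V V a b)
    (hu : ∀ j, KSIntegrable (u j) V a b) (hmono : ∀ s ∈ Icc a b, Monotone fun j => u j s)
    {N : ℕ} {k : ℝ → ℕ} (hk : ∀ s, N ≤ k s) {l : List Cell} (hl : Chain a b l) :
    ∃ K, cellSum (fun x => ksIntegral (u (k x.tag)) V a x.hi -
      ksIntegral (u (k x.tag)) V a x.lo) l ∈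
        Icc (ksIntegral (u N) V a b) (ksIntegral (u K) V a b) := by
  obtain ⟨K, hK⟩ := (l.map fun x => k x.tag).toFinset.exists_le
  have htotal : ∀ j, cellSum (fun x => ksIntegral (u j) V a x.hi - ksIntegral (u j) V a x.lo) l =
      ksIntegral (u j) V a b := fun j => by rw [cellSum_increment hl, ksIntegral_self, sub_zero]
  have hcell : ∀ x ∈ l, ∀ i j, i ≤ j →
      ksIntegral (u i) V a x.hi - ksIntegral (u i) V a x.lo ≤
        ksIntegral (u j) V a x.hi - ksIntegral (u j) V a x.lo := fun x hx i j hij => by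
    obtain ⟨hlo, hlohi, hhi, -⟩ := hl.mem x hx
    exact (hu i).increment_le hV (hu j)
      (fun s hs => hmono s ⟨hlo.trans hs.1, hs.2.trans hhi⟩ hij) hlo hlohi hhi
  refine ⟨K, ?_, ?_⟩
  · rw [← htotal N]
    exact cellSum_le fun x hx => hcell x hx _ _ (hk _)
  · rw [← htotal K]
    exact cellSum_le fun x hx => hcell x hx _ _
      (hK _ (List.mem_toFinset.2 (List.mem_map_of_mem hx)))

-- Each tag `s` gets an index `k s ≥ N` with `u (k s) s` close to `u' s`; the terms of the sum for
-- `u'` are then compared with the integrals of `u (k s)` over the cells tagged by `s`.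
theorem hasKSIntegral_of_monotone {J : ℝ} (hab : a ≤ b) (hV : DominatedBy V V a b)
    (hu : ∀ j, KSIntegrable (u j) V a b) (hmono : ∀ s ∈ Icc a b, Monotone fun j => u j s)
    (hlim : ∀ s ∈ Icc a b, Tendsto (fun j => u j s) atTop (𝓝 (u' s)))
    (hJ : Tendsto (fun j => ksIntegral (u j) V a b) atTop (𝓝 J)) :
    HasKSIntegral u' V a b J := by
  rw [hasKSIntegral_iff]
  refine Metric.tendsto_nhds.2 fun ε₀ hε₀ => ?_
  have hD := hV.increment_nonneg le_rfl hab le_rfl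
  obtain ⟨ε, hε, hεD⟩ : ∃ ε > 0, ε * (V b - V a) + ε + ε < ε₀ := by
    refine ⟨ε₀ / (V b - V a + 3), by positivity, ?_⟩
    rw [← mul_add_one, ← mul_add_one, div_mul_eq_mul_div, div_lt_iff₀ (by positivity)]
    exact mul_lt_mul_of_pos_left (by linarith) hε₀
  have hJle : ∀ j, ksIntegral (u j) V a b ≤ J := Monotone.ge_of_tendsto
    (fun i j hij => ksIntegral_mono_of_le hab hV (hu i) (hu j) fun s hs => hmono s hs hij) hJ
  obtain ⟨N, hN⟩ := (hJ.eventually (lt_mem_nhds (sub_lt_self J hε))).exists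
  have hindex : ∀ s, ∃ k ≥ N, s ∈ Icc a b → ‖u' s - u k s‖ ≤ ε := fun s => by
    by_cases hs : s ∈ Icc a b
    · obtain ⟨k, hdist, hNk⟩ := ((Metric.tendsto_nhds.1 (hlim s hs) ε hε).and
        (eventually_ge_atTop N)).exists
      exact ⟨k, hNk, fun _ => by rw [← dist_eq_norm, dist_comm]; exact hdist.le⟩
    · exact ⟨N, le_rfl, fun h => absurd h hs⟩
  choose k hNk hk using hindex
  obtain ⟨δ, hδ, hdev⟩ := exists_gauges_norm_cellSum_deviation_le hab hu hε
  refine eventually_gaugeFilter.2 ⟨fun s => δ (k s) s, fun s => hδ _ _, fun l hl hf => ?_⟩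
  have happrox := norm_cellSum_rsTerm_sub_le (u := u') (v := fun s => u (k s) s) hV hk hl
  have hdev := hdev k l hl hf
  obtain ⟨K, hNJ, hJK⟩ := exists_mem_Icc_cellSum_integral hV hu hmono hNk hl
  have hsplit : cellSum (rsTerm (fun s => u (k s) s) V) l =
      cellSum (fun x => deviation (u (k x.tag)) V a x) l +
        cellSum (fun x => ksIntegral (u (k x.tag)) V a x.hi -
          ksIntegral (u (k x.tag)) V a x.lo) l := by
    rw [← cellSum_add]
    exact cellSum_congr fun x _ => (sub_add_cancel _ _).symm
  rw [Real.norm_eq_abs, abs_le] at happrox hdev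
  rw [Real.dist_eq, abs_lt]
  constructor <;> linarith [hJle K]

theorem ksIntegrable_of_monotone (hab : a ≤ b) (hV : DominatedBy V V a b)
    (hu : ∀ j, KSIntegrable (u j) V a b) (hC : ∀ j, ∀ s ∈ Icc a b, |u j s| ≤ C)
    (hmono : ∀ s ∈ Icc a b, Monotone fun j => u j s)
    (hlim : ∀ s ∈ Icc a b, Tendsto (fun j => u j s) atTop (𝓝 (u' s))) :
    KSIntegrable u' V a b ∧
      Tendsto (fun j => ksIntegral (u j) V a b) atTop (𝓝 (ksIntegral u' V a b)) := by
  have hJ := tendsto_atTop_ciSup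
    (fun i j hij => ksIntegral_mono_of_le hab hV (hu i) (hu j) fun s hs => hmono s hs hij)
    ⟨C * (V b - V a), by
      rintro _ ⟨j, rfl⟩
      exact (le_abs_self _).trans (((hu j).hasKSIntegral hab).norm_le_const hab hV (hC j))⟩
  have hu' := hasKSIntegral_of_monotone hab hV hu hmono hlim hJ
  rw [hu'.ksIntegral_eq hab]
  exact ⟨⟨_, hu'⟩, hJ⟩

theorem tendsto_ksIntegral_of_antitone_zero (hab : a ≤ b) (hV : DominatedBy V V a b)
    (hu : ∀ j, KSIntegrable (u j) V a b) (hC : ∀ j, ∀ s ∈ Icc a b, |u j s| ≤ C)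
    (hanti : ∀ s ∈ Icc a b, Antitone fun j => u j s)
    (hlim : ∀ s ∈ Icc a b, Tendsto (fun j => u j s) atTop (𝓝 0)) :
    Tendsto (fun j => ksIntegral (u j) V a b) atTop (𝓝 0) := by
  have hneg : ∀ j, HasKSIntegral (fun s => -u j s) V a b (-ksIntegral (u j) V a b) := fun j => by
    simpa only [neg_one_smul] using ((hu j).hasKSIntegral hab).smul (-1)
  have hneg_lim := (ksIntegrable_of_monotone (u := fun j s => -u j s) (u' := fun _ => 0) hab hV
    (fun j => ⟨_, hneg j⟩) (fun j s hs => (abs_neg (u j s)).trans_le (hC j s hs))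
    (fun s hs => (hanti s hs).neg) fun s hs => by simpa only [neg_zero] using (hlim s hs).neg).2
  simp only [(hneg _).ksIntegral_eq hab, (hasKSIntegral_const (0 : ℝ)).ksIntegral_eq hab,
    smul_zero] at hneg_lim
  simpa only [neg_neg, neg_zero] using hneg_lim.neg

theorem ksIntegrable_ciSup {ι : Type*} [Countable ι] [Nonempty ι] {d : ι → ℝ → ℝ} (hab : a ≤ b)
    (hV : DominatedBy V V a b) (hd : ∀ i, KSIntegrable (d i) V a b)
    (hC : ∀ i, ∀ s ∈ Icc a b, |d i s| ≤ C) : KSIntegrable (fun s => ⨆ i, d i s) V a b := by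
  obtain ⟨e, he⟩ := exists_surjective_nat ι
  have hsups := KSIntegrable.partialSups hab hV (fun j => hd (e j)) fun j => hC (e j)
  refine (ksIntegrable_of_monotone hab hV (fun K => (hsups K).1) (fun K => (hsups K).2)
    (fun s _ => (partialSups _).monotone) fun s hs => ?_).1
  rw [← he.iSup_comp, ← ciSup_partialSups_eq]
  · refine tendsto_atTop_ciSup (partialSups _).monotone ⟨C, ?_⟩
    rintro _ ⟨K, rfl⟩
    exact (le_abs_self _).trans ((hsups K).2 s hs)
  · refine ⟨C, ?_⟩
    rintro _ ⟨j, rfl⟩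
    exact (le_abs_self _).trans (hC _ s hs)

end MonotoneConvergence

section TailDiam

variable {E : Type*} [NormedAddCommGroup E] {x : ℕ → E} {y : E}

theorem norm_sub_le_diam_image_Ici (hx : Bornology.IsBounded (range x)) {i j N : ℕ} (hi : N ≤ i)
    (hj : N ≤ j) : ‖x i - x j‖ ≤ Metric.diam (x '' Ici N) := by
  rw [← dist_eq_norm]
  exact Metric.dist_le_diam_of_mem (hx.subset (image_subset_range _ _)) ⟨i, hi, rfl⟩ ⟨j, hj, rfl⟩

theorem diam_image_Ici_eq_ciSup (hx : Bornology.IsBounded (range x)) (N : ℕ) :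
    Metric.diam (x '' Ici N) = ⨆ p : ℕ × ℕ, ‖x (N + p.1) - x (N + p.2)‖ := by
  have hle : ∀ p : ℕ × ℕ, ‖x (N + p.1) - x (N + p.2)‖ ≤ Metric.diam (x '' Ici N) := fun p =>
    norm_sub_le_diam_image_Ici hx (N.le_add_right _) (N.le_add_right _)
  refine le_antisymm (Metric.diam_le_of_forall_dist_le
    (Real.iSup_nonneg fun _ => norm_nonneg _) ?_) (ciSup_le hle)
  rintro _ ⟨i, hi, rfl⟩ _ ⟨j, hj, rfl⟩
  obtain ⟨i, rfl⟩ := Nat.exists_eq_add_of_le hi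
  obtain ⟨j, rfl⟩ := Nat.exists_eq_add_of_le hj
  rw [dist_eq_norm]
  exact le_ciSup (f := fun p : ℕ × ℕ => ‖x (N + p.1) - x (N + p.2)‖)
    ⟨_, forall_mem_range.2 hle⟩ (i, j)

theorem antitone_diam_image_Ici (hx : Bornology.IsBounded (range x)) :
    Antitone fun N => Metric.diam (x '' Ici N) := fun _ _ hNM =>
  Metric.diam_mono (image_mono (Ici_subset_Ici.2 hNM)) (hx.subset (image_subset_range _ _))

theorem tendsto_diam_image_Ici (hx : CauchySeq x) :
    Tendsto (fun N => Metric.diam (x '' Ici N)) atTop (𝓝 0) := by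
  refine (nhds_basis_zero_abs_lt ℝ).tendsto_right_iff.2 fun ε hε => ?_
  obtain ⟨N, hN⟩ := Metric.cauchySeq_iff.1 hx (ε / 2) (half_pos hε)
  filter_upwards [eventually_ge_atTop N] with M hM
  rw [abs_of_nonneg Metric.diam_nonneg]
  refine (Metric.diam_le_of_forall_dist_le (half_pos hε).le ?_).trans_lt (half_lt_self hε)
  rintro _ ⟨i, hi, rfl⟩ _ ⟨j, hj, rfl⟩
  exact (hN i (hM.trans hi) j (hM.trans hj)).le

theorem norm_sub_limit_le_diam_image_Ici (hx : Tendsto x atTop (𝓝 y)) (N : ℕ) :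
    ‖x N - y‖ ≤ Metric.diam (x '' Ici N) :=
  le_of_tendsto (hx.const_sub (x N)).norm <| (eventually_ge_atTop N).mono fun _ hj =>
    norm_sub_le_diam_image_Ici (Metric.isBounded_range_of_tendsto x hx) le_rfl hj

end TailDiam

section BoundedConvergence

variable {n : ℕ} {h V : ℝ → ℝ} {a b C : ℝ} {u : ℕ → ℝ → Vec n} {u' : ℝ → Vec n}

theorem ksIntegrable_diam_image_Ici (hab : a ≤ b) (hV : IsVariation h V a b)
    (hu : ∀ k, KSIntegrable (u k) h a b) (hC : ∀ k, ∀ s ∈ Icc a b, ‖u k s‖ ≤ C) (N : ℕ) :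
    KSIntegrable (fun s => Metric.diam ((fun k => u k s) '' Ici N)) V a b := by
  have hsub : ∀ i j, ∀ s ∈ Icc a b, ‖u i s - u j s‖ ≤ C + C := fun i j s hs =>
    (norm_sub_le _ _).trans (add_le_add (hC i s hs) (hC j s hs))
  have hnorm : ∀ i j, KSIntegrable (fun s => ‖u i s - u j s‖) V a b := fun i j => by
    obtain ⟨I, hI⟩ := hu i
    obtain ⟨J, hJ⟩ := hu j
    exact KSIntegrable.norm hab hV ⟨_, hI.sub hJ⟩ (hsub i j)
  obtain ⟨J, hJ⟩ := ksIntegrable_ciSup (d := fun (p : ℕ × ℕ) s => ‖u (N + p.1) s - u (N + p.2) s‖)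
    hab hV.dominated.self (fun p => hnorm _ _) fun p s hs => (abs_norm _).trans_le (hsub _ _ s hs)
  exact ⟨J, hJ.congr fun s hs => (diam_image_Ici_eq_ciSup (isBounded_iff_forall_norm_le.2
    ⟨C, forall_mem_range.2 fun k => hC k s hs⟩) N).symm⟩

-- The integrals of the diameters of the tails of `k ↦ u k s` tend to `0` by monotone convergence.
theorem ksIntegral_bounded_convergence (hab : a ≤ b) (hV : IsVariation h V a b)
    (hu : ∀ k, KSIntegrable (u k) h a b) (hC : ∀ k, ∀ s ∈ Icc a b, ‖u k s‖ ≤ C)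
    (hlim : ∀ s ∈ Icc a b, Tendsto (fun k => u k s) atTop (𝓝 (u' s))) :
    KSIntegrable u' h a b ∧ ∃ η : ℕ → ℝ, Tendsto η atTop (𝓝 0) ∧ ∀ k, ∀ t ∈ Icc a b,
      ‖ksIntegral (u k) h a t - ksIntegral u' h a t‖ ≤ η k := by
  set w : ℕ → ℝ → ℝ := fun N s => Metric.diam ((fun k => u k s) '' Ici N)
  have hbdd : ∀ s ∈ Icc a b, Bornology.IsBounded (range fun k => u k s) := fun s hs =>
    Metric.isBounded_range_of_tendsto _ (hlim s hs)
  have hw := ksIntegrable_diam_image_Ici hab hV hu hC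
  have hw_bound : ∀ N, ∀ s ∈ Icc a b, |w N s| ≤ C + C := fun N s hs => by
    rw [abs_of_nonneg Metric.diam_nonneg]
    refine Metric.diam_le_of_forall_dist_le_of_nonempty (nonempty_Ici.image _) ?_
    rintro _ ⟨i, -, rfl⟩ _ ⟨j, -, rfl⟩
    exact (dist_le_norm_add_norm _ _).trans (add_le_add (hC i s hs) (hC j s hs))
  have hw_lim : Tendsto (fun N => ksIntegral (w N) V a b) atTop (𝓝 0) :=
    tendsto_ksIntegral_of_antitone_zero hab hV.dominated.self hw hw_bound
      (fun s hs => antitone_diam_image_Ici (hbdd s hs))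
      fun s hs => tendsto_diam_image_Ici (hlim s hs).cauchySeq
  have huw : ∀ N, ∀ s ∈ Icc a b, ‖u N s - u' s‖ ≤ w N s := fun N s hs =>
    norm_sub_limit_le_diam_image_Ici (hlim s hs) N
  have hu' : KSIntegrable u' h a b := ksIntegrable_of_approx hab hV.dominated fun ε hε => by
    obtain ⟨N, hN⟩ := (hw_lim.eventually (gt_mem_nhds hε)).exists
    exact ⟨u N, w N, _, hu N, (hw N).hasKSIntegral hab, hN, fun s hs => by
      rw [norm_sub_rev]; exact huw N s hs⟩
  exact ⟨hu', _, hw_lim, fun k t ht =>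
    norm_ksIntegral_sub_le hV.dominated (hu k) hu' (hw k) (huw k) ht⟩

end BoundedConvergence

section Variation

variable {X : Type*} [NormedAddCommGroup X] {h : ℝ → X} {a b : ℝ}

theorem dominatedBy_variationOnFromTo (hb : BoundedVariationOn h (Icc a b)) :
    DominatedBy h (variationOnFromTo h (Icc a b) a) a b := by
  intro c d hc hcd hd
  have hbv := hb.locallyBoundedVariationOn
  have ha_mem : a ∈ Icc a b := ⟨le_rfl, hc.trans (hcd.trans hd)⟩
  have hc_mem : c ∈ Icc a b := ⟨hc, hcd.trans hd⟩
  have hd_mem : d ∈ Icc a b := ⟨hc.trans hcd, hd⟩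
  rw [← variationOnFromTo.add hbv ha_mem hc_mem hd_mem, add_sub_cancel_left]
  rw [variationOnFromTo.eq_of_le h _ hcd, ← dist_eq_norm, dist_edist]
  exact ENNReal.toReal_mono (hbv c d hc_mem hd_mem)
    (eVariationOn.edist_le h ⟨hd_mem, hcd, le_rfl⟩ ⟨hc_mem, le_rfl, hcd⟩)

theorem exists_chain_cellSum_eq_sum_range {u : ℕ → ℝ} (hu : Monotone u) (q : ℝ → ℝ → ℝ) (N : ℕ) :
    ∃ l, Chain (u 0) (u N) l ∧
      cellSum (fun x => q x.lo x.hi) l = ∑ i ∈ Finset.range N, q (u i) (u (i + 1)) := by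
  induction N with
  | zero => exact ⟨[], .nil _, by simp⟩
  | succ N ih =>
    obtain ⟨l, hl, hsum⟩ := ih
    refine ⟨l ++ [⟨u N, u N, u (N + 1)⟩],
      hl.append (.cons (hu (Nat.le_succ N)) (.inl rfl) (.nil _)), ?_⟩
    rw [cellSum_append, hsum, Finset.sum_range_succ, cellSum_cons, cellSum_nil, add_zero]

theorem sum_norm_increment_le_of_mem_upperBounds {B : ℝ}
    (hB : B ∈ upperBounds ((cellSum fun x => ‖h x.hi - h x.lo‖) '' {l | Chain a b l}))
    {u : ℕ → ℝ} (hu : Monotone u) (hu_mem : ∀ i, u i ∈ Icc a b) (N : ℕ) :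
    ∑ i ∈ Finset.range N, ‖h (u (i + 1)) - h (u i)‖ ≤ B := by
  obtain ⟨l, hl, hsum⟩ := exists_chain_cellSum_eq_sum_range hu (fun c d => ‖h d - h c‖) N
  have hle := hB ⟨⟨a, a, u 0⟩ :: (l ++ [⟨u N, u N, b⟩]), .cons (hu_mem 0).1 (.inl rfl)
    (hl.append (.cons (hu_mem N).2 (.inl rfl) (.nil b))), rfl⟩
  rw [cellSum_cons, cellSum_append, hsum, cellSum_cons, cellSum_nil] at hle
  linarith [norm_nonneg (h (u 0) - h a), norm_nonneg (h b - h (u N))]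

theorem isLUB_cellSum_norm_increment (hab : a ≤ b) (hb : BoundedVariationOn h (Icc a b)) :
    IsLUB ((cellSum fun x => ‖h x.hi - h x.lo‖) '' {l | Chain a b l})
      (eVariationOn h (Icc a b)).toReal := by
  constructor
  · rintro _ ⟨l, hl, rfl⟩
    calc cellSum (fun x => ‖h x.hi - h x.lo‖) l
        ≤ cellSum (fun x => variationOnFromTo h (Icc a b) a x.hi -
            variationOnFromTo h (Icc a b) a x.lo) l := cellSum_le fun x hx => by
          obtain ⟨hlo, hlohi, hhi, -⟩ := hl.mem x hx
          exact dominatedBy_variationOnFromTo hb _ _ hlo hlohi hhi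
      _ = (eVariationOn h (Icc a b)).toReal := by
          rw [cellSum_increment hl, variationOnFromTo.self, sub_zero,
            variationOnFromTo.eq_of_le h _ hab, inter_self]
  · intro B hB
    have hB_nonneg : 0 ≤ B := by
      simpa using sum_norm_increment_le_of_mem_upperBounds hB monotone_const
        (fun _ => left_mem_Icc.2 hab) 0
    refine ENNReal.toReal_le_of_le_ofReal hB_nonneg (iSup_le fun ⟨N, u, hu, hu_mem⟩ => ?_)
    simp only [edist_dist, dist_eq_norm]
    rw [← ENNReal.ofReal_sum_of_nonneg fun _ _ => norm_nonneg _]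
    exact ENNReal.ofReal_le_ofReal (sum_norm_increment_le_of_mem_upperBounds hB hu hu_mem N)

theorem isVariation_varFun {T : ℝ} {h : ℝ → ℝ} (hT : 0 ≤ T)
    (hb : BoundedVariationOn h (Icc 0 T)) : IsVariation h (varFun T h) 0 T := by
  refine ⟨dominatedBy_variationOnFromTo hb, ?_⟩
  rw [varFun, varFun, variationOnFromTo.self, sub_zero, variationOnFromTo.eq_of_le h _ hT,
    inter_self]
  exact tendsto_cellSum_norm_increment (isLUB_cellSum_norm_increment hT hb)

end Variation

theorem matNorm_nonneg {n : ℕ} (A : Vec n →L[ℝ] Vec n) : 0 ≤ matNorm A :=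
  Real.iSup_nonneg fun _ => Finset.sum_nonneg fun _ _ => abs_nonneg _

theorem abs_apply_le_matNorm_mul {n : ℕ} (A : Vec n →L[ℝ] Vec n) (v : Vec n) (i : Fin n) :
    |A v i| ≤ matNorm A * ‖v‖ := by
  have hv : v = ∑ j, v j • PiLp.single 1 j (1 : ℝ) := by
    ext k
    simp [Pi.single_apply]
  have hrow : ∑ j, |A (PiLp.single 1 j (1 : ℝ)) i| ≤ matNorm A :=
    le_ciSup (f := fun i => ∑ j, |A (PiLp.single 1 j (1 : ℝ)) i|) (finite_range _).bddAbove i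
  calc |A v i| = |∑ j, v j * A (PiLp.single 1 j (1 : ℝ)) i| := by
        conv_lhs => rw [hv]
        simp
    _ ≤ ∑ j, |v j * A (PiLp.single 1 j (1 : ℝ)) i| := Finset.abs_sum_le_sum_abs _ _
    _ ≤ ∑ j, |A (PiLp.single 1 j (1 : ℝ)) i| * ‖v‖ := Finset.sum_le_sum fun j _ => by
        rw [abs_mul, mul_comm]
        exact mul_le_mul_of_nonneg_left (PiLp.norm_apply_le v j) (abs_nonneg _)
    _ ≤ matNorm A * ‖v‖ := by
        rw [← Finset.sum_mul]
        exact mul_le_mul_of_nonneg_right hrow (norm_nonneg v)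

theorem opNorm_le_matNorm {n : ℕ} (A : Vec n →L[ℝ] Vec n) : ‖A‖ ≤ n * matNorm A := by
  refine A.opNorm_le_bound (mul_nonneg n.cast_nonneg (matNorm_nonneg A)) fun v => ?_
  rw [PiLp.norm_eq_of_L1 (A v)]
  refine (Finset.sum_le_sum fun i _ => abs_apply_le_matNorm_mul A v i).trans_eq ?_
  simp [mul_assoc]

/-! ## Regulated functions -/

namespace Reg

variable {n : ℕ} {T : ℝ}

theorem val_of_mem (x : Reg n T) {s : ℝ} (hs : s ∈ Icc (0 : ℝ) T) :
    x.val s = (x : lp (fun _ : Icc (0 : ℝ) T => Vec n) ∞) ⟨s, hs⟩ := dif_pos hs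

theorem val_mk {x : Icc (0 : ℝ) T → Vec n} (hx : IsRegulated x) {s : ℝ}
    (hs : s ∈ Icc (0 : ℝ) T) : (Reg.mk x hx).val s = x ⟨s, hs⟩ :=
  val_of_mem _ hs

theorem val_add (x y : Reg n T) (s : ℝ) : (x + y).val s = x.val s + y.val s := by
  unfold Reg.val
  split_ifs
  · rfl
  · rw [add_zero]

theorem val_smul (c : ℝ) (x : Reg n T) (s : ℝ) : (c • x).val s = c • x.val s := by
  unfold Reg.val
  split_ifs
  · rfl
  · rw [smul_zero]

theorem val_sub (x y : Reg n T) (s : ℝ) : (x - y).val s = x.val s - y.val s := by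
  rw [eq_sub_iff_add_eq, ← val_add, sub_add_cancel]

theorem norm_val_le (x : Reg n T) (s : ℝ) : ‖x.val s‖ ≤ ‖x‖ := by
  unfold Reg.val
  split_ifs with hs
  · exact lp.norm_apply_le_norm ENNReal.top_ne_zero _ _
  · rw [norm_zero]
    exact norm_nonneg _

theorem norm_le {x : Reg n T} {C : ℝ} (hC : 0 ≤ C) (hx : ∀ s ∈ Icc 0 T, ‖x.val s‖ ≤ C) :
    ‖x‖ ≤ C :=
  lp.norm_le_of_forall_le hC fun s =>
    (congrArg norm (val_of_mem x s.2)).symm.trans_le (hx s s.2)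

theorem ext_val {x y : Reg n T} (hxy : ∀ s ∈ Icc 0 T, x.val s = y.val s) : x = y := by
  refine Subtype.ext (lp.ext (funext fun s => ?_))
  rw [← val_of_mem x s.2, ← val_of_mem y s.2]
  exact hxy s s.2

theorem exists_dist_lt_of_tendsto (x : Reg n T) {s : Set (Icc (0 : ℝ) T)} {t : Icc (0 : ℝ) T}
    {p : Vec n} (hp : Tendsto x.1 (𝓝[s] t) (𝓝 p)) {κ : ℝ} (hκ : 0 < κ) :
    ∃ η > 0, ∀ u : Icc (0 : ℝ) T, u ∈ s → |(u : ℝ) - t| < η → dist (x.val u) p < κ := by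
  have hp_lt := Metric.tendsto_nhds.1 hp κ hκ
  rw [eventually_nhdsWithin_iff, Metric.eventually_nhds_iff] at hp_lt
  obtain ⟨η, hη, hdist⟩ := hp_lt
  refine ⟨η, hη, fun u hu hut => ?_⟩
  rw [val_of_mem x u.2]
  exact hdist hut hu

theorem exists_oscillation_lt (x : Reg n T) {κ : ℝ} (hκ : 0 < κ) {t : ℝ} (ht : t ∈ Icc 0 T) :
    ∃ η > 0, ∀ c d, 0 ≤ c → c < d → d ≤ T → (t = c ∨ t = d) → d - c < η →
      ∀ s ∈ Ioo c d, ∀ s' ∈ Ioo c d, ‖x.val s - x.val s'‖ < κ := by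
  obtain ⟨⟨l, hl⟩, ⟨r, hr⟩⟩ := x.2 ⟨t, ht⟩
  obtain ⟨η₁, hη₁, hleft⟩ := x.exists_dist_lt_of_tendsto hl (half_pos hκ)
  obtain ⟨η₂, hη₂, hright⟩ := x.exists_dist_lt_of_tendsto hr (half_pos hκ)
  refine ⟨min η₁ η₂, lt_min hη₁ hη₂, fun c d hc hcd hd htcd hη => ?_⟩
  suffices ∃ p : Vec n, ∀ s ∈ Ioo c d, dist (x.val s) p < κ / 2 by
    obtain ⟨p, hp⟩ := this
    intro s hs s' hs'
    rw [← dist_eq_norm]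
    linarith [dist_triangle_right (x.val s) (x.val s') p, hp s hs, hp s' hs']
  have hmem : ∀ s ∈ Ioo c d, s ∈ Icc 0 T := fun s hs =>
    ⟨hc.trans hs.1.le, hs.2.le.trans hd⟩
  rcases htcd with rfl | rfl
  · refine ⟨r, fun s hs => hright ⟨s, hmem s hs⟩ hs.1 ?_⟩
    rw [abs_of_pos (sub_pos.2 hs.1)]
    linarith [hs.2, min_le_right η₁ η₂]
  · refine ⟨l, fun s hs => hleft ⟨s, hmem s hs⟩ hs.2 ?_⟩
    rw [abs_sub_comm, abs_of_pos (sub_pos.2 hs.2)]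
    linarith [hs.1, min_le_left η₁ η₂]

end Reg

theorem isRegulated_const {n : ℕ} {T : ℝ} (v : Vec n) : IsRegulated fun _ : Icc (0 : ℝ) T => v :=
  fun _ => ⟨⟨v, tendsto_const_nhds⟩, ⟨v, tendsto_const_nhds⟩⟩

theorem DominatedBy.isRegulated {n : ℕ} {T : ℝ} {F : ℝ → Vec n} {M : ℝ → ℝ}
    (hF : DominatedBy F M 0 T) : IsRegulated fun t : Icc (0 : ℝ) T => F t := by
  have hM : Monotone fun s : Icc (0 : ℝ) T => M s := fun c d hcd =>
    sub_nonneg.1 ((norm_nonneg _).trans (hF c d c.2.1 hcd d.2.2))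
  have hdist : ∀ c d : Icc (0 : ℝ) T, dist (F c) (F d) ≤ dist (M c) (M d) := fun c d =>
    hF.dist_le c.2 d.2
  exact fun t => ⟨
    exists_tendsto_of_dist_le univ_mem (fun c _ d _ => hdist c d) (hM.tendsto_nhdsLT t),
    exists_tendsto_of_dist_le univ_mem (fun c _ d _ => hdist c d) (hM.tendsto_nhdsGT t)⟩

/-! ## Superposition operators -/

/-- `F(·, t)` is differentiable on `Ω` with differential bounded by `θ(t)`, for `t ∈ [0, T]`. -/
structure DifferentialBound {n : ℕ} (F : Vec n → ℝ → Vec n) (θ : ℝ → ℝ) (Ω : Set (Vec n))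
    (T : ℝ) : Prop where
  differentiableAt : ∀ x ∈ Ω, ∀ t ∈ Icc 0 T, DifferentiableAt ℝ (fun y => F y t) x
  norm_le : ∀ x ∈ Ω, ∀ t ∈ Icc 0 T, ‖dgx F x t‖ ≤ θ t

/-- The closed tube of radius `r` around the graph of `x` lies in `Ω`. -/
def Tube {n : ℕ} {T : ℝ} (Ω : Set (Vec n)) (x : Reg n T) (r : ℝ) : Prop :=
  ∀ s ∈ Icc 0 T, Metric.closedBall (x.val s) r ⊆ Ω

section Superposition

variable {n : ℕ} {T : ℝ} {Ω : Set (Vec n)} {F : Vec n → ℝ → Vec n} {θ : ℝ → ℝ} {x z : Reg n T}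
  {r ρ : ℝ}

theorem tube_of_forall_mem_closedBall (hρ : 0 ≤ ρ)
    (hball : ∀ y ∈ Metric.closedBall x ρ, ∀ t ∈ Icc 0 T, y.val t ∈ Ω) : Tube Ω x ρ := by
  intro s hs p hp
  rw [mem_closedBall_iff_norm] at hp
  have hshift := hball (x + Reg.mk _ (isRegulated_const (p - x.val s))) (by
    rw [mem_closedBall_iff_norm, add_sub_cancel_left]
    refine Reg.norm_le hρ fun t ht => ?_
    rwa [Reg.val_mk _ ht]) s hs
  rwa [Reg.val_add, Reg.val_mk _ hs, add_sub_cancel] at hshift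

namespace Tube

theorem val_mem (hx : Tube Ω x r) (hr : 0 ≤ r) {s : ℝ} (hs : s ∈ Icc 0 T) : x.val s ∈ Ω :=
  hx s hs (Metric.mem_closedBall_self hr)

theorem add (hx : Tube Ω x ρ) (hz : ‖z‖ + r ≤ ρ) : Tube Ω (x + z) r := fun s hs =>
  (Metric.closedBall_subset_closedBall' (by
    rw [Reg.val_add, dist_self_add_left]
    linarith [Reg.norm_val_le z s])).trans (hx s hs)

theorem val_add_mem (hx : Tube Ω x r) (hz : ‖z‖ ≤ r) {s : ℝ} (hs : s ∈ Icc 0 T) :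
    (x + z).val s ∈ Ω :=
  (hx.add (r := 0) (by rwa [add_zero])).val_mem le_rfl hs

end Tube

namespace DifferentialBound

theorem norm_sub_le (hF : DifferentialBound F θ Ω T) {S : Set (Vec n)} (hS : Convex ℝ S)
    (hSΩ : S ⊆ Ω) {t : ℝ} (ht : t ∈ Icc 0 T) {y y' : Vec n} (hy : y ∈ S) (hy' : y' ∈ S) :
    ‖F y' t - F y t‖ ≤ θ t * ‖y' - y‖ :=
  hS.norm_image_sub_le_of_norm_hasFDerivWithin_le
    (fun p hp => (hF.differentiableAt p (hSΩ hp) t ht).hasFDerivAt.hasFDerivWithinAt)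
    (fun p hp => hF.norm_le p (hSΩ hp) t ht) hy hy'

theorem nonneg (hF : DifferentialBound F θ Ω T) (hΩ : Ω.Nonempty) {t : ℝ} (ht : t ∈ Icc 0 T) :
    0 ≤ θ t :=
  (norm_nonneg _).trans (hF.norm_le _ hΩ.some_mem t ht)

theorem norm_superposition_sub_le (hF : DifferentialBound F θ Ω T) (hx : Tube Ω x r)
    (hz : ‖z‖ ≤ r) {s : ℝ} (hs : s ∈ Icc 0 T) :
    ‖F ((x + z).val s) s - F (x.val s) s‖ ≤ θ s * ‖z‖ := by
  have hr : 0 ≤ r := (norm_nonneg z).trans hz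
  have hzs : ‖z.val s‖ ≤ ‖z‖ := Reg.norm_val_le z s
  refine (hF.norm_sub_le (convex_closedBall (x.val s) r) (hx s hs) hs
    (Metric.mem_closedBall_self hr) ?_).trans ?_
  · rw [Reg.val_add, mem_closedBall_iff_norm, add_sub_cancel_left]
    exact hzs.trans hz
  · rw [Reg.val_add, add_sub_cancel_left]
    exact mul_le_mul_of_nonneg_left hzs (hF.nonneg ⟨_, hx.val_mem hr hs⟩ hs)

theorem norm_derivative_le (hF : DifferentialBound F θ Ω T) (hx : Tube Ω x r) (hr : 0 ≤ r)
    (z : Reg n T) {s : ℝ} (hs : s ∈ Icc 0 T) :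
    ‖dgx F (x.val s) s (z.val s)‖ ≤ θ s * ‖z‖ :=
  (ContinuousLinearMap.le_of_opNorm_le _ (hF.norm_le _ (hx.val_mem hr hs) s hs) _).trans
    (mul_le_mul_of_nonneg_left (Reg.norm_val_le z s) (hF.nonneg ⟨_, hx.val_mem hr hs⟩ hs))

theorem exists_norm_oscillation_le (hF : DifferentialBound F θ Ω T) (hx : Tube Ω x r)
    (hr : 0 < r) {κ : ℝ} (hκ : 0 < κ) {t : ℝ} (ht : t ∈ Icc 0 T) :
    ∃ η > 0, ∀ c d, 0 ≤ c → c < d → d ≤ T → (t = c ∨ t = d) → d - c < η →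
      ∀ ξ ∈ Ioo c d, ∀ s ∈ Ioo c d, ‖F (x.val s) s - F (x.val ξ) s‖ ≤ θ s * κ := by
  obtain ⟨η, hη, hosc⟩ := x.exists_oscillation_lt (lt_min hκ hr) ht
  refine ⟨η, hη, fun c d hc hcd hd htcd hdcη ξ hξ s hs => ?_⟩
  have hsξ := hosc c d hc hcd hd htcd hdcη s hs ξ hξ
  have hs_mem : s ∈ Icc 0 T := ⟨hc.trans hs.1.le, hs.2.le.trans hd⟩
  have hξ_mem : ξ ∈ Icc 0 T := ⟨hc.trans hξ.1.le, hξ.2.le.trans hd⟩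
  refine (hF.norm_sub_le (convex_closedBall (x.val ξ) r) (hx ξ hξ_mem) hs_mem
    (Metric.mem_closedBall_self hr.le) ?_).trans ?_
  · rw [mem_closedBall_iff_norm]
    exact hsξ.le.trans (min_le_right _ _)
  · exact mul_le_mul_of_nonneg_left (hsξ.le.trans (min_le_left _ _))
      (hF.nonneg ⟨_, hx.val_mem hr.le hs_mem⟩ hs_mem)

end DifferentialBound

theorem exists_seq_nhdsGT_norm_smul_lt {E : Type*} [NormedAddCommGroup E] [NormedSpace ℝ E]
    (v : E) (hρ : 0 < ρ) :
    ∃ c : ℕ → ℝ, Tendsto c atTop (𝓝[>] 0) ∧ ∀ k, ‖c k • v‖ < ρ := by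
  have hsmul : Tendsto (fun c : ℝ => ‖c • v‖) (𝓝[>] 0) (𝓝 0) := by
    simpa using ((continuous_id.smul continuous_const).norm.tendsto (0 : ℝ)).mono_left
      (nhdsWithin_le_nhds (s := Ioi 0)) (f := fun c : ℝ => ‖c • v‖)
  exact exists_seq_forall_of_frequently (hsmul.eventually_lt_const hρ).frequently

/-- The first-order remainder at `x` of the superposition operator of `F`, divided by the size of
the increment `z` (and `0` for `z = 0`, by the convention for the inverse of `0`). -/
noncomputable def relRemainder (F : Vec n → ℝ → Vec n) (x z : Reg n T) (s : ℝ) : Vec n :=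
  ‖z‖⁻¹ • (F ((x + z).val s) s - F (x.val s) s - dgx F (x.val s) s (z.val s))

theorem norm_smul_relRemainder (F : Vec n → ℝ → Vec n) (x z : Reg n T) (s : ℝ) :
    ‖z‖ • relRemainder F x z s =
      F ((x + z).val s) s - F (x.val s) s - dgx F (x.val s) s (z.val s) := by
  rcases (norm_nonneg z).eq_or_lt with hzero | hpos
  · have hval : z.val s = 0 := norm_le_zero_iff.1 ((Reg.norm_val_le z s).trans hzero.ge)
    rw [← hzero, zero_smul, Reg.val_add, hval, add_zero, map_zero, sub_self, sub_zero]
  · exact smul_inv_smul₀ hpos.ne' _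

theorem norm_relRemainder_le (hF : DifferentialBound F θ Ω T) (hx : Tube Ω x r) (hz : ‖z‖ ≤ r)
    {s : ℝ} (hs : s ∈ Icc 0 T) : ‖relRemainder F x z s‖ ≤ 2 * θ s := by
  have hr : 0 ≤ r := (norm_nonneg z).trans hz
  have hθ : 0 ≤ θ s := hF.nonneg ⟨_, hx.val_mem hr hs⟩ hs
  rw [relRemainder, norm_smul, norm_inv, norm_norm, inv_mul_eq_div]
  refine div_le_of_le_mul₀ (norm_nonneg z) (by positivity) ((norm_sub_le _ _).trans ?_)
  linarith [hF.norm_superposition_sub_le hx hz hs, hF.norm_derivative_le hx hr z hs]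

theorem tendsto_relRemainder {s : ℝ} (hF : DifferentiableAt ℝ (fun y => F y s) (x.val s)) :
    Tendsto (fun z => relRemainder F x z s) (𝓝 0) (𝓝 0) := by
  have hval : Tendsto (fun z : Reg n T => z.val s) (𝓝 0) (𝓝 0) :=
    squeeze_zero_norm (fun z => Reg.norm_val_le z s) tendsto_norm_zero
  have hval_bigO : (fun z : Reg n T => z.val s) =O[𝓝 0] fun z => ‖z‖ :=
    Asymptotics.isBigO_of_le _ fun z => by
      rw [norm_norm]
      exact Reg.norm_val_le z s
  have hlittleO := (hasFDerivAt_iff_isLittleO_nhds_zero.1 hF.hasFDerivAt).comp_tendsto hval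
  refine (hlittleO.trans_isBigO hval_bigO).tendsto_inv_smul_nhds_zero.congr fun z => ?_
  rw [relRemainder, Reg.val_add]
  rfl

end Superposition

/-! ## The Stieltjes part of the operator -/

/-- The regularity of the coefficient `g` of the Stieltjes term: a bounded differential, and
integrability of `g(x, ·)` and of a majorant `m`. The function `V` is a variation of `h`. -/
structure StieltjesC1 {n : ℕ} (g : Vec n → ℝ → Vec n) (h V m : ℝ → ℝ) (C : ℝ) (Ω : Set (Vec n))
    (T : ℝ) : Prop where
  isVariation : IsVariation h V 0 T
  integrable : ∀ x ∈ Ω, KSIntegrable (g x) h 0 T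
  differentialBound : DifferentialBound g (fun _ => C) Ω T
  majorant_integrable : KSIntegrable m V 0 T
  norm_le : ∀ x ∈ Ω, ∀ t ∈ Icc 0 T, ‖g x t‖ ≤ m t

namespace StieltjesC1

variable {n : ℕ} {T : ℝ} {Ω : Set (Vec n)} {g : Vec n → ℝ → Vec n} {h V m : ℝ → ℝ}
  {x z : Reg n T} {r C : ℝ}

theorem ksIntegrable_superposition (hg : StieltjesC1 g h V m C Ω T) (hT : 0 ≤ T)
    (hx : Tube Ω x r) (hr : 0 < r) : KSIntegrable (fun s => g (x.val s) s) h 0 T := by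
  have hC : 0 ≤ C := hg.differentialBound.nonneg
    ⟨_, hx.val_mem hr.le (left_mem_Icc.2 hT)⟩ (left_mem_Icc.2 hT)
  refine ksIntegrable_of_local_approx hT hg.isVariation.dominated fun ε hε t ht => ?_
  obtain ⟨η, hη, hosc⟩ := hg.differentialBound.exists_norm_oscillation_le hx hr
    (κ := ε / (C + 1)) (by positivity) ht
  refine ⟨η, hη, fun c d hc hcd hd htcd hdcη => ?_⟩
  obtain ⟨ξ, hξ⟩ := nonempty_Ioo.2 hcd
  have hξ_mem : ξ ∈ Icc 0 T := ⟨hc.trans hξ.1.le, hξ.2.le.trans hd⟩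
  refine ⟨g (x.val ξ), (hg.integrable _ (hx.val_mem hr.le hξ_mem)).mono hc hcd.le hd,
    fun s hs => (hosc c d hc hcd hd htcd hdcη ξ hξ s hs).trans ?_⟩
  rw [← mul_div_assoc, div_le_iff₀ (by positivity)]
  nlinarith

theorem ksIntegrable_derivative (hg : StieltjesC1 g h V m C Ω T) (hT : 0 ≤ T)
    (hx : Tube Ω x r) (hr : 0 < r) (z : Reg n T) :
    KSIntegrable (fun s => dgx g (x.val s) s (z.val s)) h 0 T := by
  obtain ⟨c, hc, hcz⟩ := exists_seq_nhdsGT_norm_smul_lt z hr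
  refine (ksIntegral_bounded_convergence (C := C * ‖z‖) hT hg.isVariation
    (u := fun k s => (c k)⁻¹ • (g ((x + c k • z).val s) s - g (x.val s) s)) (fun k => ?_)
    (fun k s hs => ?_) fun s hs => ?_).1
  · obtain ⟨I, hI⟩ := hg.ksIntegrable_superposition hT
      (hx.add (z := c k • z) (r := r - ‖c k • z‖) (by linarith)) (sub_pos.2 (hcz k))
    obtain ⟨J, hJ⟩ := hg.ksIntegrable_superposition hT hx hr
    exact ⟨_, (hI.sub hJ).smul _⟩
  · rw [norm_smul, norm_inv, inv_mul_eq_div]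
    refine div_le_of_le_mul₀ (norm_nonneg _) ?_ ?_
    · exact (norm_nonneg _).trans (hg.differentialBound.norm_derivative_le hx hr.le z hs)
    · refine (hg.differentialBound.norm_superposition_sub_le hx (hcz k).le hs).trans_eq ?_
      rw [norm_smul]
      ring
  · simp only [Reg.val_add, Reg.val_smul]
    exact (hg.differentialBound.differentiableAt _ (hx.val_mem hr.le hs) s
      hs).hasFDerivAt.hasLineDerivAt (z.val s) |>.tendsto_slope_zero_right.comp hc

theorem hasKSIntegral_relRemainder (hg : StieltjesC1 g h V m C Ω T) (hx : Tube Ω x r)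
    (hz : ‖z‖ < r) {t : ℝ} (ht : t ∈ Icc 0 T) :
    HasKSIntegral (relRemainder g x z) h 0 t (‖z‖⁻¹ •
      (ksIntegral (fun s => g ((x + z).val s) s) h 0 t - ksIntegral (fun s => g (x.val s) s) h 0 t
        - ksIntegral (fun s => dgx g (x.val s) s (z.val s)) h 0 t)) := by
  have hT : 0 ≤ T := ht.1.trans ht.2
  have hr : 0 < r := (norm_nonneg z).trans_lt hz
  have hadd := hg.ksIntegrable_superposition hT
    (hx.add (z := z) (r := r - ‖z‖) (by linarith)) (sub_pos.2 hz)
  have hself := hg.ksIntegrable_superposition hT hx hr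
  have hderiv := hg.ksIntegrable_derivative hT hx hr z
  exact ((((hadd.mono le_rfl ht.1 ht.2).hasKSIntegral ht.1).sub
    ((hself.mono le_rfl ht.1 ht.2).hasKSIntegral ht.1)).sub
    ((hderiv.mono le_rfl ht.1 ht.2).hasKSIntegral ht.1)).smul _

theorem eventually_norm_ksIntegral_sub_sub_le (hg : StieltjesC1 g h V m C Ω T) (hT : 0 ≤ T)
    (hx : Tube Ω x r) (hr : 0 < r) {ε : ℝ} (hε : 0 < ε) :
    ∀ᶠ z in 𝓝 (0 : Reg n T), ∀ t ∈ Icc 0 T,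
      ‖ksIntegral (fun s => g ((x + z).val s) s) h 0 t - ksIntegral (fun s => g (x.val s) s) h 0 t
        - ksIntegral (fun s => dgx g (x.val s) s (z.val s)) h 0 t‖ ≤ ε * ‖z‖ := by
  by_contra hfreq
  have hsmall : ∀ᶠ z in 𝓝 (0 : Reg n T), ‖z‖ < r := tendsto_norm_zero.eventually_lt_const hr
  obtain ⟨z, hz, hz_spec⟩ :=
    exists_seq_forall_of_frequently ((not_eventually.1 hfreq).and_eventually hsmall)
  have hint := fun k t (ht : t ∈ Icc 0 T) =>
    hg.hasKSIntegral_relRemainder hx (hz_spec k).2 ht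
  obtain ⟨-, η, hη, hle⟩ := ksIntegral_bounded_convergence (u' := fun _ => 0) hT hg.isVariation
    (fun k => ⟨_, hint k T (right_mem_Icc.2 hT)⟩)
    (fun k s hs => norm_relRemainder_le hg.differentialBound hx (hz_spec k).2.le hs)
    fun s hs => (tendsto_relRemainder (hg.differentialBound.differentiableAt _
      (hx.val_mem hr.le hs) s hs)).comp hz
  obtain ⟨k, hk⟩ := (hη.eventually_lt_const hε).exists
  refine (hz_spec k).1 fun t ht => ?_
  have hle_t := hle k t ht
  rw [(hint k t ht).ksIntegral_eq ht.1, (hasKSIntegral_const (0 : Vec n)).ksIntegral_eq ht.1,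
    smul_zero, sub_zero, norm_smul, norm_inv, norm_norm, inv_mul_eq_div] at hle_t
  rcases (norm_nonneg (z k)).eq_or_lt with hzero | hpos
  · have hval (s : ℝ) : (z k).val s = 0 :=
      norm_le_zero_iff.1 ((Reg.norm_val_le (z k) s).trans hzero.ge)
    simp only [Reg.val_add, hval, add_zero, map_zero, sub_self,
      (hasKSIntegral_const (0 : Vec n)).ksIntegral_eq ht.1, smul_zero, norm_zero]
    positivity
  · exact (div_le_iff₀ hpos).1 (hle_t.trans hk.le)

end StieltjesC1

/-! ## The Lebesgue part of the operator -/

section LocalApproximation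

variable {E : Type*} [NormedAddCommGroup E] {u : ℝ → E} {θ : ℝ → ℝ} {a b : ℝ}

theorem exists_aestronglyMeasurable_norm_sub_le {μ : Measure ℝ} [NullSingletonClass μ] (hab : a ≤ b)
    (hu : ∀ t ∈ Icc a b, ∃ η > 0, ∀ c d, a ≤ c → c < d → d ≤ b → (t = c ∨ t = d) → d - c < η →
      ∃ w : ℝ → E, AEStronglyMeasurable w μ ∧ ∀ s ∈ Ioo c d, ‖u s - w s‖ ≤ θ s) :
    ∃ w : ℝ → E, AEStronglyMeasurable w μ ∧ ∀ᵐ s ∂μ, s ∈ Ioc a b → ‖u s - w s‖ ≤ θ s := by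
  refine cousin_induction (P := fun c d => ∃ w : ℝ → E,
    AEStronglyMeasurable w μ ∧ ∀ᵐ s ∂μ, s ∈ Ioc c d → ‖u s - w s‖ ≤ θ s) hab ?refl ?trans ?loc
  case refl => exact fun c => ⟨0, aestronglyMeasurable_zero, by simp⟩
  case trans =>
    rintro c d e - - - - ⟨w, hw, hw_le⟩ ⟨v, hv, hv_le⟩
    refine ⟨fun s => if s ∈ Iic d then w s else v s,
      hw.restrict.piecewise measurableSet_Iic hv.restrict, ?_⟩
    filter_upwards [hw_le, hv_le] with s hs_w hs_v hs
    rcases le_or_gt s d with hsd | hds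
    · rw [if_pos (mem_Iic.2 hsd)]
      exact hs_w ⟨hs.1, hsd⟩
    · rw [if_neg (notMem_Iic.2 hds)]
      exact hs_v ⟨hds, hs.2⟩
  case loc =>
    intro t ht
    obtain ⟨η, hη, happrox⟩ := hu t ht
    refine ⟨η, hη, fun c d hc hcd hd htcd hdcη => ?_⟩
    obtain ⟨w, hw, hw_le⟩ := happrox c d hc hcd hd htcd hdcη
    refine ⟨w, hw, ?_⟩
    filter_upwards [Measure.ae_ne μ d] with s hsd hs
    exact hw_le s ⟨hs.1, hs.2.lt_of_ne hsd⟩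

theorem aestronglyMeasurable_of_local_approx {μ : Measure ℝ} [NullSingletonClass μ] (hab : a ≤ b)
    (hu : ∀ κ > 0, ∀ t ∈ Icc a b, ∃ η > 0, ∀ c d, a ≤ c → c < d → d ≤ b → (t = c ∨ t = d) →
      d - c < η → ∃ w : ℝ → E, AEStronglyMeasurable w μ ∧ ∀ s ∈ Ioo c d, ‖u s - w s‖ ≤ θ s * κ) :
    AEStronglyMeasurable u (μ.restrict (Icc a b)) := by
  choose w hw hw_le using fun k : ℕ =>
    exists_aestronglyMeasurable_norm_sub_le hab (hu (1 / ((k : ℝ) + 1)) (by positivity))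
  rw [← restrict_Ioc_eq_restrict_Icc]
  refine aestronglyMeasurable_of_tendsto_ae atTop (fun k => (hw k).restrict) ?_
  filter_upwards [ae_restrict_of_ae (ae_all_iff.2 hw_le), ae_restrict_mem measurableSet_Ioc]
    with s hs hs_mem
  rw [tendsto_iff_norm_sub_tendsto_zero]
  refine squeeze_zero (fun k => norm_nonneg _) (fun k => ?_)
    (by simpa using tendsto_one_div_add_atTop_nhds_zero_nat.const_mul (θ s))
  rw [norm_sub_rev, ← one_div]
  exact hs k hs_mem

end LocalApproximation

section IntervalIntegral

variable {E : Type*} [NormedAddCommGroup E] {u : ℝ → E} {m : ℝ → ℝ} {a b c d : ℝ}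

theorem intervalIntegrable_of_mem_Icc (hu : IntervalIntegrable u volume a b) (hc : c ∈ Icc a b)
    (hd : d ∈ Icc a b) : IntervalIntegrable u volume c d :=
  hu.mono_set (uIcc_subset_uIcc (Icc_subset_uIcc hc) (Icc_subset_uIcc hd))

theorem intervalIntegrable_of_norm_le (hab : a ≤ b)
    (hu : AEStronglyMeasurable u (volume.restrict (Icc a b)))
    (hm : IntervalIntegrable m volume a b) (hum : ∀ s ∈ Icc a b, ‖u s‖ ≤ m s) :
    IntervalIntegrable u volume a b := by
  rw [intervalIntegrable_iff_integrableOn_Icc_of_le hab] at hm ⊢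
  exact hm.mono' hu ((ae_restrict_iff' measurableSet_Icc).2 (ae_of_all _ hum))

theorem dominatedBy_integral [NormedSpace ℝ E] (hm : IntervalIntegrable m volume a b)
    (hu : IntervalIntegrable u volume a b) (hum : ∀ s ∈ Icc a b, ‖u s‖ ≤ m s) :
    DominatedBy (fun t => ∫ s in a..t, u s) (fun t => ∫ s in a..t, m s) a b := by
  intro c d hc hcd hd
  have ha_mem : a ∈ Icc a b := left_mem_Icc.2 (hc.trans (hcd.trans hd))
  have hc_mem : c ∈ Icc a b := ⟨hc, hcd.trans hd⟩
  have hd_mem : d ∈ Icc a b := ⟨hc.trans hcd, hd⟩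
  dsimp only
  rw [intervalIntegral.integral_interval_sub_left
      (intervalIntegrable_of_mem_Icc hu ha_mem hd_mem)
      (intervalIntegrable_of_mem_Icc hu ha_mem hc_mem),
    intervalIntegral.integral_interval_sub_left
      (intervalIntegrable_of_mem_Icc hm ha_mem hd_mem)
      (intervalIntegrable_of_mem_Icc hm ha_mem hc_mem)]
  exact intervalIntegral.norm_integral_le_of_norm_le hcd
    (ae_of_all _ fun s hs => hum s ⟨hc.trans hs.1.le, hs.2.trans hd⟩)
    (intervalIntegrable_of_mem_Icc hm hc_mem hd_mem)

end IntervalIntegral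

/-- A Carathéodory function with integrable majorant `m`, differentiable in the space variable
with integrable majorant `θ` of the differential. -/
structure CaratheodoryC1 {n : ℕ} (F : Vec n → ℝ → Vec n) (m θ : ℝ → ℝ) (Ω : Set (Vec n))
    (T : ℝ) : Prop where
  aestronglyMeasurable : ∀ x ∈ Ω, AEStronglyMeasurable (F x) (volume.restrict (Icc 0 T))
  majorant_integrable : IntervalIntegrable m volume 0 T
  norm_le : ∀ x ∈ Ω, ∀ t ∈ Icc 0 T, ‖F x t‖ ≤ m t
  bound_integrable : IntervalIntegrable θ volume 0 T
  differentialBound : DifferentialBound F θ Ω T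

namespace CaratheodoryC1

variable {n : ℕ} {T : ℝ} {Ω : Set (Vec n)} {F G : Vec n → ℝ → Vec n} {m θ mG θG : ℝ → ℝ}
  {x z : Reg n T} {r : ℝ}

theorem aestronglyMeasurable_superposition (hF : CaratheodoryC1 F m θ Ω T) (hT : 0 ≤ T)
    (hx : Tube Ω x r) (hr : 0 < r) :
    AEStronglyMeasurable (fun s => F (x.val s) s) (volume.restrict (Icc 0 T)) := by
  rw [← inter_self (Icc 0 T), ← Measure.restrict_restrict measurableSet_Icc]
  refine aestronglyMeasurable_of_local_approx (θ := θ) hT fun κ hκ t ht => ?_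
  obtain ⟨η, hη, hosc⟩ := hF.differentialBound.exists_norm_oscillation_le hx hr hκ ht
  refine ⟨η, hη, fun c d hc hcd hd htcd hdcη => ?_⟩
  obtain ⟨ξ, hξ⟩ := nonempty_Ioo.2 hcd
  exact ⟨F (x.val ξ), hF.aestronglyMeasurable _
    (hx.val_mem hr.le ⟨hc.trans hξ.1.le, hξ.2.le.trans hd⟩),
    hosc c d hc hcd hd htcd hdcη ξ hξ⟩

theorem intervalIntegrable_superposition (hF : CaratheodoryC1 F m θ Ω T) (hT : 0 ≤ T)
    (hx : Tube Ω x r) (hr : 0 < r) : IntervalIntegrable (fun s => F (x.val s) s) volume 0 T :=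
  intervalIntegrable_of_norm_le hT (hF.aestronglyMeasurable_superposition hT hx hr)
    hF.majorant_integrable fun s hs => hF.norm_le _ (hx.val_mem hr.le hs) s hs

theorem aestronglyMeasurable_derivative (hF : CaratheodoryC1 F m θ Ω T) (hT : 0 ≤ T)
    (hx : Tube Ω x r) (hr : 0 < r) (z : Reg n T) :
    AEStronglyMeasurable (fun s => dgx F (x.val s) s (z.val s)) (volume.restrict (Icc 0 T)) := by
  obtain ⟨c, hc, hcz⟩ := exists_seq_nhdsGT_norm_smul_lt z hr
  refine aestronglyMeasurable_of_tendsto_ae atTop (f := fun k s => (c k)⁻¹ •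
    (F ((x + c k • z).val s) s - F (x.val s) s)) (fun k => ?_) ?_
  · exact ((hF.aestronglyMeasurable_superposition hT
      (hx.add (z := c k • z) (r := r - ‖c k • z‖) (by linarith)) (sub_pos.2 (hcz k))).sub
      (hF.aestronglyMeasurable_superposition hT hx hr)).const_smul (c k)⁻¹
  · filter_upwards [ae_restrict_mem measurableSet_Icc] with s hs
    simp only [Reg.val_add, Reg.val_smul]
    exact (hF.differentialBound.differentiableAt _ (hx.val_mem hr.le hs) s
      hs).hasFDerivAt.hasLineDerivAt (z.val s) |>.tendsto_slope_zero_right.comp hc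

theorem intervalIntegrable_derivative (hF : CaratheodoryC1 F m θ Ω T) (hT : 0 ≤ T)
    (hx : Tube Ω x r) (hr : 0 < r) (z : Reg n T) :
    IntervalIntegrable (fun s => dgx F (x.val s) s (z.val s)) volume 0 T :=
  intervalIntegrable_of_norm_le hT (hF.aestronglyMeasurable_derivative hT hx hr z)
    (hF.bound_integrable.mul_const ‖z‖)
    fun _ hs => hF.differentialBound.norm_derivative_le hx hr.le z hs

theorem intervalIntegrable_relRemainder (hF : CaratheodoryC1 F m θ Ω T) (hT : 0 ≤ T)
    (hx : Tube Ω x r) (hz : ‖z‖ < r) : IntervalIntegrable (relRemainder F x z) volume 0 T :=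
  have hr : 0 < r := (norm_nonneg z).trans_lt hz
  (((hF.intervalIntegrable_superposition hT (hx.add (z := z) (r := r - ‖z‖) (by linarith))
    (sub_pos.2 hz)).sub (hF.intervalIntegrable_superposition hT hx hr)).sub
    (hF.intervalIntegrable_derivative hT hx hr z)).smul ‖z‖⁻¹

theorem tendsto_integral_norm_relRemainder (hF : CaratheodoryC1 F m θ Ω T) (hT : 0 ≤ T)
    (hx : Tube Ω x r) (hr : 0 < r) :
    Tendsto (fun z => ∫ s in (0 : ℝ)..T, ‖relRemainder F x z s‖) (𝓝 0) (𝓝 0) := by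
  have hsmall : ∀ᶠ z in 𝓝 (0 : Reg n T), ‖z‖ < r := tendsto_norm_zero.eventually_lt_const hr
  have hIoc {s : ℝ} (hs : s ∈ uIoc 0 T) : s ∈ Icc 0 T := by
    rw [uIoc_of_le hT] at hs
    exact Ioc_subset_Icc_self hs
  suffices Tendsto (fun z => ∫ s in (0 : ℝ)..T, ‖relRemainder F x z s‖) (𝓝 0)
      (𝓝 (∫ _ in (0 : ℝ)..T, (0 : ℝ))) by
    rwa [intervalIntegral.integral_zero] at this
  refine intervalIntegral.tendsto_integral_filter_of_dominated_convergence (fun s => 2 * θ s)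
    ?_ ?_ (hF.bound_integrable.const_mul 2) ?_
  · filter_upwards [hsmall] with z hz
    exact (hF.intervalIntegrable_relRemainder hT hx hz).norm.aestronglyMeasurable_restrict_uIoc
  · filter_upwards [hsmall] with z hz
    refine ae_of_all _ fun s hs => ?_
    rw [norm_norm]
    exact norm_relRemainder_le hF.differentialBound hx hz.le (hIoc hs)
  · refine ae_of_all _ fun s hs => ?_
    exact tendsto_zero_iff_norm_tendsto_zero.1 (tendsto_relRemainder
      (hF.differentialBound.differentiableAt _ (hx.val_mem hr.le (hIoc hs)) s (hIoc hs)))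

theorem eventually_norm_integral_sub_sub_le (hF : CaratheodoryC1 F m θ Ω T) (hT : 0 ≤ T)
    (hx : Tube Ω x r) (hr : 0 < r) {ε : ℝ} (hε : 0 < ε) :
    ∀ᶠ z in 𝓝 (0 : Reg n T), ∀ t ∈ Icc 0 T,
      ‖(∫ s in (0 : ℝ)..t, F ((x + z).val s) s) - (∫ s in (0 : ℝ)..t, F (x.val s) s)
        - ∫ s in (0 : ℝ)..t, dgx F (x.val s) s (z.val s)‖ ≤ ε * ‖z‖ := by
  have hsmall : ∀ᶠ z in 𝓝 (0 : Reg n T), ‖z‖ < r := tendsto_norm_zero.eventually_lt_const hr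
  filter_upwards [(hF.tendsto_integral_norm_relRemainder hT hx hr).eventually_lt_const hε, hsmall]
    with z hz_lt hzr t ht
  have hsub {w : ℝ → Vec n} (hw : IntervalIntegrable w volume 0 T) :
      IntervalIntegrable w volume 0 t :=
    intervalIntegrable_of_mem_Icc hw (left_mem_Icc.2 hT) ht
  have hadd := hsub (hF.intervalIntegrable_superposition hT
    (hx.add (z := z) (r := r - ‖z‖) (by linarith)) (sub_pos.2 hzr))
  have hself := hsub (hF.intervalIntegrable_superposition hT hx hr)
  have hrem := hF.intervalIntegrable_relRemainder hT hx hzr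
  rw [← intervalIntegral.integral_sub hadd hself, ← intervalIntegral.integral_sub
    (hadd.sub hself) (hsub (hF.intervalIntegrable_derivative hT hx hr z))]
  simp only [← norm_smul_relRemainder]
  rw [intervalIntegral.integral_smul, norm_smul, norm_norm, mul_comm]
  gcongr
  calc ‖∫ s in (0 : ℝ)..t, relRemainder F x z s‖
      ≤ ∫ s in (0 : ℝ)..t, ‖relRemainder F x z s‖ :=
        intervalIntegral.norm_integral_le_integral_norm ht.1
    _ ≤ ∫ s in (0 : ℝ)..T, ‖relRemainder F x z s‖ :=
        intervalIntegral.integral_mono_interval le_rfl ht.1 ht.2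
          (ae_of_all _ fun s => norm_nonneg _) hrem.norm
    _ ≤ ε := hz_lt.le

theorem hasFDerivAt_sub (hF : CaratheodoryC1 F m θ Ω T) (hG : CaratheodoryC1 G mG θG Ω T)
    {y : Vec n} (hy : y ∈ Ω) {t : ℝ} (ht : t ∈ Icc 0 T) :
    HasFDerivAt (fun y => F y t - G y t) (dgx F y t - dgx G y t) y :=
  (hF.differentialBound.differentiableAt y hy t ht).hasFDerivAt.sub
    (hG.differentialBound.differentiableAt y hy t ht).hasFDerivAt

theorem sub (hF : CaratheodoryC1 F m θ Ω T) (hG : CaratheodoryC1 G mG θG Ω T) :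
    CaratheodoryC1 (fun y t => F y t - G y t) (fun t => m t + mG t) (fun t => θ t + θG t) Ω T where
  aestronglyMeasurable y hy := (hF.aestronglyMeasurable y hy).sub (hG.aestronglyMeasurable y hy)
  majorant_integrable := hF.majorant_integrable.add hG.majorant_integrable
  norm_le y hy t ht := (norm_sub_le _ _).trans
    (add_le_add (hF.norm_le y hy t ht) (hG.norm_le y hy t ht))
  bound_integrable := hF.bound_integrable.add hG.bound_integrable
  differentialBound := by
    refine ⟨fun y hy t ht => (hF.hasFDerivAt_sub hG hy ht).differentiableAt, fun y hy t ht => ?_⟩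
    rw [dgx, (hF.hasFDerivAt_sub hG hy ht).fderiv]
    exact (norm_sub_le _ _).trans (add_le_add (hF.differentialBound.norm_le y hy t ht)
      (hG.differentialBound.norm_le y hy t ht))

end CaratheodoryC1

/-! ## Dependence on the parameter -/

theorem aestronglyMeasurable_of_forall_apply {α E F : Type*} [MeasurableSpace α] {μ : Measure α}
    [NormedAddCommGroup E] [NormedSpace ℝ E] [FiniteDimensional ℝ E] [NormedAddCommGroup F]
    [NormedSpace ℝ F] {A : α → E →L[ℝ] F} (hA : ∀ v, AEStronglyMeasurable (fun a => A a v) μ) :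
    AEStronglyMeasurable A μ := by
  set b := Module.finBasis ℝ E
  have hsum : A = fun a => ∑ j, ContinuousLinearMap.smulRightL ℝ E F
      (LinearMap.toContinuousLinearMap (b.coord j)) (A a (b j)) := by
    funext a
    refine ContinuousLinearMap.coe_injective (b.ext fun i => ?_)
    simp [Finsupp.single_apply, ite_smul]
  rw [hsum]
  exact Finset.aestronglyMeasurable_fun_sum _ fun j _ =>
    (ContinuousLinearMap.continuous _).comp_aestronglyMeasurable (hA (b j))

namespace CaratheodoryC1

variable {n : ℕ} {T : ℝ} {Ω : Set (Vec n)} {F : Vec n → ℝ → Vec n} {m θ V : ℝ → ℝ}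
  {x z : Reg n T} {r : ℝ}

theorem aestronglyMeasurable_dgx (hF : CaratheodoryC1 F m θ Ω T) (hΩ : IsOpen Ω) {y : Vec n}
    (hy : y ∈ Ω) : AEStronglyMeasurable (dgx F y) (volume.restrict (Icc 0 T)) := by
  refine aestronglyMeasurable_of_forall_apply fun v => ?_
  obtain ⟨ρ, hρ, hball⟩ := Metric.isOpen_iff.1 hΩ y hy
  obtain ⟨c, hc, hcv⟩ := exists_seq_nhdsGT_norm_smul_lt v hρ
  refine aestronglyMeasurable_of_tendsto_ae atTop
    (f := fun k s => (c k)⁻¹ • (F (y + c k • v) s - F y s)) (fun k => ?_) ?_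
  · have hmem : y + c k • v ∈ Ω := hball (by
      rw [mem_ball_iff_norm, add_sub_cancel_left]
      exact hcv k)
    exact ((hF.aestronglyMeasurable _ hmem).sub (hF.aestronglyMeasurable y hy)).const_smul (c k)⁻¹
  · filter_upwards [ae_restrict_mem measurableSet_Icc] with s hs
    exact (hF.differentialBound.differentiableAt y hy s
      hs).hasFDerivAt.hasLineDerivAt v |>.tendsto_slope_zero_right.comp hc

theorem intervalIntegrable (hF : CaratheodoryC1 F m θ Ω T) (hT : 0 ≤ T) {y : Vec n}
    (hy : y ∈ Ω) : IntervalIntegrable (F y) volume 0 T :=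
  intervalIntegrable_of_norm_le hT (hF.aestronglyMeasurable y hy) hF.majorant_integrable
    (hF.norm_le y hy)

theorem hasFDerivAt_integral (hF : CaratheodoryC1 F m θ Ω T) (hΩ : IsOpen Ω) {c d : ℝ}
    (hc : c ∈ Icc 0 T) (hd : d ∈ Icc 0 T) {y : Vec n} (hy : y ∈ Ω) :
    HasFDerivAt (fun y => ∫ s in c..d, F y s) (∫ s in c..d, dgx F y s) y := by
  have hT : 0 ≤ T := hc.1.trans hc.2
  have hsub : uIoc c d ⊆ Icc 0 T := uIoc_subset_uIcc.trans (uIcc_subset_Icc hc hd)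
  have hmeasure := Measure.restrict_mono_set (volume : Measure ℝ) hsub
  refine intervalIntegral.hasFDerivAt_integral_of_dominated_of_fderiv_le (bound := θ)
    (hΩ.mem_nhds hy) ?_ (intervalIntegrable_of_mem_Icc (hF.intervalIntegrable hT hy) hc hd)
    ((hF.aestronglyMeasurable_dgx hΩ hy).mono_measure hmeasure) ?_
    (intervalIntegrable_of_mem_Icc hF.bound_integrable hc hd) ?_
  · filter_upwards [hΩ.mem_nhds hy] with p hp
    exact (hF.aestronglyMeasurable p hp).mono_measure hmeasure
  · exact ae_of_all _ fun s hs p hp => hF.differentialBound.norm_le p hp s (hsub hs)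
  · exact ae_of_all _ fun s hs p hp =>
      (hF.differentialBound.differentiableAt p hp s (hsub hs)).hasFDerivAt

theorem norm_integral_sub_le (hF : CaratheodoryC1 F m θ Ω T) (hΩ : IsOpen Ω) {c d K : ℝ}
    (hc : c ∈ Icc 0 T) (hd : d ∈ Icc 0 T) (hK : ∀ y ∈ Ω, ‖∫ s in c..d, dgx F y s‖ ≤ K)
    {S : Set (Vec n)} (hS : Convex ℝ S) (hSΩ : S ⊆ Ω) {y y' : Vec n} (hy : y ∈ S) (hy' : y' ∈ S) :
    ‖∫ s in c..d, (F y' s - F y s)‖ ≤ K * ‖y' - y‖ := by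
  have hT : 0 ≤ T := hc.1.trans hc.2
  rw [intervalIntegral.integral_sub
    (intervalIntegrable_of_mem_Icc (hF.intervalIntegrable hT (hSΩ hy')) hc hd)
    (intervalIntegrable_of_mem_Icc (hF.intervalIntegrable hT (hSΩ hy)) hc hd)]
  exact hS.norm_image_sub_le_of_norm_hasFDerivWithin_le
    (fun p hp => (hF.hasFDerivAt_integral hΩ hc hd (hSΩ hp)).hasFDerivWithinAt)
    (fun p hp => hK p (hSΩ hp)) hy hy'

theorem intervalIntegrable_superposition_sub (hF : CaratheodoryC1 F m θ Ω T) (hT : 0 ≤ T)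
    (hx : Tube Ω x r) (hz : ‖z‖ < r) :
    IntervalIntegrable (fun s => F ((x + z).val s) s - F (x.val s) s) volume 0 T :=
  (hF.intervalIntegrable_superposition hT (hx.add (z := z) (r := r - ‖z‖) (by linarith))
    (sub_pos.2 hz)).sub
    (hF.intervalIntegrable_superposition hT hx ((norm_nonneg z).trans_lt hz))

theorem norm_integral_add_val_sub_le (hF : CaratheodoryC1 F m θ Ω T) (hΩ : IsOpen Ω) {c d K : ℝ}
    (hc : c ∈ Icc 0 T) (hd : d ∈ Icc 0 T) (hK : ∀ y ∈ Ω, ‖∫ s in c..d, dgx F y s‖ ≤ K)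
    (hx : Tube Ω x r) (hz : ‖z‖ ≤ r) {ξ : ℝ} (hξ : ξ ∈ Icc 0 T) :
    ‖∫ s in c..d, (F ((x + z).val ξ) s - F (x.val ξ) s)‖ ≤ K * ‖z‖ := by
  have hr : 0 ≤ r := (norm_nonneg z).trans hz
  have hzξ : ‖z.val ξ‖ ≤ ‖z‖ := Reg.norm_val_le z ξ
  rw [Reg.val_add]
  refine (hF.norm_integral_sub_le hΩ hc hd hK (convex_closedBall (x.val ξ) r) (hx ξ hξ)
    (Metric.mem_closedBall_self hr) ?_).trans ?_
  · rw [mem_closedBall_iff_norm, add_sub_cancel_left]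
    exact hzξ.trans hz
  · rw [add_sub_cancel_left]
    exact mul_le_mul_of_nonneg_left hzξ ((norm_nonneg _).trans (hK _ (hx.val_mem hr hξ)))

-- On a small cell both curves are almost constant, and for constant arguments the mean value
-- theorem applies to the integral over the cell.
theorem exists_norm_integral_superposition_sub_le (hF : CaratheodoryC1 F m θ Ω T)
    (hΩ : IsOpen Ω) (hx : Tube Ω x r) (hz : ‖z‖ < r)
    (hV : ∀ y ∈ Ω, ∀ c d, 0 ≤ c → c ≤ d → d ≤ T → ‖∫ s in c..d, dgx F y s‖ ≤ V d - V c)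
    {κ : ℝ} (hκ : 0 < κ) {t : ℝ} (ht : t ∈ Icc 0 T) :
    ∃ η > 0, ∀ c d, 0 ≤ c → c < d → d ≤ T → (t = c ∨ t = d) → d - c < η →
      ‖∫ s in c..d, (F ((x + z).val s) s - F (x.val s) s)‖ ≤
        (V d - V c) * ‖z‖ + κ * ∫ s in c..d, θ s := by
  have hT : 0 ≤ T := ht.1.trans ht.2
  have hr : 0 < r := (norm_nonneg z).trans_lt hz
  obtain ⟨η₁, hη₁, hosc_add⟩ := hF.differentialBound.exists_norm_oscillation_le
    (hx.add (z := z) (r := r - ‖z‖) (by linarith)) (sub_pos.2 hz) (half_pos hκ) ht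
  obtain ⟨η₂, hη₂, hosc⟩ := hF.differentialBound.exists_norm_oscillation_le hx hr (half_pos hκ) ht
  refine ⟨min η₁ η₂, lt_min hη₁ hη₂, fun c d hc hcd hd htcd hdcη => ?_⟩
  have hc_mem : c ∈ Icc 0 T := ⟨hc, hcd.le.trans hd⟩
  have hd_mem : d ∈ Icc 0 T := ⟨hc.trans hcd.le, hd⟩
  obtain ⟨ξ, hξ⟩ := nonempty_Ioo.2 hcd
  have hξ_mem : ξ ∈ Icc 0 T := ⟨hc.trans hξ.1.le, hξ.2.le.trans hd⟩
  set D : ℝ → Vec n := fun s => F ((x + z).val s) s - F (x.val s) s with hD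
  set Dξ : ℝ → Vec n := fun s => F ((x + z).val ξ) s - F (x.val ξ) s with hDξ
  have hD_int : IntervalIntegrable D volume c d :=
    intervalIntegrable_of_mem_Icc (hF.intervalIntegrable_superposition_sub hT hx hz) hc_mem hd_mem
  have hDξ_int : IntervalIntegrable Dξ volume c d := intervalIntegrable_of_mem_Icc
    ((hF.intervalIntegrable hT (hx.val_add_mem hz.le hξ_mem)).sub
      (hF.intervalIntegrable hT (hx.val_mem hr.le hξ_mem))) hc_mem hd_mem
  have hfreeze : ‖∫ s in c..d, (D s - Dξ s)‖ ≤ κ * ∫ s in c..d, θ s := by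
    rw [← intervalIntegral.integral_const_mul]
    refine intervalIntegral.norm_integral_le_of_norm_le hcd.le ?_
      ((intervalIntegrable_of_mem_Icc hF.bound_integrable hc_mem hd_mem).const_mul κ)
    filter_upwards [Measure.ae_ne volume d] with s hsd hs
    have hs_mem : s ∈ Ioo c d := ⟨hs.1, hs.2.lt_of_ne hsd⟩
    rw [hD, hDξ, sub_sub_sub_comm]
    refine (norm_sub_le _ _).trans ((add_le_add
      (hosc_add c d hc hcd hd htcd (hdcη.trans_le (min_le_left _ _)) ξ hξ s hs_mem)
      (hosc c d hc hcd hd htcd (hdcη.trans_le (min_le_right _ _)) ξ hξ s hs_mem)).trans_eq ?_)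
    ring
  have hmean : ‖∫ s in c..d, Dξ s‖ ≤ (V d - V c) * ‖z‖ :=
    hF.norm_integral_add_val_sub_le hΩ hc_mem hd_mem (fun y hy => hV y hy c d hc hcd.le hd) hx hz.le
      hξ_mem
  rw [intervalIntegral.integral_sub hD_int hDξ_int] at hfreeze
  linarith [norm_le_norm_add_norm_sub' (∫ s in c..d, D s) (∫ s in c..d, Dξ s)]

theorem norm_integral_superposition_sub_le_add (hF : CaratheodoryC1 F m θ Ω T)
    (hΩ : IsOpen Ω) (hx : Tube Ω x r) (hz : ‖z‖ < r)
    (hV : ∀ y ∈ Ω, ∀ c d, 0 ≤ c → c ≤ d → d ≤ T → ‖∫ s in c..d, dgx F y s‖ ≤ V d - V c)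
    {κ : ℝ} (hκ : 0 < κ) {t : ℝ} (ht : t ∈ Icc 0 T) :
    ‖∫ s in (0 : ℝ)..t, (F ((x + z).val s) s - F (x.val s) s)‖ ≤
      (V t - V 0) * ‖z‖ + κ * ∫ s in (0 : ℝ)..t, θ s := by
  have hT : 0 ≤ T := ht.1.trans ht.2
  refine cousin_induction (P := fun c d =>
    ‖∫ s in c..d, (F ((x + z).val s) s - F (x.val s) s)‖ ≤
      (V d - V c) * ‖z‖ + κ * ∫ s in c..d, θ s) ht.1 ?refl ?trans ?loc
  case refl => simp
  case trans =>
    intro c d e hc hcd hde he hcd_le hde_le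
    have hc_mem : c ∈ Icc 0 T := ⟨hc, (hcd.trans hde).trans (he.trans ht.2)⟩
    have hd_mem : d ∈ Icc 0 T := ⟨hc.trans hcd, hde.trans (he.trans ht.2)⟩
    have he_mem : e ∈ Icc 0 T := ⟨hd_mem.1.trans hde, he.trans ht.2⟩
    have hD := hF.intervalIntegrable_superposition_sub hT hx hz
    have hθ := hF.bound_integrable
    rw [← intervalIntegral.integral_add_adjacent_intervals
        (intervalIntegrable_of_mem_Icc hD hc_mem hd_mem)
        (intervalIntegrable_of_mem_Icc hD hd_mem he_mem),
      ← intervalIntegral.integral_add_adjacent_intervals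
        (intervalIntegrable_of_mem_Icc hθ hc_mem hd_mem)
        (intervalIntegrable_of_mem_Icc hθ hd_mem he_mem)]
    exact (norm_add_le _ _).trans ((add_le_add hcd_le hde_le).trans_eq (by ring))
  case loc =>
    intro τ hτ
    obtain ⟨η, hη, hcell⟩ := hF.exists_norm_integral_superposition_sub_le hΩ hx hz hV hκ
      (t := τ) ⟨hτ.1, hτ.2.trans ht.2⟩
    exact ⟨η, hη, fun c d hc hcd hd => hcell c d hc hcd (hd.trans ht.2)⟩

theorem norm_integral_superposition_sub_le (hF : CaratheodoryC1 F m θ Ω T)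
    (hΩ : IsOpen Ω) (hx : Tube Ω x r) (hz : ‖z‖ < r)
    (hV : ∀ y ∈ Ω, ∀ c d, 0 ≤ c → c ≤ d → d ≤ T → ‖∫ s in c..d, dgx F y s‖ ≤ V d - V c)
    {t : ℝ} (ht : t ∈ Icc 0 T) :
    ‖∫ s in (0 : ℝ)..t, (F ((x + z).val s) s - F (x.val s) s)‖ ≤ (V T - V 0) * ‖z‖ := by
  have hlim : Tendsto (fun κ : ℝ => (V t - V 0) * ‖z‖ + κ * ∫ s in (0 : ℝ)..t, θ s) (𝓝[>] 0)
      (𝓝 ((V t - V 0) * ‖z‖)) := by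
    have hcont : Continuous fun κ : ℝ => (V t - V 0) * ‖z‖ + κ * ∫ s in (0 : ℝ)..t, θ s := by
      fun_prop
    simpa using (hcont.tendsto 0).mono_left nhdsWithin_le_nhds
  refine (ge_of_tendsto hlim (eventually_mem_nhdsWithin.mono fun κ hκ =>
    hF.norm_integral_superposition_sub_le_add hΩ hx hz hV hκ ht)).trans ?_
  have hVt : V t ≤ V T := sub_nonneg.1 ((norm_nonneg _).trans
    (hV _ (hx.val_mem ((norm_nonneg z).trans hz.le) ht) t T ht.1 ht.2 le_rfl))
  gcongr

end CaratheodoryC1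

/-! ## The operator and its Fréchet derivative -/

theorem DominatedBy.const_add_add {E : Type*} [NormedAddCommGroup E] {F G : ℝ → E} {V W : ℝ → ℝ}
    {a b : ℝ} (hF : DominatedBy F V a b) (hG : DominatedBy G W a b) (k : E) :
    DominatedBy (fun t => k + F t + G t) (fun t => V t + W t) a b := by
  intro c d hc hcd hd
  dsimp only
  rw [add_sub_add_comm, add_sub_add_left_eq_sub, add_sub_add_comm]
  exact (norm_add_le _ _).trans (add_le_add (hF c d hc hcd hd) (hG c d hc hcd hd))

theorem DominatedBy.norm_sub_left_le {E : Type*} [NormedAddCommGroup E] {F : ℝ → E} {V : ℝ → ℝ}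
    {a b t : ℝ} (hF : DominatedBy F V a b) (ht : t ∈ Icc a b) : ‖F t - F a‖ ≤ V b - V a :=
  (hF a t le_rfl ht.1 ht.2).trans (by linarith [hF.increment_nonneg ht.1 ht.2 le_rfl])

theorem exists_continuousLinearMap_val_eq {E : Type*} [NormedAddCommGroup E] [NormedSpace ℝ E]
    {n : ℕ} {T C : ℝ} {K : E → ℝ → Vec n} (hreg : ∀ z, IsRegulated fun t : Icc (0 : ℝ) T => K z t)
    (hlin : ∀ t ∈ Icc 0 T, IsLinearMap ℝ fun z => K z t) (hC : 0 ≤ C)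
    (hK : ∀ z, ∀ t ∈ Icc 0 T, ‖K z t‖ ≤ C * ‖z‖) :
    ∃ L : E →L[ℝ] Reg n T, ∀ z, ∀ t ∈ Icc 0 T, (L z).val t = K z t := by
  have hval : ∀ z, ∀ t ∈ Icc 0 T, (Reg.mk _ (hreg z)).val t = K z t := fun z t ht =>
    Reg.val_mk (hreg z) ht
  let L : E →ₗ[ℝ] Reg n T :=
    { toFun := fun z => Reg.mk _ (hreg z)
      map_add' := fun z w => Reg.ext_val fun t ht => by
        rw [Reg.val_add, hval _ t ht, hval _ t ht, hval _ t ht, (hlin t ht).map_add]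
      map_smul' := fun c z => Reg.ext_val fun t ht => by
        rw [RingHom.id_apply, Reg.val_smul, hval _ t ht, hval _ t ht, (hlin t ht).map_smul] }
  refine ⟨L.mkContinuous C fun z => Reg.norm_le (by positivity) fun t ht => ?_, hval⟩
  exact (congrArg norm (hval z t ht)).trans_le (hK z t ht)

theorem KSIntegrable.dominatedBy_ksIntegral {E : Type*} [NormedAddCommGroup E] [NormedSpace ℝ E]
    [CompleteSpace E] {u : ℝ → E} {h V m : ℝ → ℝ} {a b : ℝ} (hu : KSIntegrable u h a b)
    (hV : DominatedBy h V a b) (hm : KSIntegrable m V a b) (hum : ∀ s ∈ Icc a b, ‖u s‖ ≤ m s) :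
    DominatedBy (ksIntegral u h a) (ksIntegral m V a) a b := fun _ _ hac hcd hdb =>
  (hu.hasKSIntegral_sub hac hcd hdb).norm_le hcd (hV.mono hac hdb)
    (fun s hs => hum s ⟨hac.trans hs.1, hs.2.trans hdb⟩) (hm.hasKSIntegral_sub hac hcd hdb)

section Operator

variable {n : ℕ} {T : ℝ} {Ω : Set (Vec n)} {F g : Vec n → ℝ → Vec n} {f : ℝ → Vec n → ℝ → Vec n}
  {h V m mg θ : ℝ → ℝ} {x : Reg n T} {r C lam : ℝ}

theorem CaratheodoryC1.isLinearMap_integral_derivative (hF : CaratheodoryC1 F m θ Ω T)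
    (hx : Tube Ω x r) (hr : 0 < r) {t : ℝ} (ht : t ∈ Icc 0 T) :
    IsLinearMap ℝ fun z : Reg n T => ∫ s in (0 : ℝ)..t, dgx F (x.val s) s (z.val s) := by
  have hT : 0 ≤ T := ht.1.trans ht.2
  have hint (z : Reg n T) : IntervalIntegrable (fun s => dgx F (x.val s) s (z.val s)) volume 0 t :=
    intervalIntegrable_of_mem_Icc (hF.intervalIntegrable_derivative hT hx hr z)
      (left_mem_Icc.2 hT) ht
  constructor
  · intro z w
    simp only [Reg.val_add, map_add]
    exact intervalIntegral.integral_add (hint z) (hint w)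
  · intro c z
    simp only [Reg.val_smul, map_smul]
    exact intervalIntegral.integral_smul c _

theorem StieltjesC1.isLinearMap_ksIntegral_derivative (hg : StieltjesC1 g h V mg C Ω T)
    (hx : Tube Ω x r) (hr : 0 < r) {t : ℝ} (ht : t ∈ Icc 0 T) :
    IsLinearMap ℝ fun z : Reg n T =>
      ksIntegral (fun s => dgx g (x.val s) s (z.val s)) h 0 t := by
  have hint (z : Reg n T) :=
    ((hg.ksIntegrable_derivative (ht.1.trans ht.2) hx hr z).mono le_rfl ht.1 ht.2).hasKSIntegral
      ht.1
  constructor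
  · intro z w
    simp only [Reg.val_add, map_add]
    exact ((hint z).add (hint w)).ksIntegral_eq ht.1
  · intro c z
    simp only [Reg.val_smul, map_smul]
    exact ((hint z).smul c).ksIntegral_eq ht.1

theorem isRegulated_phiFun (hF : CaratheodoryC1 (f lam) m θ Ω T)
    (hg : StieltjesC1 g h V mg C Ω T) (hT : 0 ≤ T) (hx : Tube Ω x r) (hr : 0 < r) :
    IsRegulated (phiFun f g h lam x) :=
  ((dominatedBy_integral hF.majorant_integrable (hF.intervalIntegrable_superposition hT hx hr)
    fun s hs => hF.norm_le _ (hx.val_mem hr.le hs) s hs).const_add_add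
    ((hg.ksIntegrable_superposition hT hx hr).dominatedBy_ksIntegral hg.isVariation.dominated
      hg.majorant_integrable fun s hs => hg.norm_le _ (hx.val_mem hr.le hs) s hs)
    (x.val T)).isRegulated

theorem phi_val (hF : CaratheodoryC1 (f lam) m θ Ω T) (hg : StieltjesC1 g h V mg C Ω T)
    (hx : Tube Ω x r) (hr : 0 < r) {t : ℝ} (ht : t ∈ Icc 0 T) :
    (phi f g h lam x).val t = x.val T + (∫ s in (0 : ℝ)..t, f lam (x.val s) s) +
      ksIntegral (fun s => g (x.val s) s) h 0 t := by
  rw [phi, dif_pos (isRegulated_phiFun hF hg (ht.1.trans ht.2) hx hr), Reg.val_mk _ ht]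
  rfl

/-- The value at `t` of the derivative at `x` of the operator `Φ̃(lam, ·)` in the direction `z`,
where `F = f(lam, ·, ·)`. -/
noncomputable def phiDerivFun (F g : Vec n → ℝ → Vec n) (h : ℝ → ℝ) (x z : Reg n T) (t : ℝ) :
    Vec n :=
  z.val T + (∫ s in (0 : ℝ)..t, dgx F (x.val s) s (z.val s)) +
    ksIntegral (fun s => dgx g (x.val s) s (z.val s)) h 0 t

theorem isLinearMap_phiDerivFun (hF : CaratheodoryC1 F m θ Ω T)
    (hg : StieltjesC1 g h V mg C Ω T) (hx : Tube Ω x r) (hr : 0 < r) {t : ℝ} (ht : t ∈ Icc 0 T) :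
    IsLinearMap ℝ fun z => phiDerivFun F g h x z t := by
  have hint := hF.isLinearMap_integral_derivative hx hr ht
  have hks := hg.isLinearMap_ksIntegral_derivative hx hr ht
  refine ⟨fun z w => ?_, fun c z => ?_⟩
  · rw [phiDerivFun, Reg.val_add, hint.map_add, hks.map_add, phiDerivFun, phiDerivFun]
    abel
  · rw [phiDerivFun, Reg.val_smul, hint.map_smul, hks.map_smul, phiDerivFun, smul_add, smul_add]

theorem dominatedBy_phiDerivFun (hF : CaratheodoryC1 F m θ Ω T)
    (hg : StieltjesC1 g h V mg C Ω T) (hT : 0 ≤ T) (hx : Tube Ω x r) (hr : 0 < r) (z : Reg n T) :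
    DominatedBy (phiDerivFun F g h x z)
      (fun t => (∫ s in (0 : ℝ)..t, θ s * ‖z‖) + ksIntegral (fun _ => C * ‖z‖) V 0 t) 0 T :=
  (dominatedBy_integral (hF.bound_integrable.mul_const ‖z‖)
    (hF.intervalIntegrable_derivative hT hx hr z)
    fun _ hs => hF.differentialBound.norm_derivative_le hx hr.le z hs).const_add_add
    ((hg.ksIntegrable_derivative hT hx hr z).dominatedBy_ksIntegral hg.isVariation.dominated
      ⟨_, hasKSIntegral_const (C * ‖z‖)⟩
      fun _ hs => hg.differentialBound.norm_derivative_le hx hr.le z hs) (z.val T)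

theorem norm_phiDerivFun_le (hF : CaratheodoryC1 F m θ Ω T)
    (hg : StieltjesC1 g h V mg C Ω T) (hx : Tube Ω x r) (hr : 0 < r) (z : Reg n T) {t : ℝ}
    (ht : t ∈ Icc 0 T) :
    ‖phiDerivFun F g h x z t‖ ≤ (1 + (∫ s in (0 : ℝ)..T, θ s) + (V T - V 0) * C) * ‖z‖ := by
  have hT : 0 ≤ T := ht.1.trans ht.2
  have hsub := (dominatedBy_phiDerivFun hF hg hT hx hr z).norm_sub_left_le ht
  have hzero : phiDerivFun F g h x z 0 = z.val T := by
    rw [phiDerivFun, intervalIntegral.integral_same, ksIntegral_self, add_zero, add_zero]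
  rw [intervalIntegral.integral_same, ksIntegral_self, add_zero, sub_zero,
    intervalIntegral.integral_mul_const, (hasKSIntegral_const (C * ‖z‖)).ksIntegral_eq hT,
    smul_eq_mul, hzero] at hsub
  linarith [norm_le_norm_add_norm_sub' (phiDerivFun F g h x z t) (z.val T), Reg.norm_val_le z T]

theorem exists_continuousLinearMap_phiDerivFun (hF : CaratheodoryC1 F m θ Ω T)
    (hg : StieltjesC1 g h V mg C Ω T) (hT : 0 ≤ T) (hx : Tube Ω x r) (hr : 0 < r) :
    ∃ L : Reg n T →L[ℝ] Reg n T, ∀ z, ∀ t ∈ Icc 0 T, (L z).val t = phiDerivFun F g h x z t := by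
  have hΩ : Ω.Nonempty := ⟨_, hx.val_mem hr.le (left_mem_Icc.2 hT)⟩
  have hθ : 0 ≤ ∫ s in (0 : ℝ)..T, θ s :=
    intervalIntegral.integral_nonneg hT fun s hs => hF.differentialBound.nonneg hΩ hs
  have hC : 0 ≤ C := hg.differentialBound.nonneg hΩ (left_mem_Icc.2 hT)
  have hV : 0 ≤ V T - V 0 := hg.isVariation.dominated.increment_nonneg le_rfl hT le_rfl
  exact exists_continuousLinearMap_val_eq
    (fun z => (dominatedBy_phiDerivFun hF hg hT hx hr z).isRegulated)
    (fun t ht => isLinearMap_phiDerivFun hF hg hx hr ht) (by positivity)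
    fun z t ht => norm_phiDerivFun_le hF hg hx hr z ht

theorem differentiableAt_phi (hF : CaratheodoryC1 (f lam) m θ Ω T)
    (hg : StieltjesC1 g h V mg C Ω T) (hT : 0 ≤ T) (hx : Tube Ω x r) (hr : 0 < r) :
    DifferentiableAt ℝ (phi f g h lam) x := by
  obtain ⟨L, hL⟩ := exists_continuousLinearMap_phiDerivFun hF hg hT hx hr
  refine ⟨L, hasFDerivAt_iff_isLittleO_nhds_zero.2 (Asymptotics.isLittleO_iff.2 fun ε hε => ?_)⟩
  have hsmall : ∀ᶠ z in 𝓝 (0 : Reg n T), ‖z‖ < r := tendsto_norm_zero.eventually_lt_const hr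
  filter_upwards [hF.eventually_norm_integral_sub_sub_le hT hx hr (half_pos hε),
    hg.eventually_norm_ksIntegral_sub_sub_le hT hx hr (half_pos hε), hsmall] with z hint hks hzr
  refine Reg.norm_le (by positivity) fun t ht => ?_
  rw [Reg.val_sub, Reg.val_sub, hL z t ht, phi_val hF hg hx hr ht, phi_val hF hg
    (hx.add (z := z) (r := r - ‖z‖) (by linarith)) (sub_pos.2 hzr) ht, Reg.val_add x z T]
  calc _ = _ := congrArg norm ?_
    _ ≤ _ := norm_add_le _ _
    _ ≤ ε / 2 * ‖z‖ + ε / 2 * ‖z‖ := add_le_add (hint t ht) (hks t ht)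
    _ = ε * ‖z‖ := by ring
  rw [phiDerivFun]
  abel

end Operator

/-! ## Periodic solutions and the parameter -/

section Solutions

variable {n : ℕ} {T : ℝ}

theorem isTest_smul_single {ψ : ℝ → ℝ} (hψ : ContDiff ℝ ∞ ψ) (hψ0 : ∀ t ∉ Ioo 0 T, ψ t = 0)
    (i : Fin n) : IsTest T fun t => ψ t • (PiLp.single 1 i (1 : ℝ) : Vec n) :=
  ⟨hψ.smul contDiff_const, fun t ht => by simp only [hψ0 t ht, zero_smul]⟩

theorem pairing_smul_single (w : ℝ → Vec n) (ψ : ℝ → ℝ) (i : Fin n) :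
    pairing T w (fun t => ψ t • (PiLp.single 1 i (1 : ℝ) : Vec n)) =
      ∫ t in (0 : ℝ)..T, ψ t • w t i := by
  have hdot (t : ℝ) : dot (w t) (ψ t • PiLp.single 1 i (1 : ℝ)) = ψ t • w t i := by
    simp [dot, mul_comm]
  simp only [pairing, hdot]

theorem ae_eq_of_integral_contDiff_smul_eq {u v : ℝ → ℝ} (hT : 0 ≤ T)
    (hu : IntervalIntegrable u volume 0 T) (hv : IntervalIntegrable v volume 0 T)
    (huv : ∀ ψ : ℝ → ℝ, ContDiff ℝ ∞ ψ → (∀ t ∉ Ioo 0 T, ψ t = 0) →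
      ∫ t in (0 : ℝ)..T, ψ t • u t = ∫ t in (0 : ℝ)..T, ψ t • v t) :
    ∀ᵐ t, t ∈ Ioo 0 T → u t = v t := by
  have hsub : IntegrableOn (fun t => u t - v t) (Ioo 0 T) :=
    (intervalIntegrable_iff_integrableOn_Ioo_of_le hT).1 (hu.sub hv)
  have hzero : ∀ᵐ t, t ∈ Ioo 0 T → u t - v t = 0 := by
    refine isOpen_Ioo.ae_eq_zero_of_integral_contDiff_smul_eq_zero hsub.locallyIntegrableOn
      fun ψ hψ _ hsupp => ?_
    have hψ0 : ∀ t ∉ Ioo 0 T, ψ t = 0 := fun t ht =>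
      image_eq_zero_of_notMem_tsupport fun h => ht (hsupp h)
    rw [← setIntegral_eq_integral_of_forall_compl_eq_zero (s := Ioc 0 T) fun t ht => by
        rw [hψ0 t fun h => ht (Ioo_subset_Ioc_self h), zero_smul],
      ← intervalIntegral.integral_of_le hT]
    simp only [smul_sub]
    rw [intervalIntegral.integral_sub (hu.continuousOn_smul hψ.continuous.continuousOn)
      (hv.continuousOn_smul hψ.continuous.continuousOn), huv ψ hψ hψ0, sub_self]
  exact hzero.mono fun t ht hmem => sub_eq_zero.1 (ht hmem)

theorem ae_eq_of_pairing_eq {u v : ℝ → Vec n} (hT : 0 ≤ T)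
    (hu : IntervalIntegrable u volume 0 T) (hv : IntervalIntegrable v volume 0 T)
    (huv : ∀ φ : ℝ → Vec n, IsTest T φ → pairing T u φ = pairing T v φ) :
    ∀ᵐ t, t ∈ Ioo 0 T → u t = v t := by
  have hproj (i : Fin n) {w : ℝ → Vec n} (hw : IntervalIntegrable w volume 0 T) :
      IntervalIntegrable (fun t => w t i) volume 0 T :=
    ⟨(PiLp.proj 1 (fun _ : Fin n => ℝ) i : Vec n →L[ℝ] ℝ).integrable_comp hw.1,
      (PiLp.proj 1 (fun _ : Fin n => ℝ) i : Vec n →L[ℝ] ℝ).integrable_comp hw.2⟩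
  have hcomp (i : Fin n) : ∀ᵐ t, t ∈ Ioo 0 T → u t i = v t i :=
    ae_eq_of_integral_contDiff_smul_eq hT (hproj i hu) (hproj i hv) fun ψ hψ hψ0 => by
      rw [← pairing_smul_single, ← pairing_smul_single, huv _ (isTest_smul_single hψ hψ0 i)]
  filter_upwards [ae_all_iff.2 hcomp] with t ht hmem
  ext i
  exact ht i hmem

-- The test functions do not see a jump of `x₀` at `0`, so `Φ̃(lam, x₀) = x₀` may fail; only the
-- independence of `Φ̃(lam, x₀)` from `lam` can be read off the equations.
theorem IsPeriodicSolution.phi_eq {Ω : Set (Vec n)} {f : ℝ → Vec n → ℝ → Vec n}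
    {g : Vec n → ℝ → Vec n} {h : ℝ → ℝ} {x₀ : Reg n T} {lam mu : ℝ} (hT : 0 ≤ T)
    (hlam : IsPeriodicSolution T Ω f g h x₀ lam) (hmu : IsPeriodicSolution T Ω f g h x₀ mu)
    (hlam_int : IntervalIntegrable (fun s => f lam (x₀.val s) s) volume 0 T)
    (hmu_int : IntervalIntegrable (fun s => f mu (x₀.val s) s) volume 0 T) :
    phi f g h lam x₀ = phi f g h mu x₀ := by
  have hae := ae_eq_of_pairing_eq hT hlam_int hmu_int fun φ hφ => by
    linarith [hlam.eqn φ hφ, hmu.eqn φ hφ]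
  have hfun : phiFun f g h lam x₀ = phiFun f g h mu x₀ := by
    funext t
    rw [phiFun, phiFun, intervalIntegral.integral_congr_ae]
    filter_upwards [hae, Measure.ae_ne volume T] with s hs hsT hmem
    rw [uIoc_of_le t.2.1] at hmem
    exact hs ⟨hmem.1, (hmem.2.trans t.2.2).lt_of_ne hsT⟩
  grind [phi]

end Solutions

/-! ## Local uniqueness -/

theorem eq_zero_of_norm_apply_le {E F : Type*} [NormedAddCommGroup E] [NormedSpace ℝ E]
    [NormedAddCommGroup F] [NormedSpace ℝ F] (e : E ≃L[ℝ] F) {z : E}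
    (hz : ‖e z‖ ≤ (‖(e.symm : F →L[ℝ] E)‖ + 1)⁻¹ * ‖z‖) : z = 0 := by
  have hsymm : ‖z‖ ≤ ‖(e.symm : F →L[ℝ] E)‖ * ‖e z‖ := by
    simpa using (e.symm : F →L[ℝ] E).le_opNorm (e z)
  rw [le_inv_mul_iff₀ (by positivity)] at hz
  have hez : ‖e z‖ ≤ 0 := by linarith
  exact e.map_eq_zero_iff.1 (norm_le_zero_iff.1 hez)

theorem exists_eventually_eq_zero_of_norm_apply_sub_le {E F : Type*} [NormedAddCommGroup E]
    [NormedSpace ℝ E] [NormedAddCommGroup F] [NormedSpace ℝ F] (e : E ≃L[ℝ] F) (q : F) :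
    ∃ ε > 0, ∀ᶠ z in 𝓝 (0 : E), ‖e z - q‖ ≤ ε * ‖z‖ → z = 0 := by
  refine ⟨(‖(e.symm : F →L[ℝ] E)‖ + 1)⁻¹, by positivity, ?_⟩
  obtain rfl | hq := eq_or_ne q 0
  · exact .of_forall fun z hz => eq_zero_of_norm_apply_le e (by rwa [sub_zero] at hz)
  · have hlt : ∀ᶠ z in 𝓝 (0 : E), (‖(e.symm : F →L[ℝ] E)‖ + 1)⁻¹ * ‖z‖ < ‖e z - q‖ :=
      ContinuousAt.eventually_lt (by fun_prop) (by fun_prop) (by simpa using hq)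
    exact hlt.mono fun z hz hle => absurd hle hz.not_ge

section Parameter

variable {n : ℕ} {T : ℝ} {Ω : Set (Vec n)} {Λ : Set ℝ} {f : ℝ → Vec n → ℝ → Vec n}
  {g : Vec n → ℝ → Vec n} {h V mg γ : ℝ → ℝ} {x z : Reg n T} {r C lam mu : ℝ}

/-- Continuity at `mu`, within `Λ`, of the integrals of `f'_x` over the subintervals of `[0, T]`,
uniformly in `Ω` and with the increments of `γ` as weights. -/
def ParamDiffContinuousAt (T : ℝ) (Ω : Set (Vec n)) (Λ : Set ℝ) (f : ℝ → Vec n → ℝ → Vec n)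
    (γ : ℝ → ℝ) (mu : ℝ) : Prop :=
  ∀ ε > 0, ∀ᶠ lam in 𝓝[Λ] mu, ∀ x ∈ Ω, ∀ c d, 0 ≤ c → c ≤ d → d ≤ T →
    ‖∫ s in c..d, (dfx f lam x s - dfx f mu x s)‖ ≤ ε * (γ d - γ c)

theorem norm_phi_add_sub_sub_le {mlam θlam mmu θmu : ℝ → ℝ}
    (hlam : CaratheodoryC1 (f lam) mlam θlam Ω T) (hmu : CaratheodoryC1 (f mu) mmu θmu Ω T)
    (hg : StieltjesC1 g h V mg C Ω T) (hT : 0 ≤ T) (hΩ : IsOpen Ω) (hx : Tube Ω x r)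
    (hz : ‖z‖ < r)
    (hW : ∀ y ∈ Ω, ∀ c d, 0 ≤ c → c ≤ d → d ≤ T →
      ‖∫ s in c..d, (dfx f lam y s - dfx f mu y s)‖ ≤ γ d - γ c) :
    ‖phi f g h lam (x + z) - phi f g h mu (x + z) - (phi f g h lam x - phi f g h mu x)‖ ≤
      (γ T - γ 0) * ‖z‖ := by
  have hr : 0 < r := (norm_nonneg z).trans_lt hz
  have hxz : Tube Ω (x + z) (r - ‖z‖) := hx.add (by linarith)
  have hzr : 0 < r - ‖z‖ := sub_pos.2 hz
  have hγ : 0 ≤ γ T - γ 0 := (norm_nonneg _).trans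
    (hW _ (hx.val_mem hr.le (left_mem_Icc.2 hT)) 0 T le_rfl hT le_rfl)
  refine Reg.norm_le (by positivity) fun t ht => ?_
  have hdgx (y : Vec n) (hy : y ∈ Ω) (c d : ℝ) (hc : 0 ≤ c) (hcd : c ≤ d) (hd : d ≤ T) :
      ‖∫ s in c..d, dgx (fun y s => f lam y s - f mu y s) y s‖ ≤ γ d - γ c := by
    refine (congrArg norm (intervalIntegral.integral_congr fun s hs => ?_)).trans_le
      (hW y hy c d hc hcd hd)
    rw [uIcc_of_le hcd] at hs
    exact (hlam.hasFDerivAt_sub hmu hy ⟨hc.trans hs.1, hs.2.trans hd⟩).fderiv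
  have hint {F : Vec n → ℝ → Vec n} {m θ : ℝ → ℝ} (hF : CaratheodoryC1 F m θ Ω T) {y : Reg n T}
      {r : ℝ} (hy : Tube Ω y r) (hr : 0 < r) :
      IntervalIntegrable (fun s => F (y.val s) s) volume 0 t :=
    intervalIntegrable_of_mem_Icc (hF.intervalIntegrable_superposition hT hy hr)
      (left_mem_Icc.2 hT) ht
  have hmean := (hlam.sub hmu).norm_integral_superposition_sub_le hΩ hx hz hdgx ht
  rw [intervalIntegral.integral_sub (hint (hlam.sub hmu) hxz hzr) (hint (hlam.sub hmu) hx hr),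
    intervalIntegral.integral_sub (hint hlam hxz hzr) (hint hmu hxz hzr),
    intervalIntegral.integral_sub (hint hlam hx hr) (hint hmu hx hr)] at hmean
  simp only [Reg.val_sub]
  rwa [phi_val hlam hg hxz hzr ht, phi_val hmu hg hxz hzr ht, phi_val hlam hg hx hr ht,
    phi_val hmu hg hx hr ht, add_sub_add_right_eq_sub, add_sub_add_left_eq_sub,
    add_sub_add_right_eq_sub, add_sub_add_left_eq_sub]

theorem ParamDiffContinuousAt.eventually_norm_phi_sub_sub_le
    (hγ : ParamDiffContinuousAt T Ω Λ f γ mu)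
    (hf : ∀ lam ∈ Λ, ∃ m θ, CaratheodoryC1 (f lam) m θ Ω T)
    (hg : StieltjesC1 g h V mg C Ω T) (hT : 0 ≤ T) (hΩ : IsOpen Ω) (hx : Tube Ω x r)
    (hr : 0 < r) (hmu : mu ∈ Λ) {ε : ℝ} (hε : 0 < ε) :
    ∀ᶠ q in 𝓝 (x, mu), q.2 ∈ Λ →
      ‖phi f g h q.2 q.1 - phi f g h mu q.1 - (phi f g h q.2 x - phi f g h mu x)‖ ≤
        ε * ‖q.1 - x‖ := by
  obtain ⟨η, hη, hηε⟩ : ∃ η > 0, η * (γ T - γ 0) < ε := by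
    have hlim : Tendsto (fun η : ℝ => η * (γ T - γ 0)) (𝓝[>] 0) (𝓝 0) := by
      simpa using ((continuous_mul_const (γ T - γ 0)).tendsto 0).mono_left nhdsWithin_le_nhds
    exact ((hlim.eventually_lt_const hε).and eventually_mem_nhdsWithin).exists.imp
      fun η hη => hη.symm
  have hball : ∀ᶠ y in 𝓝 x, ‖y - x‖ < r :=
    mem_of_superset (Metric.ball_mem_nhds x hr) fun y hy => mem_ball_iff_norm.1 hy
  filter_upwards [hball.prod_inl_nhds mu,
    (eventually_nhdsWithin_iff.1 (hγ η hη)).prod_inr_nhds x] with ⟨y, lam⟩ hy hW hlam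
  obtain ⟨mlam, θlam, hflam⟩ := hf lam hlam
  obtain ⟨mmu, θmu, hfmu⟩ := hf mu hmu
  have hbound := norm_phi_add_sub_sub_le (γ := fun s => η * γ s) hflam hfmu hg hT hΩ hx hy
    fun p hp c d hc hcd hd => (hW hlam p hp c d hc hcd hd).trans_eq (mul_sub _ _ _)
  rw [add_sub_cancel, ← mul_sub] at hbound
  exact hbound.trans (mul_le_mul_of_nonneg_right hηε.le (norm_nonneg _))

theorem ParamDiffContinuousAt.eventually_eq_of_phi_eq
    (hγ : ParamDiffContinuousAt T Ω Λ f γ mu)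
    (hf : ∀ lam ∈ Λ, ∃ m θ, CaratheodoryC1 (f lam) m θ Ω T)
    (hg : StieltjesC1 g h V mg C Ω T) (hT : 0 ≤ T) (hΩ : IsOpen Ω) (hx : Tube Ω x r)
    (hr : 0 < r) (hmu : mu ∈ Λ) (hphi : ∀ lam ∈ Λ, phi f g h lam x = phi f g h mu x)
    {e : Reg n T ≃L[ℝ] Reg n T} (he : (e : Reg n T →L[ℝ] Reg n T) =
      ContinuousLinearMap.id ℝ (Reg n T) - fderiv ℝ (phi f g h mu) x) :
    ∀ᶠ q in 𝓝 (x, mu), q.2 ∈ Λ → phi f g h q.2 q.1 = q.1 → q.1 = x := by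
  obtain ⟨m, θ, hfmu⟩ := hf mu hmu
  obtain ⟨ε, hε, huniq⟩ := exists_eventually_eq_zero_of_norm_apply_sub_le e (phi f g h mu x - x)
  have hsub : Tendsto (fun y => y - x) (𝓝 x) (𝓝 0) := tendsto_sub_nhds_zero_iff.2 tendsto_id
  have hrem := (differentiableAt_phi hfmu hg hT hx hr).hasFDerivAt.isLittleO.def (half_pos hε)
  filter_upwards [(hsub.eventually huniq).prod_inl_nhds mu, hrem.prod_inl_nhds mu,
    hγ.eventually_norm_phi_sub_sub_le hf hg hT hΩ hx hr hmu (half_pos hε)]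
    with ⟨y, lam⟩ huniq hrem hpar hlam hfix
  replace hpar := hpar hlam
  rw [hphi lam hlam, sub_self, sub_zero, hfix] at hpar
  refine sub_eq_zero.1 (huniq ?_)
  have hey : e (y - x) = y - x - fderiv ℝ (phi f g h mu) x (y - x) := DFunLike.congr_fun he (y - x)
  calc ‖e (y - x) - (phi f g h mu x - x)‖
      = ‖y - phi f g h mu y +
          (phi f g h mu y - phi f g h mu x - fderiv ℝ (phi f g h mu) x (y - x))‖ := by
        rw [hey]
        congr 1
        abel
    _ ≤ ε / 2 * ‖y - x‖ + ε / 2 * ‖y - x‖ := (norm_add_le _ _).trans (add_le_add hpar hrem)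
    _ = ε * ‖y - x‖ := by ring

theorem exists_forall_not_isBifurcationPoint (K : Set (Reg n T))
    (huniq : ∀ᶠ q in 𝓝 (x, mu), q.2 ∈ Λ → phi f g h q.2 q.1 = q.1 → q.1 = x) :
    ∃ δ > 0, ∀ (y : Reg n T) (lam : ℝ), ‖y - x‖ + |lam - mu| < δ →
      ¬ IsBifurcationPoint f g h K Λ y lam := by
  obtain ⟨δ, hδ, hnear⟩ := Metric.eventually_nhds_iff.1 huniq.eventually_nhds
  refine ⟨δ, hδ, fun y lam hlt ⟨⟨_, hlam, hfix⟩, hbif⟩ => ?_⟩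
  have hdist : dist (y, lam) (x, mu) < δ := by
    rw [Prod.dist_eq, dist_eq_norm, Real.dist_eq]
    exact (max_le_add_of_nonneg (norm_nonneg _) (abs_nonneg _)).trans_lt hlt
  obtain rfl : y = x := (hnear hdist).self_of_nhds hlam hfix
  obtain ⟨w, nu, hw, -, hnu, hwfix, hne⟩ := hbif _ (mem_nhdsWithin_of_mem_nhds (hnear hdist))
  exact hne (hw hnu hwfix)

end Parameter

/-! ## Verification of the regularity conditions -/

section Hypotheses

variable {n : ℕ} {T : ℝ} {Ω : Set (Vec n)} {Λ : Set ℝ} {f : ℝ → Vec n → ℝ → Vec n}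
  {g : Vec n → ℝ → Vec n} {h : ℝ → ℝ} {lam mu : ℝ}

theorem CaraCond.exists_caratheodoryC1 (hf : CaraCond T Ω Λ f) (hdf : DiffCondF T Ω Λ f)
    (hT : 0 ≤ T) (hlam : lam ∈ Λ) : ∃ m θ, CaratheodoryC1 (f lam) m θ Ω T := by
  obtain ⟨m, -, hm, hfm⟩ := hf.bound
  obtain ⟨θ, hθ, hfθ⟩ := hdf.bound
  refine ⟨m, fun t => n * θ t, hf.meas lam hlam,
    (intervalIntegrable_iff_integrableOn_Icc_of_le hT).2 hm, hfm lam hlam,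
    ((intervalIntegrable_iff_integrableOn_Icc_of_le hT).2 hθ).const_mul _,
    hdf.diff lam hlam, fun x hx t ht => (opNorm_le_matNorm _).trans ?_⟩
  exact mul_le_mul_of_nonneg_left (hfθ lam hlam x hx t ht) n.cast_nonneg

theorem StieltjesCond.exists_stieltjesC1 (hg : StieltjesCond T Ω g h) (hdg : DiffCondG T Ω g h)
    (hT : 0 ≤ T) (hh : BoundedVariationOn h (Icc 0 T)) :
    ∃ V m C, StieltjesC1 g h V m C Ω T := by
  obtain ⟨m, -, hm, hgm⟩ := hg.bound
  obtain ⟨C, hC⟩ := hdg.bdd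
  refine ⟨varFun T h, m, n * C, isVariation_varFun hT hh, hg.integrable,
    ⟨hdg.diff, fun x hx t ht => (opNorm_le_matNorm _).trans ?_⟩, hm, hgm⟩
  exact mul_le_mul_of_nonneg_left (hC x hx t ht) n.cast_nonneg

theorem ParamDiffCond.exists_paramDiffContinuousAt (hpar : ParamDiffCond T Ω Λ f g h)
    (hmu : mu ∈ Λ) : ∃ γ, ParamDiffContinuousAt T Ω Λ f γ mu := by
  obtain ⟨γ, hγ, hpar⟩ := hpar
  refine ⟨fun t => n * γ t, fun ε hε => ?_⟩
  obtain ⟨δ, hδ, hpar⟩ := hpar ε hε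
  filter_upwards [self_mem_nhdsWithin, mem_nhdsWithin_of_mem_nhds (Metric.ball_mem_nhds mu hδ)]
    with lam hlam hdist x hx c d hc hcd hd
  have hc_mem : c ∈ Icc 0 T := ⟨hc, hcd.trans hd⟩
  have hd_mem : d ∈ Icc 0 T := ⟨hc.trans hcd, hd⟩
  have hmat := hpar d hd_mem c hc_mem x hx x hx lam hlam mu hmu
    (by rwa [sub_self, norm_zero, add_zero])
  have hks : ksIntegral (fun s => dgx g x s - dgx g x s) h c d = 0 := by
    simpa only [sub_self, smul_zero] using (hasKSIntegral_const (h := h) (a := c) (b := d)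
      (0 : Vec n →L[ℝ] Vec n)).ksIntegral_eq hcd
  rw [hks, add_zero, abs_of_nonneg (sub_nonneg.2 (hγ hc_mem hd_mem hcd))] at hmat
  refine (opNorm_le_matNorm _).trans
    ((mul_le_mul_of_nonneg_left hmat n.cast_nonneg).trans_eq ?_)
  ring

end Hypotheses

end MDEBif

open MDEBif in
theorem mainTheorem4_general {n : ℕ} {T : ℝ} (hT : 0 ≤ T) {Ω : Set (Vec n)} (hΩ : IsOpen Ω)
    {Λ : Set ℝ} {f : ℝ → Vec n → ℝ → Vec n} {g : Vec n → ℝ → Vec n} {h V m : ℝ → ℝ} {C : ℝ}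
    (hf : ∀ lam ∈ Λ, ∃ m θ, CaratheodoryC1 (f lam) m θ Ω T) (hg : StieltjesC1 g h V m C Ω T)
    {x₀ : Reg n T} (hx₀ : ∀ lam ∈ Λ, IsPeriodicSolution T Ω f g h x₀ lam) {ρ : ℝ} (hρ : 0 < ρ)
    (hball : ∀ x ∈ Metric.closedBall x₀ ρ, ∀ t ∈ Icc 0 T, x.val t ∈ Ω) {lam₀ : ℝ}
    (hlam₀ : lam₀ ∈ Λ) {γ : ℝ → ℝ} (hγ : ParamDiffContinuousAt T Ω Λ f γ lam₀)
    (hiso : ∃ e : Reg n T ≃L[ℝ] Reg n T, (e : Reg n T →L[ℝ] Reg n T) =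
      ContinuousLinearMap.id ℝ (Reg n T) - fderiv ℝ (phi f g h lam₀) x₀) :
    ∃ δ > 0, ∀ (x : Reg n T) (lam : ℝ), ‖x - x₀‖ + |lam - lam₀| < δ →
      ¬ IsBifurcationPoint f g h (Metric.closedBall x₀ ρ) Λ x lam := by
  obtain ⟨e, he⟩ := hiso
  have htube : Tube Ω x₀ ρ := tube_of_forall_mem_closedBall hρ.le hball
  have hint : ∀ lam ∈ Λ, IntervalIntegrable (fun s => f lam (x₀.val s) s) volume 0 T := by
    intro lam hlam
    obtain ⟨m, θ, hlamC1⟩ := hf lam hlam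
    exact hlamC1.intervalIntegrable_superposition hT htube hρ
  have hphi : ∀ lam ∈ Λ, phi f g h lam x₀ = phi f g h lam₀ x₀ := fun lam hlam =>
    (hx₀ lam hlam).phi_eq hT (hx₀ lam₀ hlam₀) (hint lam hlam) (hint lam₀ hlam₀)
  exact exists_forall_not_isBifurcationPoint _
    (hγ.eventually_eq_of_phi_eq hf hg hT hΩ htube hρ hlam₀ hphi he)

theorem mainTheorem4 (n : ℕ) (T : ℝ) (hT : 0 < T)
    (Ω : Set (MDEBif.Vec n)) (hΩ : IsOpen Ω) (Λ : Set ℝ) (hΛ : IsOpen Λ)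
    (f : ℝ → MDEBif.Vec n → ℝ → MDEBif.Vec n) (g : MDEBif.Vec n → ℝ → MDEBif.Vec n) (h : ℝ → ℝ)
    (hh : MDEBif.IntegratorCond T h)
    (hf : MDEBif.CaraCond T Ω Λ f)
    (hg : MDEBif.StieltjesCond T Ω g h)
    (hdf : MDEBif.DiffCondF T Ω Λ f)
    (hdg : MDEBif.DiffCondG T Ω g h)
    (x₀ : MDEBif.Reg n T)
    (hx₀ : ∀ lam ∈ Λ, MDEBif.IsPeriodicSolution T Ω f g h x₀ lam)
    (ρ : ℝ) (hρ : 0 < ρ)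
    (hball : ∀ x ∈ Metric.closedBall x₀ ρ, ∀ t ∈ Set.Icc 0 T, x.val t ∈ Ω)
    (hpar : MDEBif.ParamCond T Ω Λ f)
    (hpard : MDEBif.ParamDiffCond T Ω Λ f g h)
    (lam₀ : ℝ) (hlam₀ : lam₀ ∈ Λ)
    (hiso : ∃ e : MDEBif.Reg n T ≃L[ℝ] MDEBif.Reg n T,
      (e : MDEBif.Reg n T →L[ℝ] MDEBif.Reg n T) =
        ContinuousLinearMap.id ℝ (MDEBif.Reg n T) - fderiv ℝ (MDEBif.phi f g h lam₀) x₀) :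
    ∃ δ > 0, ∀ (x : MDEBif.Reg n T) (lam : ℝ), ‖x - x₀‖ + |lam - lam₀| < δ →
      ¬ MDEBif.IsBifurcationPoint f g h (Metric.closedBall x₀ ρ) Λ x lam := by
  obtain ⟨V, m, C, hgC1⟩ := hg.exists_stieltjesC1 hdg hT.le hh.bv
  obtain ⟨γ, hγ⟩ := hpard.exists_paramDiffContinuousAt hlam₀
  exact mainTheorem4_general hT.le hΩ (fun _ => hf.exists_caratheodoryC1 hdf hT.le) hgC1 hx₀ hρ
    hball hlam₀ hγ hiso
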